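/- **Setting.** Let $\ell:\mathbb R^d\to[0,\infty)$, $f:\mathbb R^d\to\mathbb R^d$, $B:\mathbb R^d\to\mathbb R^{d\times m}$ be locally Lipschitz, $\ell(0)=0$, $f(0)=0$, $\beta>0$, and let $$V(y_0)=\inf_{u\in L^2((0,\infty);\mathbb R^m)}\int_0^\infty\Big(\ell(y)+\tfrac\beta2|u|^2\Big)dt,\qquad \dot y=f(y)+B(y)u,\quad y(0)=y_0,$$ be the value function (the infimum is over the controls whose state exists on $[0,\infty)$), assumed finite and continuous on $\mathbb R^d$. For $v\in C^1$ put $u_v(y)=-\frac1\beta B(y)^\top\nabla v(y)$. For $u$ locally Lipschitz on an open set $\Omega$ let $y(\cdot;y_0,u)$ be the solution of $\dot y=f(y)+B(y)u(y)$, $y(0)=y_0$, and $\mathcal V_{u,T}(y_0)=\int_0^T(\ell(y)+\frac\beta2|u(y)|^2)\,dt$ along it. For $D\subset\Omega$, the triplet $(u,D,T)$ is *admissible* if $T>0$ and $y(t;y_0,u)$ exists and lies in $\Omega$ for all $t\in[0,T]$ and $y_0\in D$. Matrices carry the operator norm and $\|F\|_{Lip(\Omega)}=\sup_{x,y\in\Omega}\big(\frac{|F(x)-F(y)|}{|x-y|}+|F(x)|\big)$.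 For $\lambda>0$ let $\mathcal M_\lambda V(y)=\inf_{x\in\Omega}V(x)+\frac1{2\lambda}|x-y|^2$, let $\mathcal A_\lambda V(x)$ be the set of minimisers of $y\mapsto V(y)+\frac1{2\lambda}|x-y|^2$ over $\Omega$, and let $\Omega_V^\lambda=\{x\in\Omega:\operatorname{dist}(x,\partial\Omega)\ge2\lambda^{1/2}\|V\|_{L^\infty(\Omega)}^{1/2}\}$. Let $\rho\ge0$ be a smooth function on $\mathbb R^d$ supported in the closed unit ball with $\int\rho=1$, $\rho_\varepsilon=\varepsilon^{-d}\rho(\cdot/\varepsilon)$, and $V_{\varepsilon,\lambda}=\rho_\varepsilon*\mathcal M_\lambda V$. **Hypotheses.** Let $\Omega\subset\mathbb R^d$ be open, convex and bounded, $\omega$ open and nonempty with $\overline\omega\subset\Omega$, $\delta>0$, $w\in C^1(\overline\Omega)$, $\omega_\delta=\{y\in\Omega:w(y)<\sup_\omega w+\delta\}$ and $\overline{\omega_\delta}\subset\Omega$. Assume the Lyapunov condition (with $g=0$): $V$ is a viscosity super-solution of $-\nabla w^\top(f+Bu_V)=0$ in $\omega_\delta$, i.e. $\nabla w(\bar y)^\top(f(\bar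 y)+B(\bar y)u_h(\bar y))\le0$ whenever $\bar y\in\omega_\delta$, $h\in C^1(\Omega)$ and $V-h$ has a local minimum at $\bar y$. Assume $V$ is semi-convex on $\Omega$: $V+\frac C2|\cdot|^2$ is convex on $\Omega$ for some $C>0$. Let $h_w$ be the modulus of continuity of $\nabla w$ on $\omega_\delta$ and put $$g_\lambda(x)=\sup_{y\in\mathcal A_\lambda V(x)}\Big\{h_w(|x-y|)\Big(\|f\|_{L^\infty(\Omega)}+\tfrac1\beta\tfrac{|x-y|}\lambda\|B\|^2_{L^\infty(\Omega)}\Big)+\|f\|_{Lip(\Omega)}\|\nabla w\|_{L^\infty(\Omega)}|x-y|+\tfrac2\beta\tfrac{|x-y|^2}\lambda\|B\|^2_{Lip(\Omega)}\|\nabla w\|_{L^\infty(\Omega)}\Big\},$$ $$\sigma^1_{\varepsilon,\lambda}=\sup_{x\in\omega_\delta,\,y\in B(x,\varepsilon)}\big|g_\lambda(y)-\nabla w(y)^\top f(y)+\nabla w(x)^\top f(x)\big|,\qquad \sigma^2_\varepsilon=\sup_{x\in\omega_\delta,\,y\in B(x,\varepsilon)}\big|B(x)^\top\nabla w(x)-B(y)^\top\nabla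 w(y)\big|.$$ **Theorem.** There is $\lambda_0>0$ such that for every $\lambda\in(0,\lambda_0)$ the function $\mathcal M_\lambda V$ is differentiable on $\omega_\delta$ and all sufficiently small $\varepsilon>0$ satisfy $$\|\nabla V_{\varepsilon,\lambda}-\nabla\mathcal M_\lambda V\|^2_{L^\infty(\omega_\delta)}\le\lambda\quad\text{and}\quad\omega_\delta+B(0,\varepsilon)\subset\Omega_V^\lambda.\tag{1}$$ Let $\varepsilon(\lambda)>0$ satisfy (1) for all $\lambda\in(0,\lambda_0)$ and $\varepsilon(\lambda)\to0$ as $\lambda\to0^+$, put $u_\lambda=u_{V_{\varepsilon(\lambda),\lambda}}$, and let $\theta\in(0,1)$. Then there is $\lambda_1\in(0,\lambda_0]$ such that for every $\kappa:(0,\infty)\to(0,\infty)$ with $\kappa(s)\to\infty$ and $\kappa(s)s\to0$ as $s\to0^+$, and $$\tau_\lambda=\min\Big\{\theta\delta\Big(\sigma^1_{\varepsilon(\lambda),\lambda}+\sigma^2_{\varepsilon(\lambda)}\frac{\|B^\top\nabla\mathcal M_\lambda V\|_{L^\infty(\omega_\delta)}}\beta\Big)^{-1},\ \kappa(\lambda)\Big\}\qquad(0^{-1}:=\infty),$$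 the following hold. For all $\lambda\in(0,\lambda_1)$, $u_\lambda$ is locally Lipschitz on $\Omega$, $(u_\lambda,\omega,\tau_\lambda)$ is admissible, and $y([0,\tau_\lambda];y_0,u_\lambda)\subset\omega_\delta$ for all $y_0\in\omega$. Moreover $\lim_{\lambda\to0^+}\tau_\lambda=\infty$, and $$\lim_{\lambda\to0^+}\ \big\|\mathcal V_{u_\lambda,\tau_\lambda}+V\circ y(\tau_\lambda;\cdot,u_\lambda)-V\big\|_{L^\infty(\omega_{\delta}^\lambda)}=0,$$ where $\omega_\delta^\lambda\supset\omega$ is the set of all $y_0\in\omega_\delta$ whose trajectory satisfies $y([0,\tau_\lambda];y_0,u_\lambda)\subset\omega_\delta$. -/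

import Mathlib

open Set Filter Topology MeasureTheory
open scoped ENNReal

/-- Euclidean space `ℝⁿ`. -/
abbrev E (n : ℕ) : Type := EuclideanSpace ℝ (Fin n)

/-! ### Norms on a set

All functions whose norms occur below are continuous on the (open) sets in question, where the
`L^∞` norm is the supremum of the pointwise norm. -/

/-- The `L^∞` norm of `F` on `s`. -/
noncomputable def supNorm {n : ℕ} {Y : Type*} [NormedAddCommGroup Y]
    (F : E n → Y) (s : Set (E n)) : ℝ≥0∞ :=
  ⨆ x ∈ s, ENNReal.ofReal ‖F x‖

/-- The norm `‖F‖_{Lip(s)} = sup_{x, y ∈ s} (|F x - F y| / |x - y| + |F x|)`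
(the quotient is `0` for `x = y`). -/
noncomputable def lipNorm {n : ℕ} {Y : Type*} [NormedAddCommGroup Y]
    (F : E n → Y) (s : Set (E n)) : ℝ≥0∞ :=
  ⨆ x ∈ s, ⨆ y ∈ s, ENNReal.ofReal (‖F x - F y‖ / ‖x - y‖ + ‖F x‖)

/-- The modulus of continuity of `F` on `s`. -/
noncomputable def modulus {n : ℕ} {Y : Type*} [NormedAddCommGroup Y]
    (F : E n → Y) (s : Set (E n)) (r : ℝ) : ℝ :=
  sSup {a : ℝ | ∃ x ∈ s, ∃ y ∈ s, ‖x - y‖ ≤ r ∧ a = ‖F x - F y‖}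

/-! ### Semi-convexity, mollification, Moreau envelope -/

/-- `v` is semi-convex on `Ω` with constant `C`: `v + C/2 |·|²` is convex
(that is, `-v - C/2 |·|²` is concave). -/
def SemiconvexOn {n : ℕ} (C : ℝ) (Ω : Set (E n)) (v : E n → ℝ) : Prop :=
  ConvexOn ℝ Ω (fun x => v x + C / 2 * ‖x‖ ^ 2)

/-- Smooth mollifiers, supported in the closed unit ball. (The approximate identity property
`∫ φ(x) ρ(x/ε) ε⁻ⁿ dx → φ(0)` for continuous `φ` is a consequence.) -/
structure IsSmoothMollifier {n : ℕ} (ρ : E n → ℝ) : Prop where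
  smooth : ContDiff ℝ (⊤ : ℕ∞) ρ
  nonneg : ∀ x, 0 ≤ ρ x
  support_subset : tsupport ρ ⊆ Metric.closedBall 0 1
  integral_eq_one : ∫ x, ρ x = 1

/-- The mollification `ρ_ε ∗ φ` with `ρ_ε(x) = ε⁻ⁿ ρ(x/ε)`. -/
noncomputable def mollify {n : ℕ} (ρ : E n → ℝ) (ε : ℝ) (φ : E n → ℝ) (x : E n) : ℝ :=
  ∫ z, (ε ^ n)⁻¹ * ρ (ε⁻¹ • (x - z)) * φ z

/-- The Moreau envelope `M_λ φ(y) = inf_{x ∈ Ω} φ(x) + |x - y|² / (2λ)`. -/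
noncomputable def moreau {n : ℕ} (Ω : Set (E n)) (φ : E n → ℝ) (lam : ℝ) (y : E n) : ℝ :=
  ⨅ x : Ω, (φ x + 1 / (2 * lam) * ‖(x : E n) - y‖ ^ 2)

/-- The set `A_λ φ(x)` of minimisers over `Ω` in the definition of `M_λ φ(x)`. -/
def proxSet {n : ℕ} (Ω : Set (E n)) (φ : E n → ℝ) (lam : ℝ) (x : E n) : Set (E n) :=
  {y | y ∈ Ω ∧ ∀ z ∈ Ω, φ y + 1 / (2 * lam) * ‖x - y‖ ^ 2 ≤ φ z + 1 / (2 * lam) * ‖x - z‖ ^ 2}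

/-- `Ω^λ_φ`: the points of `Ω` whose distance to `∂Ω` is at least
`2 λ^{1/2} ‖φ‖_{L^∞(Ω)}^{1/2}`. -/
noncomputable def innerDomain {n : ℕ} (Ω : Set (E n)) (φ : E n → ℝ) (lam : ℝ) : Set (E n) :=
  {x | x ∈ Ω ∧
    2 * ENNReal.ofReal (Real.sqrt lam) * (supNorm φ Ω) ^ (1 / 2 : ℝ)
      ≤ Metric.infEDist x (frontier Ω)}

/-- `ω_δ = {y ∈ Ω : w(y) < sup_ω w + δ}`. -/
noncomputable def sublevel {n : ℕ} (Ω ω : Set (E n)) (w : E n → ℝ) (δ : ℝ) : Set (E n) :=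
  {y | y ∈ Ω ∧ w y < sSup (w '' ω) + δ}

/-! ### The control problem -/

/-- The data of the control problem: minimise `∫₀^∞ (ℓ(y) + β/2 |u|²) dt` subject to
`y' = f(y) + B(y) u`, `y(0) = y₀`. The matrices `B(y)` are regarded as linear maps, with
transpose the adjoint and norm the operator norm. -/
structure ControlProblem (d m : ℕ) where
  f : E d → E d
  B : E d → (E m →L[ℝ] E d)
  ell : E d → ℝ
  β : ℝ

namespace ControlProblem

variable {d m : ℕ}

/-- The standing assumptions on the data. -/
structure Standing (P : ControlProblem d m) : Prop where
  f_lip : LocallyLipschitz P.f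
  f_zero : P.f 0 = 0
  B_lip : LocallyLipschitz P.B
  ell_lip : LocallyLipschitz P.ell
  ell_nonneg : ∀ y, 0 ≤ P.ell y
  ell_zero : P.ell 0 = 0
  β_pos : 0 < P.β

/-- `u ∈ L²((0,∞); ℝᵐ)` and `y` is the (global, Carathéodory) solution of
`y' = f(y) + B(y) u`, `y(0) = y₀`. -/
structure IsOpenLoop (P : ControlProblem d m) (y₀ : E d) (u : ℝ → E m) (y : ℝ → E d) :
    Prop where
  memLp : MemLp u 2 (volume.restrict (Ioi (0 : ℝ)))
  continuousOn : ContinuousOn y (Ici 0)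
  eq_integral : ∀ t, 0 ≤ t → y t = y₀ + ∫ s in (0 : ℝ)..t, (P.f (y s) + P.B (y s) (u s))

/-- The cost `∫₀^∞ (ℓ(y) + β/2 |u|²) dt ∈ [0,∞]`. -/
noncomputable def cost (P : ControlProblem d m) (u : ℝ → E m) (y : ℝ → E d) : ℝ≥0∞ :=
  ∫⁻ t in Ioi (0 : ℝ), ENNReal.ofReal (P.ell (y t) + P.β / 2 * ‖u t‖ ^ 2)

/-- The value function with values in `[0,∞]`. -/
noncomputable def valueENN (P : ControlProblem d m) (y₀ : E d) : ℝ≥0∞ :=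
  ⨅ (u : ℝ → E m) (y : ℝ → E d) (_ : P.IsOpenLoop y₀ u y), P.cost u y

/-- The value function `V` as a real function (meaningful where `valueENN` is finite). -/
noncomputable def value (P : ControlProblem d m) (y₀ : E d) : ℝ := (P.valueENN y₀).toReal

/-- The feedback `u_v(y) = -β⁻¹ B(y)ᵀ ∇v(y)`. -/
noncomputable def feedback (P : ControlProblem d m) (v : E d → ℝ) (y : E d) : E m :=
  -(P.β⁻¹ • ContinuousLinearMap.adjoint (P.B y) (gradient v y))

/-- `y` solves the closed loop problem `y' = f(y) + B(y) u(y)`, `y(0) = y₀` on `[0,T]`, with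
`y(t) ∈ D` for all `t ∈ [0,T]`. -/
structure IsClosedLoop (P : ControlProblem d m) (D : Set (E d)) (u : E d → E m) (T : ℝ)
    (y₀ : E d) (y : ℝ → E d) : Prop where
  init : y 0 = y₀
  deriv : ∀ t ∈ Icc 0 T,
    HasDerivWithinAt y (P.f (y t) + P.B (y t) (u (y t))) (Icc 0 T) t
  mem : ∀ t ∈ Icc 0 T, y t ∈ D

/-- The triplet `(u, ω, T)` is admissible: `u` is locally Lipschitz on `Ω`, `T > 0`, and the closed
loop trajectories that start in `ω` exist and stay in `Ω` on `[0,T]`. -/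
structure Admissible (P : ControlProblem d m) (Ω : Set (E d)) (u : E d → E m) (ω : Set (E d))
    (T : ℝ) : Prop where
  lip : LocallyLipschitzOn Ω u
  time_pos : 0 < T
  exists_sol : ∀ y₀ ∈ ω, ∃ y, P.IsClosedLoop Ω u T y₀ y

/-- The points of `D` whose closed loop trajectory stays in `D` on `[0,T]`. -/
def stayingSet (P : ControlProblem d m) (D : Set (E d)) (u : E d → E m) (T : ℝ) : Set (E d) :=
  {y₀ | ∃ y, P.IsClosedLoop D u T y₀ y}

open Classical in
/-- The closed loop trajectory `y(·; y₀, u)` in `Ω` on `[0,T]` (unique for locally Lipschitz `u`;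
the constant `y₀` if there is none). -/
noncomputable def trajectory (P : ControlProblem d m) (Ω : Set (E d)) (u : E d → E m) (T : ℝ)
    (y₀ : E d) : ℝ → E d :=
  if h : ∃ y, P.IsClosedLoop Ω u T y₀ y then h.choose else fun _ => y₀

/-- `𝒱_{u,T}(y₀) = ∫₀ᵀ (ℓ(y) + β/2 |u(y)|²) dt` along `y = y(·; y₀, u)`. -/
noncomputable def feedbackCost (P : ControlProblem d m) (Ω : Set (E d)) (u : E d → E m) (T : ℝ)
    (y₀ : E d) : ℝ :=
  ∫ t in (0 : ℝ)..T,
    (P.ell (P.trajectory Ω u T y₀ t) + P.β / 2 * ‖u (P.trajectory Ω u T y₀ t)‖ ^ 2)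

/-- The Lyapunov hypothesis for `(ω, δ, w, φ, g)`: `φ` is a viscosity super-solution of
`-∇wᵀ (f + B u_φ) + g = 0` in `ω_δ`. -/
structure Lyapunov (P : ControlProblem d m) (Ω ω : Set (E d)) (δ : ℝ) (w φ g : E d → ℝ) :
    Prop where
  δ_pos : 0 < δ
  w_C1 : ContDiffOn ℝ 1 w Ω
  φ_cont : ContinuousOn φ Ω
  g_cont : ContinuousOn g Ω
  g_nonneg : ∀ y ∈ Ω, 0 ≤ g y
  super : ∀ y ∈ sublevel Ω ω w δ, ∀ h : E d → ℝ, ContDiffOn ℝ 1 h Ω →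
    IsLocalMin (fun x => φ x - h x) y →
    inner ℝ (gradient w y) (P.f y + P.B y (P.feedback h y)) ≤ g y

/-- The function `g_λ` attached to the Lyapunov hypothesis. -/
noncomputable def gLam (P : ControlProblem d m) (Ω ω : Set (E d)) (δ : ℝ) (w φ g : E d → ℝ)
    (lam : ℝ) (x : E d) : ℝ :=
  g x + sSup ((fun y : E d =>
      modulus (gradient w) (sublevel Ω ω w δ) ‖x - y‖ *
        ((supNorm P.f Ω).toReal
          + 1 / P.β * (‖x - y‖ / lam) * (supNorm P.B Ω).toReal ^ 2)
      + (lipNorm P.f Ω).toReal * (supNorm (gradient w) Ω).toReal * ‖x - y‖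
      + 2 / P.β * (‖x - y‖ ^ 2 / lam) * (lipNorm P.B Ω).toReal ^ 2
          * (supNorm (gradient w) Ω).toReal) '' proxSet Ω φ lam x)

/-- `σ¹_{ε,λ}`. -/
noncomputable def sigma1 (P : ControlProblem d m) (Ω ω : Set (E d)) (δ : ℝ) (w φ g : E d → ℝ)
    (ε lam : ℝ) : ℝ≥0∞ :=
  ⨆ x ∈ sublevel Ω ω w δ, ⨆ y ∈ Metric.ball x ε,
    ENNReal.ofReal |P.gLam Ω ω δ w φ g lam y - inner ℝ (gradient w y) (P.f y)
      + inner ℝ (gradient w x) (P.f x)|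

/-- `σ²_ε`. -/
noncomputable def sigma2 (P : ControlProblem d m) (Ω ω : Set (E d)) (δ : ℝ) (w : E d → ℝ)
    (ε : ℝ) : ℝ≥0∞ :=
  ⨆ x ∈ sublevel Ω ω w δ, ⨆ y ∈ Metric.ball x ε,
    ENNReal.ofReal ‖ContinuousLinearMap.adjoint (P.B x) (gradient w x)
      - ContinuousLinearMap.adjoint (P.B y) (gradient w y)‖

/-- `V_{ε,λ} = ρ_ε ∗ M_λ V`. -/
noncomputable def smoothValue (P : ControlProblem d m) (Ω : Set (E d)) (ρ : E d → ℝ)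
    (ε lam : ℝ) : E d → ℝ :=
  mollify ρ ε (moreau Ω P.value lam)

/-- The requirement on `ε = ε(λ)`: `‖∇V_{ε,λ} - ∇M_λ V‖²_{L^∞(ω_δ)} ≤ λ` and
`ω_δ + B(0,ε) ⊂ Ω^λ_V`. -/
def GoodEps (P : ControlProblem d m) (Ω ω : Set (E d)) (δ : ℝ) (w ρ : E d → ℝ)
    (ε lam : ℝ) : Prop :=
  supNorm (fun x => gradient (P.smoothValue Ω ρ ε lam) x
      - gradient (moreau Ω P.value lam) x) (sublevel Ω ω w δ) ^ 2 ≤ ENNReal.ofReal lam ∧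
    ∀ x ∈ sublevel Ω ω w δ, Metric.ball x ε ⊆ innerDomain Ω P.value lam

/-- `τ = min {θ δ (σ¹_{ε,λ} + σ²_ε ‖Bᵀ ∇M_λ V‖_{L^∞(ω_δ)} / β)⁻¹, k}` with `g = 0` and `φ = V`;
the first entry is `∞` if the bracket vanishes. -/
noncomputable def horizon (P : ControlProblem d m) (Ω ω : Set (E d)) (δ : ℝ) (w : E d → ℝ)
    (θ ε lam k : ℝ) : ℝ :=
  (min (ENNReal.ofReal (θ * δ) /
      (P.sigma1 Ω ω δ w P.value 0 ε lam
        + P.sigma2 Ω ω δ w ε *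
          supNorm (fun x => ContinuousLinearMap.adjoint (P.B x)
            (gradient (moreau Ω P.value lam) x)) (sublevel Ω ω w δ) / ENNReal.ofReal P.β))
    (ENNReal.ofReal k)).toReal

end ControlProblem

/-! Regularity. If `p` minimises `V + |y - ·|²/(2λ)`, then `ξ = (y - p)/λ` is a `C`-subgradient of
`V` at `p`. Subgradients are monotone up to `-C`, so for `λC ≤ 1/2` the point `p` is unique and
Lipschitz in `y`. Near `ω_δ` the envelope is therefore `C¹` with `∇M_λV(y) = ξ`, and `|ξ| ≤ L`
uniformly in `λ`. Conversely every subgradient `ξ` at `p` is the gradient of `M_λV` at `p + λξ`.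

Cost. Dynamic programming yields `fᵀξ + ℓ - |Bᵀξ|²/(2β) ≤ 0` at every subgradient
(`Standing.negHam_nonpos`), hence the same for `M_λV` up to `O(λ)`. Mollification changes the
gradient by at most `√λ`, so completing the square shows that `M_λV` plus the accumulated running
cost grows at most at rate `O(λ)` along closed loops in `ω_δ`. Since `τ_λ ≤ κ(λ)`, `κ(λ)λ → 0` and
`M_λV → V` uniformly, this bounds the cost defect from above; dynamic programming bounds it from
below by `0`.

Confinement. The drift of `w` at `x` is an average over `y ∈ B(x,ε)` of expressions in `∇M_λV(y)`.
The Lyapunov condition at the proximal point of `y`, transported to `x`, bounds it by the rate `σ¹ +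
σ²‖Bᵀ∇M_λV‖/β` plus an excess `c ε sup |∇M_λV|`, caused by replacing `B(x)` by `B(y)` in front of
the gradient (`Frame.closedLoop_drift_le`). The horizon `τ_λ` only controls the rate, by `θδ`; the
excess has to fit into the remaining `(1 - θ)δ`. Three situations occur.

(a) `V` has a non-zero subgradient at one of its zeros. A blow-up at that point and a Liouville
property of mollification force `ε = o(λ)` for good `ε` (`Frame.exists_eps_lt`), while the rate is
at least of order `λ`; the excess is a small multiple of the rate.

(b) Otherwise `∇M_λV` is small wherever `V` is small. If moreover the rate is at least `kε`, then
`ετ_λ` is bounded. Times at which `V` is large start windows of non-negligible cost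
(`Frame.exists_window`), and the total cost is at most `Vb + O(λτ_λ)`, so such times contribute `O(ε
+ λ)` to the integrated excess; the other times contribute little because the gradient is small
(`Frame.exists_rise_le`).

(c) If no such `k` is obtained, the drift itself vanishes, or `V = 0` on `ω_δ` and the excess
vanishes (`Frame.exists_drift_le_or_le_rate`). -/

/-! ### Moreau envelopes of semi-convex functions -/

/-- `ξ` is a `C`-subgradient of `V` at `p`, relative to `Ω`. -/
def IsSubgrad {n : ℕ} (C : ℝ) (Ω : Set (E n)) (V : E n → ℝ) (p ξ : E n) : Prop :=
  ∀ z ∈ Ω, V p + inner ℝ ξ (z - p) - C / 2 * ‖z - p‖ ^ 2 ≤ V z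

section Moreau

variable {n : ℕ} {C lam : ℝ} {Ω : Set (E n)} {V : E n → ℝ}

theorem norm_sq_convex_comb (a b : E n) (t : ℝ) :
    ‖(1 - t) • a + t • b‖ ^ 2
      = (1 - t) * ‖a‖ ^ 2 + t * ‖b‖ ^ 2 - t * (1 - t) * ‖b - a‖ ^ 2 := by
  simp only [← real_inner_self_eq_norm_sq, inner_add_left, inner_add_right, inner_sub_left,
    inner_sub_right, inner_smul_left, inner_smul_right, real_inner_comm a b]
  simp
  ring

theorem SemiconvexOn.le_comb (hV : SemiconvexOn C Ω V) {a b : E n} (ha : a ∈ Ω) (hb : b ∈ Ω)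
    {t : ℝ} (h0 : 0 ≤ t) (h1 : t ≤ 1) :
    V ((1 - t) • a + t • b)
      ≤ (1 - t) * V a + t * V b + C / 2 * (t * (1 - t) * ‖b - a‖ ^ 2) := by
  have h := hV.2 ha hb (sub_nonneg.2 h1) h0 (by ring)
  simp only [smul_eq_mul] at h
  rw [norm_sq_convex_comb] at h
  linarith

/-- Minimality is tested at `(1 - t)p + tz`. Semi-convexity and the exact convexity identity for the
square make every term divisible by `t`; letting `t → 0` and expanding `|y - z|²` leaves exactly the
subgradient inequality. No smallness of `λ` is needed. -/
theorem SemiconvexOn.isSubgrad_of_mem_proxSet (hV : SemiconvexOn C Ω V) (hlam : 0 < lam)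
    {y p : E n} (hp : p ∈ proxSet Ω V lam y) : IsSubgrad C Ω V p (lam⁻¹ • (y - p)) := by
  intro z hz
  obtain ⟨hpΩ, hmin⟩ := hp
  have key : ∀ t ∈ Ioc (0 : ℝ) 1,
      0 ≤ (V z - V p) + 1 / (2 * lam) * (‖y - z‖ ^ 2 - ‖y - p‖ ^ 2)
        - (1 - t) * ((1 / lam - C) / 2 * ‖z - p‖ ^ 2) := by
    intro t ht
    have hmem : (1 - t) • p + t • z ∈ Ω := hV.1 hpΩ hz (by linarith [ht.2]) ht.1.le (by ring)
    have h1 := hmin _ hmem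
    have h2 := hV.le_comb hpΩ hz ht.1.le ht.2
    have h3 : y - ((1 - t) • p + t • z) = (1 - t) • (y - p) + t • (y - z) := by module
    rw [h3, norm_sq_convex_comb, show y - z - (y - p) = -(z - p) by abel, norm_neg] at h1
    have h4 : 0 ≤ t * ((V z - V p) + 1 / (2 * lam) * (‖y - z‖ ^ 2 - ‖y - p‖ ^ 2)
        - (1 - t) * ((1 / lam - C) / 2 * ‖z - p‖ ^ 2)) := by
      have : 1 / lam = 2 * (1 / (2 * lam)) := by field_simp
      rw [this]
      linarith
    exact nonneg_of_mul_nonneg_right h4 ht.1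
  have hlim : Tendsto (fun t : ℝ => (V z - V p) + 1 / (2 * lam) * (‖y - z‖ ^ 2 - ‖y - p‖ ^ 2)
        - (1 - t) * ((1 / lam - C) / 2 * ‖z - p‖ ^ 2)) (𝓝[>] 0)
      (𝓝 ((V z - V p) + 1 / (2 * lam) * (‖y - z‖ ^ 2 - ‖y - p‖ ^ 2)
        - (1 - 0) * ((1 / lam - C) / 2 * ‖z - p‖ ^ 2))) := by
    apply Tendsto.mono_left _ nhdsWithin_le_nhds
    exact Continuous.tendsto (by fun_prop) 0
  have h := ge_of_tendsto hlim (by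
    filter_upwards [Ioc_mem_nhdsGT (zero_lt_one' ℝ)] with t ht using key t ht)
  have h5 : ‖y - z‖ ^ 2 = ‖y - p‖ ^ 2 - 2 * inner ℝ (y - p) (z - p) + ‖z - p‖ ^ 2 := by
    rw [← norm_sub_sq_real]; congr 2; abel
  rw [h5] at h
  rw [inner_smul_left]
  simp only [conj_trivial]
  have e1 : 1 / lam = lam⁻¹ := one_div _
  have e2 : 1 / (2 * lam) = lam⁻¹ / 2 := by field_simp
  rw [e1, e2] at h
  linarith

/-- The converse direction: the proximal penalty `1/(2λ)` dominates the concave error `C/2` as soon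
as `λC ≤ 1`. This lets every subgradient be seen as a gradient of the envelope. -/
theorem IsSubgrad.mem_proxSet (hlam : 0 < lam) (hC : lam * C ≤ 1) {p ξ : E n} (hp : p ∈ Ω)
    (h : IsSubgrad C Ω V p ξ) : p ∈ proxSet Ω V lam (p + lam • ξ) := by
  refine ⟨hp, fun z hz => ?_⟩
  have h1 := h z hz
  have h2 : ‖p + lam • ξ - z‖ ^ 2
      = ‖p + lam • ξ - p‖ ^ 2 - 2 * (lam * inner ℝ ξ (z - p)) + ‖z - p‖ ^ 2 := by
    rw [show p + lam • ξ - p = lam • ξ by abel, show p + lam • ξ - z = lam • ξ - (z - p) by abel,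
      norm_sub_sq_real, inner_smul_left]
    simp
  rw [h2]
  have h3 : 1 / (2 * lam) * (‖p + lam • ξ - p‖ ^ 2 - 2 * (lam * inner ℝ ξ (z - p)) + ‖z - p‖ ^ 2)
      = 1 / (2 * lam) * ‖p + lam • ξ - p‖ ^ 2 - inner ℝ ξ (z - p)
        + 1 / (2 * lam) * ‖z - p‖ ^ 2 := by
    field_simp
  have h4 : C / 2 * ‖z - p‖ ^ 2 ≤ 1 / (2 * lam) * ‖z - p‖ ^ 2 := by
    refine mul_le_mul_of_nonneg_right ?_ (by positivity)
    rw [div_le_div_iff₀ (by norm_num) (by positivity)]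
    linarith
  linarith

theorem IsSubgrad.inner_sub_ge {p q ξ η : E n} (hp : p ∈ Ω) (hq : q ∈ Ω)
    (h : IsSubgrad C Ω V p ξ) (h' : IsSubgrad C Ω V q η) :
    -C * ‖q - p‖ ^ 2 ≤ inner ℝ (η - ξ) (q - p) := by
  have h1 := h q hq
  have h2 := h' p hp
  rw [norm_sub_rev, ← neg_sub q p, inner_neg_right] at h2
  rw [inner_sub_left]
  linarith

/-- Monotonicity up to `-C` of the subgradients `(y - p)/λ` gives `(1 - λC)|p' - p|² ≤ ⟨y' - y, p' -
p⟩`. With `y' = y` this contains uniqueness of the proximal point. -/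
theorem SemiconvexOn.proxSet_lipschitz (hV : SemiconvexOn C Ω V) (hlam : 0 < lam)
    (hC : lam * C ≤ 1 / 2) {y y' p p' : E n} (hp : p ∈ proxSet Ω V lam y)
    (hp' : p' ∈ proxSet Ω V lam y') : ‖p' - p‖ ≤ 2 * ‖y' - y‖ := by
  have h := (hV.isSubgrad_of_mem_proxSet hlam hp).inner_sub_ge hp.1 hp'.1
    (hV.isSubgrad_of_mem_proxSet hlam hp')
  rw [← smul_sub, inner_smul_left, show y' - p' - (y - p) = (y' - y) - (p' - p) by abel,
    inner_sub_left, real_inner_self_eq_norm_sq] at h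
  simp only [conj_trivial] at h
  have h1 : inner ℝ (y' - y) (p' - p) ≤ ‖y' - y‖ * ‖p' - p‖ := real_inner_le_norm _ _
  have h2 : -(lam * C) * ‖p' - p‖ ^ 2 ≤ inner ℝ (y' - y) (p' - p) - ‖p' - p‖ ^ 2 := by
    have := mul_le_mul_of_nonneg_left h hlam.le
    rw [← mul_assoc lam lam⁻¹, mul_inv_cancel₀ hlam.ne', one_mul] at this
    linarith
  have h3 : ‖p' - p‖ ^ 2 ≤ 2 * ‖y' - y‖ * ‖p' - p‖ := by
    nlinarith [sq_nonneg ‖p' - p‖]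
  rcases (norm_nonneg (p' - p)).eq_or_lt with h0 | h0
  · rw [← h0]; positivity
  · exact le_of_mul_le_mul_right (by linarith [sq ‖p' - p‖]) h0

/-- `Ω` is not compact, but outside the ball of radius `r` the penalty already exceeds `Vb ≥ V(y)`,
so minimising over the closed ball is enough. -/
theorem exists_mem_proxSet {Vb r : ℝ} (hlam : 0 < lam) (hc : ContinuousOn V Ω)
    (h0 : ∀ x ∈ Ω, 0 ≤ V x) (hb : ∀ x ∈ Ω, V x ≤ Vb) (hr : 0 < r) (hlr : 2 * lam * Vb ≤ r ^ 2)
    {y : E n} (hy : Metric.closedBall y r ⊆ Ω) : (proxSet Ω V lam y).Nonempty := by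
  obtain ⟨p, hp, hmin⟩ := (isCompact_closedBall y r).exists_isMinOn
    ⟨y, Metric.mem_closedBall_self hr.le⟩
    (f := fun z => V z + 1 / (2 * lam) * ‖y - z‖ ^ 2)
    ((hc.mono hy).add (by fun_prop))
  refine ⟨p, hy hp, fun z hz => ?_⟩
  by_cases hzb : z ∈ Metric.closedBall y r
  · exact hmin hzb
  · have hyy := hmin (Metric.mem_closedBall_self (x := y) hr.le)
    simp only [mem_ofPred_eq, sub_self, norm_zero] at hyy
    have h1 : r ≤ ‖y - z‖ := by
      rw [Metric.mem_closedBall, not_le, dist_eq_norm, norm_sub_rev] at hzb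
      exact hzb.le
    have h2 : r ^ 2 ≤ ‖y - z‖ ^ 2 := by gcongr
    have h3 : Vb ≤ 1 / (2 * lam) * ‖y - z‖ ^ 2 := by
      rw [one_div, ← div_eq_inv_mul, le_div_iff₀ (by positivity)]
      linarith
    have h4 := hb y (hy (Metric.mem_closedBall_self hr.le))
    have h5 := h0 z hz
    norm_num at hyy
    norm_num at h3 ⊢
    linarith

theorem norm_sub_sq_le_of_mem_proxSet {Vb : ℝ} (hlam : 0 < lam)
    (h0 : ∀ x ∈ Ω, 0 ≤ V x) (hb : ∀ x ∈ Ω, V x ≤ Vb) {y p : E n} (hy : y ∈ Ω)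
    (hp : p ∈ proxSet Ω V lam y) : ‖y - p‖ ^ 2 ≤ 2 * lam * Vb := by
  have h := hp.2 y hy
  have h1 := h0 p hp.1
  have h2 := hb y hy
  simp only [sub_self, norm_zero] at h
  have h3 : 1 / (2 * lam) * ‖y - p‖ ^ 2 ≤ Vb := by
    have : (1 / (2 * lam) * (0 : ℝ) ^ 2) = 0 := by ring
    linarith
  rw [one_div, ← div_eq_inv_mul, div_le_iff₀ (by positivity)] at h3
  linarith

/-- Without a lower bound the real infimum in `moreau` would take the default value `0`;
non-negativity of `V` on `Ω` excludes this. -/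
theorem bddBelow_moreau (hlam : 0 < lam) (h0 : ∀ x ∈ Ω, 0 ≤ V x) (y : E n) :
    BddBelow (range fun x : Ω => V x + 1 / (2 * lam) * ‖(x : E n) - y‖ ^ 2) := by
  refine ⟨0, ?_⟩
  rintro _ ⟨x, rfl⟩
  have := h0 x x.2
  positivity

theorem moreau_le (hlam : 0 < lam) (h0 : ∀ x ∈ Ω, 0 ≤ V x) (y : E n) {z : E n} (hz : z ∈ Ω) :
    moreau Ω V lam y ≤ V z + 1 / (2 * lam) * ‖z - y‖ ^ 2 :=
  ciInf_le (bddBelow_moreau hlam h0 y) (⟨z, hz⟩ : Ω)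

theorem moreau_le_self (hlam : 0 < lam) (h0 : ∀ x ∈ Ω, 0 ≤ V x) {y : E n} (hy : y ∈ Ω) :
    moreau Ω V lam y ≤ V y := by
  simpa using moreau_le hlam h0 y hy

theorem moreau_nonneg (hlam : 0 < lam) (h0 : ∀ x ∈ Ω, 0 ≤ V x) (y : E n) :
    0 ≤ moreau Ω V lam y := by
  refine Real.iInf_nonneg fun x => ?_
  have := h0 x x.2
  positivity

theorem moreau_eq {y p : E n} (hlam : 0 < lam) (h0 : ∀ x ∈ Ω, 0 ≤ V x)
    (hp : p ∈ proxSet Ω V lam y) :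
    moreau Ω V lam y = V p + 1 / (2 * lam) * ‖p - y‖ ^ 2 := by
  have : Nonempty Ω := ⟨⟨p, hp.1⟩⟩
  refine le_antisymm (moreau_le hlam h0 y hp.1) (le_ciInf fun x => ?_)
  rw [norm_sub_rev p, norm_sub_rev (x : E n)]
  exact hp.2 x x.2

/-- The envelope inherits a quadratic lower support from `V`. Each competitor `x` for `y'` is
bounded below by the subgradient inequality at `p`; the loss `C/2 |x - p|²` splits into `C|h|²`,
with `h = y' - y`, and a part absorbed by the penalty because `C ≤ 1/(2λ)`. -/
theorem SemiconvexOn.le_moreau_sub (hV : SemiconvexOn C Ω V) (hlam : 0 < lam)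
    (hC0 : 0 ≤ C) (hC : lam * C ≤ 1 / 2) (h0 : ∀ x ∈ Ω, 0 ≤ V x) {y p : E n}
    (hp : p ∈ proxSet Ω V lam y) (y' : E n) :
    inner ℝ (lam⁻¹ • (y - p)) (y' - y) - C * ‖y' - y‖ ^ 2
      ≤ moreau Ω V lam y' - moreau Ω V lam y := by
  rw [moreau_eq hlam h0 hp, le_sub_iff_add_le]
  have : Nonempty Ω := ⟨⟨p, hp.1⟩⟩
  refine le_ciInf fun x => ?_
  have h1 := hV.isSubgrad_of_mem_proxSet hlam hp x x.2
  set ξ := lam⁻¹ • (y - p) with hξ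
  have hy : y - p = lam • ξ := by rw [hξ, smul_smul, mul_inv_cancel₀ hlam.ne', one_smul]
  set k := (x : E n) - p with hk
  set h := y' - y with hh
  have h2 : (x : E n) - y' = (k - h) - lam • ξ := by rw [← hy]; simp only [hk, hh]; abel
  have h3 : ‖p - y‖ = ‖lam • ξ‖ := by rw [← hy, norm_sub_rev]
  rw [h2, norm_sub_sq_real (k - h), inner_smul_right, h3]
  have h4 : ‖k‖ ^ 2 ≤ 2 * (‖k - h‖ ^ 2 + ‖h‖ ^ 2) := by
    have := parallelogram_law_with_norm ℝ (k - h) h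
    rw [sub_add_cancel] at this
    nlinarith [sq_nonneg ‖k - h - h‖]
  have h5 : 1 / (2 * lam) * (‖k - h‖ ^ 2 - 2 * (lam * inner ℝ (k - h) ξ) + ‖lam • ξ‖ ^ 2)
      = 1 / (2 * lam) * ‖k - h‖ ^ 2 - (inner ℝ ξ k - inner ℝ ξ h)
        + 1 / (2 * lam) * ‖lam • ξ‖ ^ 2 := by
    rw [real_inner_comm, inner_sub_right]; field_simp
  rw [h5]
  have h6 : C * ‖k - h‖ ^ 2 ≤ 1 / (2 * lam) * ‖k - h‖ ^ 2 := by
    gcongr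
    rw [le_div_iff₀ (by positivity)]
    linarith
  have h7 : C / 2 * ‖k‖ ^ 2 ≤ C * ‖k - h‖ ^ 2 + C * ‖h‖ ^ 2 := by
    have := mul_le_mul_of_nonneg_left h4 (by positivity : 0 ≤ C / 2)
    linarith
  linarith

theorem SemiconvexOn.moreau_sub_le (hV : SemiconvexOn C Ω V) (hlam : 0 < lam)
    (hC0 : 0 ≤ C) (hC : lam * C ≤ 1 / 2) (h0 : ∀ x ∈ Ω, 0 ≤ V x) {y' p' : E n}
    (hp' : p' ∈ proxSet Ω V lam y') (y : E n) :
    moreau Ω V lam y' - moreau Ω V lam y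
      ≤ inner ℝ (lam⁻¹ • (y' - p')) (y' - y) + C * ‖y' - y‖ ^ 2 := by
  have := hV.le_moreau_sub hlam hC0 hC h0 hp' y
  rw [← neg_sub y' y, inner_neg_right, norm_neg] at this
  linarith

/-- The lower supports at `y` and at `y'` bound the increment from both sides, with slopes `(y -
p)/λ` and `(y' - p')/λ`. These differ by at most `3|y' - y|/λ` since the proximal map is
2-Lipschitz, so the remainder is quadratic. -/
theorem SemiconvexOn.hasGradientAt_moreau (hV : SemiconvexOn C Ω V) (hlam : 0 < lam)
    (hC0 : 0 ≤ C) (hC : lam * C ≤ 1 / 2) (h0 : ∀ x ∈ Ω, 0 ≤ V x) {y p : E n}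
    (hp : p ∈ proxSet Ω V lam y) (hne : ∀ᶠ y' in 𝓝 y, (proxSet Ω V lam y').Nonempty) :
    HasGradientAt (moreau Ω V lam) (lam⁻¹ • (y - p)) y := by
  rw [hasGradientAt_iff_isLittleO]
  have hO : (fun y' => moreau Ω V lam y' - moreau Ω V lam y
      - inner ℝ (lam⁻¹ • (y - p)) (y' - y)) =O[𝓝 y] fun y' => ‖y' - y‖ ^ 2 := by
    refine Asymptotics.IsBigO.of_bound (C + 3 * lam⁻¹) ?_
    filter_upwards [hne] with y' ⟨p', hp'⟩
    have h1 := hV.le_moreau_sub hlam hC0 hC h0 hp y'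
    have h2 := hV.moreau_sub_le hlam hC0 hC h0 hp' y
    have h3 := hV.proxSet_lipschitz hlam hC hp hp'
    have h4 : inner ℝ (lam⁻¹ • (y' - p')) (y' - y) - inner ℝ (lam⁻¹ • (y - p)) (y' - y)
        ≤ 3 * lam⁻¹ * ‖y' - y‖ ^ 2 := by
      rw [← inner_sub_left, ← smul_sub, inner_smul_left,
        show y' - p' - (y - p) = (y' - y) - (p' - p) by abel]
      simp only [conj_trivial]
      have h5 : inner ℝ (y' - y - (p' - p)) (y' - y) ≤ 3 * ‖y' - y‖ ^ 2 := by
        refine (real_inner_le_norm _ _).trans ?_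
        have := norm_sub_le (y' - y) (p' - p)
        nlinarith [norm_nonneg (y' - y)]
      have := mul_le_mul_of_nonneg_left h5 (inv_pos.2 hlam).le
      linarith
    rw [Real.norm_eq_abs, Real.norm_eq_abs, abs_of_nonneg (by positivity : 0 ≤ ‖y' - y‖ ^ 2),
      abs_le, add_mul]
    have : 0 ≤ 3 * lam⁻¹ * ‖y' - y‖ ^ 2 := by positivity
    have : 0 ≤ C * ‖y' - y‖ ^ 2 := by positivity
    constructor <;> linarith
  refine hO.trans_isLittleO ?_
  have := Asymptotics.isLittleO_norm_pow_id (E' := E n) (one_lt_two)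
  have h2 := this.comp_tendsto (show Tendsto (fun y' => y' - y) (𝓝 y) (𝓝 0) from by
    have : Tendsto (fun y' => y' - y) (𝓝 y) (𝓝 (y - y)) := Continuous.tendsto (by fun_prop) y
    simpa using this)
  exact h2

theorem abs_moreau_sub_le {R : ℝ} (hlam : 0 < lam) (h0 : ∀ x ∈ Ω, 0 ≤ V x) (hne : Ω.Nonempty)
    (hR : ∀ x ∈ Ω, ‖x‖ ≤ R) (y y' : E n) :
    moreau Ω V lam y' - moreau Ω V lam y
      ≤ 1 / (2 * lam) * (2 * R + ‖y‖ + ‖y'‖) * ‖y' - y‖ := by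
  have : Nonempty Ω := hne.to_subtype
  rw [sub_le_comm]
  refine le_ciInf fun x => ?_
  have h1 := moreau_le hlam h0 y' x.2
  have h2 : ‖(x : E n) - y'‖ ^ 2 ≤ ‖(x : E n) - y‖ ^ 2 + (2 * R + ‖y‖ + ‖y'‖) * ‖y' - y‖ := by
    have e1 : ‖(x : E n) - y'‖ - ‖(x : E n) - y‖ ≤ ‖y' - y‖ := by
      have := norm_sub_norm_le ((x : E n) - y') ((x : E n) - y)
      rwa [sub_sub_sub_cancel_left, norm_sub_rev y y'] at this
    have e2 : ‖(x : E n) - y'‖ + ‖(x : E n) - y‖ ≤ 2 * R + ‖y‖ + ‖y'‖ := by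
      have := norm_sub_le (x : E n) y
      have := norm_sub_le (x : E n) y'
      have := hR x x.2
      linarith
    have e3 : ‖(x : E n) - y'‖ ^ 2 - ‖(x : E n) - y‖ ^ 2
      = (‖(x : E n) - y'‖ + ‖(x : E n) - y‖) * (‖(x : E n) - y'‖ - ‖(x : E n) - y‖) := by ring
    have : (‖(x : E n) - y'‖ + ‖(x : E n) - y‖) * (‖(x : E n) - y'‖ - ‖(x : E n) - y‖)
        ≤ (2 * R + ‖y‖ + ‖y'‖) * ‖y' - y‖ := by
      refine (mul_le_mul_of_nonneg_left e1 (by positivity)).trans ?_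
      gcongr
    linarith
  have h3 := mul_le_mul_of_nonneg_left h2 (by positivity : 0 ≤ 1 / (2 * lam))
  linarith

theorem continuous_moreau (hlam : 0 < lam) (h0 : ∀ x ∈ Ω, 0 ≤ V x) (hne : Ω.Nonempty)
    (hb : Bornology.IsBounded Ω) : Continuous (moreau Ω V lam) := by
  obtain ⟨R, hR⟩ := hb.exists_norm_le
  rw [continuous_iff_continuousAt]
  intro y
  rw [ContinuousAt, tendsto_iff_dist_tendsto_zero]
  have hlim : Tendsto (fun y' : E n => 1 / (2 * lam) * (2 * R + ‖y‖ + ‖y'‖) * ‖y' - y‖) (𝓝 y)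
      (𝓝 (1 / (2 * lam) * (2 * R + ‖y‖ + ‖y‖) * ‖y - y‖)) := Continuous.tendsto (by fun_prop) y
  simp only [sub_self, norm_zero, mul_zero] at hlim
  refine squeeze_zero (fun _ => dist_nonneg) (fun y' => ?_) hlim
  rw [Real.dist_eq, abs_sub_le_iff]
  refine ⟨abs_moreau_sub_le hlam h0 hne hR y y', ?_⟩
  have := abs_moreau_sub_le hlam h0 hne hR y' y
  rw [norm_sub_rev y y'] at this
  linarith

/-- The subgradient inequality at `p + rξ/|ξ|` reads `r|ξ| ≤ Vb + C r²/2`, because `0 ≤ V ≤ Vb`. -/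
theorem IsSubgrad.norm_le {Vb r : ℝ} (hC : 0 ≤ C) (h0 : ∀ x ∈ Ω, 0 ≤ V x)
    (hb : ∀ x ∈ Ω, V x ≤ Vb) (hr : 0 < r) {p ξ : E n} (hp : Metric.closedBall p r ⊆ Ω)
    (h : IsSubgrad C Ω V p ξ) : ‖ξ‖ ≤ Vb / r + C / 2 * r := by
  have hVb : 0 ≤ Vb := (h0 p (hp (Metric.mem_closedBall_self hr.le))).trans
    (hb p (hp (Metric.mem_closedBall_self hr.le)))
  rcases (norm_nonneg ξ).eq_or_lt with h1 | h1
  · rw [← h1]; positivity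
  · have hz : p + (r / ‖ξ‖) • ξ ∈ Ω := by
      apply hp
      rw [Metric.mem_closedBall, dist_eq_norm, add_sub_cancel_left, norm_smul, Real.norm_eq_abs,
        abs_of_pos (by positivity), div_mul_cancel₀ _ h1.ne']
    have h2 := h _ hz
    rw [add_sub_cancel_left, inner_smul_right, real_inner_self_eq_norm_sq, norm_smul,
      Real.norm_eq_abs, abs_of_pos (by positivity), div_mul_cancel₀ _ h1.ne'] at h2
    have h3 : r / ‖ξ‖ * ‖ξ‖ ^ 2 = r * ‖ξ‖ := by field_simp
    have h4 := h0 p (hp (Metric.mem_closedBall_self hr.le))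
    have h5 := hb _ hz
    rw [h3] at h2
    have h6 : r * ‖ξ‖ ≤ Vb + C / 2 * r ^ 2 := by linarith
    have : Vb / r + C / 2 * r = (Vb + C / 2 * r ^ 2) / r := by field_simp
    rw [this, le_div_iff₀ hr]
    linarith

theorem IsSubgrad.of_tendsto {ι : Type*} {l : Filter ι} [l.NeBot] {p ξ : ι → E n} {p₀ ξ₀ : E n}
    (hV : ContinuousAt V p₀) (h : ∀ᶠ i in l, IsSubgrad C Ω V (p i) (ξ i))
    (hp : Tendsto p l (𝓝 p₀)) (hξ : Tendsto ξ l (𝓝 ξ₀)) : IsSubgrad C Ω V p₀ ξ₀ := by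
  intro z hz
  have hlim : Tendsto (fun i => V (p i) + inner ℝ (ξ i) (z - p i) - C / 2 * ‖z - p i‖ ^ 2) l
      (𝓝 (V p₀ + inner ℝ ξ₀ (z - p₀) - C / 2 * ‖z - p₀‖ ^ 2)) :=
    ((hV.tendsto.comp hp).add (hξ.inner (tendsto_const_nhds.sub hp))).sub
      (((tendsto_const_nhds.sub hp).norm.pow 2).const_mul _)
  exact le_of_tendsto hlim (h.mono fun i hi => hi z hz)

/-- A zero of the non-negative `V` is a minimum. In the blow-up argument this supplies a second
subgradient besides the non-zero one. -/
theorem isSubgrad_zero (hC : 0 ≤ C) (h0 : ∀ x ∈ Ω, 0 ≤ V x) {p : E n} (hp : V p = 0) :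
    IsSubgrad C Ω V p 0 := by
  intro z hz
  have := h0 z hz
  have : 0 ≤ C / 2 * ‖z - p‖ ^ 2 := by positivity
  simp only [hp, inner_zero_left]
  linarith

end Moreau

/-! ### Mollification -/

section Mollify

variable {n : ℕ} {ρ : E n → ℝ}

/-- The set where `ρ` is non-zero is open, so it lies in the interior of the closed unit ball.
Averages therefore only see the open ball `B(x,ε)`, as in `sigma1` and `sigma2`. -/
theorem IsSmoothMollifier.norm_lt_one (hρ : IsSmoothMollifier ρ) {z : E n} (hz : ρ z ≠ 0) :
    ‖z‖ < 1 := by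
  have hopen : IsOpen (Function.support ρ) := hρ.smooth.continuous.isOpen_support
  have h1 : Function.support ρ ⊆ interior (Metric.closedBall 0 1) :=
    interior_maximal ((subset_tsupport ρ).trans hρ.support_subset) hopen
  rw [interior_closedBall (0 : E n) one_ne_zero] at h1
  simpa using h1 hz

theorem IsSmoothMollifier.hasCompactSupport (hρ : IsSmoothMollifier ρ) : HasCompactSupport ρ :=
  (isCompact_closedBall (0 : E n) 1).of_isClosed_subset (isClosed_tsupport ρ) hρ.support_subset

theorem IsSmoothMollifier.integrable (hρ : IsSmoothMollifier ρ) : Integrable ρ :=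
  hρ.smooth.continuous.integrable_of_hasCompactSupport hρ.hasCompactSupport

theorem mollify_eq {ε : ℝ} (hε : 0 < ε) (φ : E n → ℝ) (x : E n) :
    mollify ρ ε φ x = ∫ z, ρ z * φ (x - ε • z) := by
  unfold mollify
  rw [← integral_sub_left_eq_self _ volume x]
  have h := Measure.integral_comp_smul (volume : Measure (E n))
    (fun z => (ε ^ n)⁻¹ * ρ (ε⁻¹ • (x - (x - z))) * φ (x - z)) ε
  have h2 : (fun z : E n => (ε ^ n)⁻¹ * ρ (ε⁻¹ • (x - (x - ε • z))) * φ (x - ε • z))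
      = fun z => (ε ^ n)⁻¹ * (ρ z * φ (x - ε • z)) := by
    funext z
    rw [sub_sub_cancel, smul_smul, inv_mul_cancel₀ hε.ne', one_smul, mul_assoc]
  rw [h2, integral_const_mul, finrank_euclideanSpace_fin, abs_of_pos (by positivity),
    smul_eq_mul] at h
  exact (mul_left_cancel₀ (by positivity) h).symm

theorem IsSmoothMollifier.contDiff_mollify (hρ : IsSmoothMollifier ρ) {ε : ℝ} (hε : 0 < ε)
    {φ : E n → ℝ} (hφ : Continuous φ) : ContDiff ℝ (⊤ : ℕ∞) (mollify ρ ε φ) := by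
  have hs : ContDiff ℝ (⊤ : ℕ∞) (fun z : E n => (ε ^ n)⁻¹ * ρ (ε⁻¹ • z)) :=
    contDiff_const.mul (hρ.smooth.comp (contDiff_const_smul _))
  have hc : HasCompactSupport (fun z : E n => (ε ^ n)⁻¹ * ρ (ε⁻¹ • z)) :=
    (hρ.hasCompactSupport.comp_smul (inv_ne_zero hε.ne')).mul_left
  have h := hc.contDiff_convolution_right (ContinuousLinearMap.lsmul ℝ ℝ)
    (hφ.locallyIntegrable (μ := (volume : Measure (E n)))) hs
  convert h using 1
  funext x
  simp only [mollify, convolution_def, ContinuousLinearMap.lsmul_apply, smul_eq_mul]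
  exact integral_congr_ae (ae_of_all _ fun z => mul_comm _ _)

theorem IsSmoothMollifier.sub_smul_mem_ball (hρ : IsSmoothMollifier ρ) {ε : ℝ} (hε : 0 < ε)
    {z : E n} (hz : ρ z ≠ 0) (x : E n) : x - ε • z ∈ Metric.ball x ε := by
  rw [Metric.mem_ball, dist_eq_norm, sub_sub_cancel_left, norm_neg, norm_smul, Real.norm_eq_abs,
    abs_of_pos hε]
  have := hρ.norm_lt_one hz
  nlinarith

theorem IsSmoothMollifier.integrable_smul (hρ : IsSmoothMollifier ρ) {Y : Type*}
    [NormedAddCommGroup Y] [NormedSpace ℝ Y] {ε : ℝ} (hε : 0 < ε) {G : E n → Y}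
    {x : E n} (hG : ContinuousOn G (Metric.closedBall x ε)) :
    Integrable (fun z => ρ z • G (x - ε • z)) := by
  have hm : MapsTo (fun z : E n => x - ε • z) (Metric.closedBall 0 1) (Metric.closedBall x ε) := by
    intro z hz
    rw [mem_closedBall_zero_iff] at hz
    rw [Metric.mem_closedBall, dist_eq_norm, sub_sub_cancel_left, norm_neg, norm_smul,
      Real.norm_eq_abs, abs_of_pos hε]
    nlinarith
  have h1 : ContinuousOn (fun z => ρ z • G (x - ε • z)) (Metric.closedBall 0 1) :=
    hρ.smooth.continuous.continuousOn.smul (hG.comp (by fun_prop) hm)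
  have h2 := h1.integrableOn_compact (isCompact_closedBall 0 1) (μ := volume)
  refine h2.integrable_of_forall_notMem_eq_zero fun z hz => ?_
  rw [mem_closedBall_zero_iff] at hz
  by_contra hne
  exact hz (hρ.norm_lt_one (left_ne_zero_of_smul hne)).le

theorem IsSmoothMollifier.hasGradientAt_mollify (hρ : IsSmoothMollifier ρ) {ε r L : ℝ}
    (hε : 0 < ε) (hr : 0 < r) {φ : E n → ℝ} (hφ : Continuous φ) {G : E n → E n} {x : E n}
    (hG : ∀ y ∈ Metric.ball x (ε + r), HasGradientAt φ (G y) y)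
    (hGc : ContinuousOn G (Metric.ball x (ε + r)))
    (hGb : ∀ y ∈ Metric.ball x (ε + r), ‖G y‖ ≤ L) :
    HasGradientAt (mollify ρ ε φ) (∫ z, ρ z • G (x - ε • z)) x := by
  have hmem : ∀ z, ρ z ≠ 0 → ∀ y ∈ Metric.ball x r, y - ε • z ∈ Metric.ball x (ε + r) := by
    intro z hz y hy
    have h1 := hρ.sub_smul_mem_ball hε hz y
    rw [Metric.mem_ball] at *
    linarith [dist_triangle (y - ε • z) y x]
  have hint : Integrable fun z => ρ z • G (x - ε • z) :=
    hρ.integrable_smul hε (hGc.mono (Metric.closedBall_subset_ball (by linarith)))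
  have h := hasFDerivAt_integral_of_dominated_of_fderiv_le (μ := (volume : Measure (E n)))
    (F := fun y z => ρ z * φ (y - ε • z))
    (F' := fun y z => ρ z • InnerProductSpace.toDual ℝ (E n) (G (y - ε • z)))
    (bound := fun z => ρ z * L) (x₀ := x) (Metric.ball_mem_nhds x hr)
    (Eventually.of_forall fun y => (hρ.smooth.continuous.mul
      (hφ.comp (by fun_prop))).aestronglyMeasurable)
    ((hρ.smooth.continuous.mul (hφ.comp (by fun_prop))).integrable_of_hasCompactSupport
      hρ.hasCompactSupport.mul_right)
    (by
      have := (InnerProductSpace.toDual ℝ (E n)).continuous.comp_aestronglyMeasurable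
        hint.aestronglyMeasurable
      refine this.congr (ae_of_all _ fun z => ?_)
      simp)
    (ae_of_all _ fun z y hy => by
      rw [norm_smul, LinearIsometryEquiv.norm_map, Real.norm_eq_abs, abs_of_nonneg (hρ.nonneg z)]
      by_cases hz : ρ z = 0
      · simp [hz]
      · exact mul_le_mul_of_nonneg_left (hGb _ (hmem z hz y hy)) (hρ.nonneg z))
    (hρ.integrable.mul_const L)
    (ae_of_all _ fun z y hy => by
      by_cases hz : ρ z = 0
      · simpa [hz] using hasFDerivAt_const (0 : ℝ) y
      · have h1 := (hG _ (hmem z hz y hy)).hasFDerivAt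
        have h2 : HasFDerivAt (fun y : E n => y - ε • z) (ContinuousLinearMap.id ℝ (E n)) y :=
          (hasFDerivAt_id y).sub_const _
        have h3 := (HasFDerivAt.comp y h1 h2).const_mul (ρ z)
        simpa using h3)
  have heq : (fun y => ∫ z, ρ z * φ (y - ε • z)) = mollify ρ ε φ :=
    funext fun y => (mollify_eq hε φ y).symm
  rw [heq] at h
  have h4 : ∫ z, ρ z • InnerProductSpace.toDual ℝ (E n) (G (x - ε • z))
      = InnerProductSpace.toDual ℝ (E n) (∫ z, ρ z • G (x - ε • z)) := by
    have := (InnerProductSpace.toDual ℝ (E n)).toContinuousLinearEquiv.toContinuousLinearMap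
      |>.integral_comp_comm hint
    refine Eq.trans (integral_congr_ae (ae_of_all _ fun z => ?_)) this
    simp
  rw [h4] at h
  exact h

/-- Averaging against a mollifier preserves pointwise bounds of a linear functional. -/
theorem IsSmoothMollifier.inner_integral_le (hρ : IsSmoothMollifier ρ) {ε : ℝ} (hε : 0 < ε)
    {G : E n → E n} {x : E n} (hG : ContinuousOn G (Metric.closedBall x ε)) {b : E n} {s : ℝ}
    (hs : ∀ y ∈ Metric.ball x ε, inner ℝ b (G y) ≤ s) :
    inner ℝ b (∫ z, ρ z • G (x - ε • z)) ≤ s := by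
  rw [← integral_inner (hρ.integrable_smul hε hG)]
  have : s = ∫ z, ρ z * s := by rw [integral_mul_const, hρ.integral_eq_one, one_mul]
  rw [this]
  refine integral_mono ((hρ.integrable_smul hε hG).const_inner b) (hρ.integrable.mul_const s)
    fun z => ?_
  simp only [inner_smul_right]
  by_cases hz : ρ z = 0
  · simp [hz]
  · exact mul_le_mul_of_nonneg_left (hs _ (hρ.sub_smul_mem_ball hε hz x)) (hρ.nonneg z)

theorem IsSmoothMollifier.norm_integral_sub_le (hρ : IsSmoothMollifier ρ) {ε : ℝ} (hε : 0 < ε)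
    {G : E n → E n} {x : E n} (hG : ContinuousOn G (Metric.closedBall x ε)) {g : E n} {s : ℝ}
    (hs : ∀ y ∈ Metric.ball x ε, ‖G y - g‖ ≤ s) :
    ‖(∫ z, ρ z • G (x - ε • z)) - g‖ ≤ s := by
  have h1 : g = ∫ z, ρ z • g := by rw [integral_smul_const, hρ.integral_eq_one, one_smul]
  rw [h1, ← integral_sub (hρ.integrable_smul hε hG) (hρ.integrable.smul_const g)]
  have : s = ∫ z, ρ z * s := by rw [integral_mul_const, hρ.integral_eq_one, one_mul]
  rw [this]
  refine norm_integral_le_of_norm_le (hρ.integrable.mul_const s) (ae_of_all _ fun z => ?_)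
  rw [← smul_sub, norm_smul, Real.norm_eq_abs, abs_of_nonneg (hρ.nonneg z)]
  by_cases hz : ρ z = 0
  · simp [hz]
  · exact mul_le_mul_of_nonneg_left (hs _ (hρ.sub_smul_mem_ball hε hz x)) (hρ.nonneg z)

end Mollify

/-! ### Global flows of locally Lipschitz vector fields on bounded sets -/

section Flow

variable {n : ℕ}

/-- Coordinatewise truncation to the cube `[-R, R]ⁿ`. -/
noncomputable def clamp (R : ℝ) (y : E n) : E n :=
  WithLp.toLp 2 fun i => max (-R) (min R (y i))

theorem lipschitzWith_clamp (R : ℝ) : LipschitzWith 1 (clamp (n := n) R) := by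
  refine LipschitzWith.of_dist_le_mul fun x y => ?_
  rw [NNReal.coe_one, one_mul, EuclideanSpace.dist_eq, EuclideanSpace.dist_eq]
  refine Real.sqrt_le_sqrt (Finset.sum_le_sum fun i _ => ?_)
  refine pow_le_pow_left₀ dist_nonneg ?_ 2
  rw [Real.dist_eq, Real.dist_eq]
  simp only [clamp]
  refine (abs_max_sub_max_le_max _ _ _ _).trans (max_le (by simp) ?_)
  exact (abs_min_sub_min_le_max _ _ _ _).trans (max_le (by simp) le_rfl)

theorem clamp_eq_self {R : ℝ} {y : E n} (hy : ‖y‖ ≤ R) : clamp R y = y := by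
  ext i
  have h : |y i| ≤ R := (PiLp.norm_apply_le y i).trans hy
  rw [abs_le] at h
  simp only [clamp]
  rw [min_eq_right h.2, max_eq_right h.1]

theorem isCompact_closure_range_clamp (R : ℝ) : IsCompact (closure (range (clamp (n := n) R))) := by
  refine Bornology.IsBounded.isCompact_closure ?_
  rw [isBounded_iff_forall_norm_le]
  refine ⟨Real.sqrt (∑ _i : Fin n, |R| ^ 2), ?_⟩
  rintro _ ⟨y, rfl⟩
  rw [EuclideanSpace.norm_eq]
  refine Real.sqrt_le_sqrt (Finset.sum_le_sum fun i _ => ?_)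
  refine pow_le_pow_left₀ (norm_nonneg _) ?_ 2
  simp only [clamp, Real.norm_eq_abs]
  refine abs_le.2 ⟨?_, ?_⟩
  · exact (neg_le_neg (le_abs_self R)).trans (le_max_left _ _)
  · exact max_le (neg_le_abs R) ((min_le_left _ _).trans (le_abs_self R))

/-- Composition with the clamp onto a cube turns local into global Lipschitz bounds without changing
the field on the bounded set. All existence and uniqueness statements for trajectories are reduced
to this situation. -/
theorem LocallyLipschitz.exists_lipschitzWith_eqOn {Y : Type*} [NormedAddCommGroup Y]
    {X : E n → Y} (hX : LocallyLipschitz X) {s : Set (E n)} (hs : Bornology.IsBounded s) :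
    ∃ (X' : E n → Y) (K : NNReal) (L : ℝ), LipschitzWith K X' ∧ (∀ x, ‖X' x‖ ≤ L) ∧
      EqOn X' X s := by
  obtain ⟨R, hR⟩ := hs.exists_norm_le
  have hcomp := isCompact_closure_range_clamp (n := n) R
  obtain ⟨K, hK⟩ := (hX.locallyLipschitzOn (s := closure (range (clamp (n := n)
    R)))).exists_lipschitzOnWith_of_compact hcomp
  obtain ⟨L, hL⟩ := hcomp.exists_bound_of_continuousOn hX.continuous.continuousOn
  have hmem : ∀ x : E n, clamp R x ∈ closure (range (clamp (n := n) R)) :=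
    fun x => subset_closure (mem_range_self x)
  refine ⟨X ∘ clamp R, K * 1, L, ?_, fun x => hL _ (hmem x), fun x hx => ?_⟩
  · rw [← lipschitzOnWith_univ]
    exact hK.comp (lipschitzWith_clamp R).lipschitzOnWith fun x _ => hmem x
  · simp [clamp_eq_self (hR x hx)]

/-- A field bounded by `L` leaves the ball of radius `L(N + 1)` at no time in `[-(N + 1), N + 1]`,
so Picard–Lindelöf applies on every such interval; uniqueness glues the pieces. Negative times are
needed in `Frame.value_eq_zero`. -/
theorem LipschitzWith.exists_flow {X : E n → E n} {K : NNReal} {L : ℝ} (hX : LipschitzWith K X)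
    (hL : ∀ x, ‖X x‖ ≤ L) (x₀ : E n) :
    ∃ z : ℝ → E n, z 0 = x₀ ∧ ∀ t, HasDerivAt z (X (z t)) t := by
  have hL0 : 0 ≤ L := (norm_nonneg _).trans (hL x₀)
  have hloc : ∀ N : ℕ, ∃ α : ℝ → E n, α 0 = x₀ ∧
      ∀ t ∈ Ioo (-((N : ℝ) + 1)) (N + 1), HasDerivAt α (X (α t)) t := by
    intro N
    have hN : (0 : ℝ) ≤ (N : ℝ) + 1 := by positivity
    have hp : IsPicardLindelof (fun _ => X) (tmin := -((N : ℝ) + 1)) (tmax := N + 1)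
        ⟨0, by constructor <;> linarith⟩ x₀ (L.toNNReal * (N + 1)) 0 L.toNNReal K := by
      refine IsPicardLindelof.of_time_independent (fun x _ => ?_) hX.lipschitzOnWith ?_
      · rw [Real.coe_toNNReal _ hL0]; exact hL x
      · simp
    obtain ⟨α, h0, h⟩ := hp.exists_eq_forall_mem_Icc_hasDerivWithinAt₀
    exact ⟨α, h0, fun t ht => (h t (Ioo_subset_Icc_self ht)).hasDerivAt (Icc_mem_nhds ht.1 ht.2)⟩
  choose α hα0 hα using hloc
  have huniq : ∀ N M : ℕ, N ≤ M → EqOn (α N) (α M) (Ioo (-((N : ℝ) + 1)) (N + 1)) := by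
    intro N M hNM
    have hNM' : (N : ℝ) ≤ M := by exact_mod_cast hNM
    have hN : (0 : ℝ) ≤ N := by positivity
    refine ODE_solution_unique_of_mem_Ioo (v := fun _ => X) (s := fun _ => univ) (t₀ := 0)
      (fun t _ => hX.lipschitzOnWith) ⟨by linarith, by linarith⟩
      (fun t ht => ⟨hα N t ht, mem_univ _⟩)
      (fun t ht => ⟨hα M t ⟨by linarith [ht.1], by linarith [ht.2]⟩, mem_univ _⟩) ?_
    rw [hα0, hα0]
  have hz : ∀ N : ℕ, EqOn (fun t => α ⌈|t|⌉₊ t) (α N) (Ioo (-((N : ℝ) + 1)) (N + 1)) := by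
    intro N t ht
    rcases le_total N ⌈|t|⌉₊ with h | h
    · exact (huniq _ _ h ht).symm
    · refine huniq _ _ h ?_
      rw [mem_Ioo, ← abs_lt]
      linarith [Nat.le_ceil |t|]
  refine ⟨fun t => α ⌈|t|⌉₊ t, by simp [hα0], fun t => ?_⟩
  have ht : t ∈ Ioo (-((⌈|t|⌉₊ : ℝ) + 1)) (⌈|t|⌉₊ + 1) := by
    rw [mem_Ioo, ← abs_lt]
    linarith [Nat.le_ceil |t|]
  refine (hα _ t ht).congr_of_eventuallyEq ?_
  filter_upwards [Ioo_mem_nhds ht.1 ht.2] with s hs using hz _ hs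

end Flow

/-! ### Dynamic programming -/

/-- Cauchy–Schwarz, obtained from the non-negativity of `∫ (t g - I)²`. -/
theorem sq_intervalIntegral_le {g : ℝ → ℝ} {t : ℝ} (ht : 0 ≤ t)
    (hg : IntervalIntegrable g volume 0 t) (hg2 : IntervalIntegrable (fun s => g s ^ 2) volume 0 t) :
    (∫ s in (0 : ℝ)..t, g s) ^ 2 ≤ t * ∫ s in (0 : ℝ)..t, g s ^ 2 := by
  set I := ∫ s in (0 : ℝ)..t, g s with hI
  have h : 0 ≤ ∫ s in (0 : ℝ)..t, (t * g s - I) ^ 2 :=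
    intervalIntegral.integral_nonneg ht fun _ _ => sq_nonneg _
  have h1 : (fun s => (t * g s - I) ^ 2)
      = fun s => t ^ 2 * g s ^ 2 - 2 * t * I * g s + I ^ 2 := by funext s; ring
  rw [h1, intervalIntegral.integral_add ((hg2.const_mul _).sub (hg.const_mul _))
    intervalIntegrable_const, intervalIntegral.integral_sub (hg2.const_mul _) (hg.const_mul _),
    intervalIntegral.integral_const_mul, intervalIntegral.integral_const_mul,
    intervalIntegral.integral_const, ← hI, smul_eq_mul, sub_zero] at h
  rcases ht.eq_or_lt with h0 | h0
  · have : I = 0 := by rw [hI, ← h0]; simp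
    rw [← h0, this]; simp
  · have : 0 ≤ t * (t * (∫ s in (0 : ℝ)..t, g s ^ 2) - I ^ 2) := by linarith
    linarith [nonneg_of_mul_nonneg_right this h0]

theorem measurePreserving_add_left_Ioi (t : ℝ) :
    MeasurePreserving (fun s : ℝ => t + s) (volume.restrict (Ioi 0)) (volume.restrict (Ioi t)) := by
  have h := (measurePreserving_add_left (volume : Measure ℝ) t).restrict_preimage
    (measurableSet_Ioi (a := t))
  have h2 : (fun s : ℝ => t + s) ⁻¹' Ioi t = Ioi 0 := by ext s; simp
  rwa [h2] at h

namespace ControlProblem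

variable {d m : ℕ} {P : ControlProblem d m}

theorem Standing.continuous_f (hP : P.Standing) : Continuous P.f := hP.f_lip.continuous
theorem Standing.continuous_B (hP : P.Standing) : Continuous P.B := hP.B_lip.continuous
theorem Standing.continuous_ell (hP : P.Standing) : Continuous P.ell := hP.ell_lip.continuous

/-- The running cost. -/
noncomputable def runCost (P : ControlProblem d m) (u : ℝ → E m) (y : ℝ → E d) (t : ℝ) : ℝ :=
  P.ell (y t) + P.β / 2 * ‖u t‖ ^ 2

theorem Standing.runCost_nonneg (hP : P.Standing) (u : ℝ → E m) (y : ℝ → E d) (t : ℝ) :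
    0 ≤ P.runCost u y t := by
  have := hP.ell_nonneg (y t)
  have := hP.β_pos
  unfold runCost
  positivity

theorem Standing.integrableOn_field (hP : P.Standing) {u : ℝ → E m} {y : ℝ → E d} {a b : ℝ}
    (hu : IntegrableOn u (Icc a b)) (hy : ContinuousOn y (Icc a b)) :
    IntegrableOn (fun s => P.f (y s) + P.B (y s) (u s)) (Icc a b) := by
  refine (hP.continuous_f.comp_continuousOn hy).integrableOn_Icc.add ?_
  have hBy : ContinuousOn (fun s => P.B (y s)) (Icc a b) := hP.continuous_B.comp_continuousOn hy
  obtain ⟨c, hc⟩ := isCompact_Icc.exists_bound_of_continuousOn hBy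
  refine Integrable.mono' (hu.norm.const_mul c) ?_ ?_
  · exact (ContinuousLinearMap.apply ℝ (E d) |>.flip).aestronglyMeasurable_comp₂
      (hBy.aestronglyMeasurable measurableSet_Icc) hu.aestronglyMeasurable
  · filter_upwards [ae_restrict_mem measurableSet_Icc] with s hs
    exact (ContinuousLinearMap.le_opNorm _ _).trans
      (mul_le_mul_of_nonneg_right (hc s hs) (norm_nonneg _))

namespace IsOpenLoop

variable {y₀ : E d} {u : ℝ → E m} {y : ℝ → E d}

theorem memLp_Icc (h : P.IsOpenLoop y₀ u y) (t : ℝ) :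
    MemLp u 2 (volume.restrict (Icc 0 t)) := by
  have h1 : volume.restrict (Icc (0 : ℝ) t) = volume.restrict (Ioc 0 t) :=
    Measure.restrict_congr_set Ioc_ae_eq_Icc.symm
  rw [h1]
  exact h.memLp.mono_measure (Measure.restrict_mono Ioc_subset_Ioi_self le_rfl)

theorem integrableOn (h : P.IsOpenLoop y₀ u y) (t : ℝ) : IntegrableOn u (Icc 0 t) :=
  (h.memLp_Icc t).integrable (by norm_num)

theorem integrableOn_sq (h : P.IsOpenLoop y₀ u y) (t : ℝ) :
    IntegrableOn (fun s => ‖u s‖ ^ 2) (Icc 0 t) :=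
  (h.memLp_Icc t).integrable_norm_pow (by norm_num)

theorem init (h : P.IsOpenLoop y₀ u y) : y 0 = y₀ := by
  simpa using h.eq_integral 0 le_rfl

theorem integrableOn_field (hP : P.Standing) (h : P.IsOpenLoop y₀ u y) (t : ℝ) :
    IntegrableOn (fun s => P.f (y s) + P.B (y s) (u s)) (Icc 0 t) :=
  hP.integrableOn_field (h.integrableOn t) (h.continuousOn.mono Icc_subset_Ici_self)

theorem integrableOn_runCost (hP : P.Standing) (h : P.IsOpenLoop y₀ u y) (t : ℝ) :
    IntegrableOn (P.runCost u y) (Icc 0 t) :=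
  ((hP.continuous_ell.comp_continuousOn
    (h.continuousOn.mono Icc_subset_Ici_self)).integrableOn_Icc).add
    ((h.integrableOn_sq t).const_mul _)

theorem intervalIntegrable_field (hP : P.Standing) (h : P.IsOpenLoop y₀ u y) {a b : ℝ}
    (ha : 0 ≤ a) (hb : 0 ≤ b) :
    IntervalIntegrable (fun s => P.f (y s) + P.B (y s) (u s)) volume a b := by
  rw [intervalIntegrable_iff]
  refine (h.integrableOn_field hP (max a b)).mono_set ?_
  rw [uIoc]
  exact Ioc_subset_Icc_self.trans (Icc_subset_Icc_left (le_min ha hb))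

theorem shift (hP : P.Standing) (h : P.IsOpenLoop y₀ u y) {t : ℝ} (ht : 0 ≤ t) :
    P.IsOpenLoop (y t) (fun s => u (t + s)) (fun s => y (t + s)) where
  memLp := by
    refine MemLp.comp_measurePreserving (g := u) ?_ (measurePreserving_add_left_Ioi t)
    exact h.memLp.mono_measure (Measure.restrict_mono (Ioi_subset_Ioi ht) le_rfl)
  continuousOn := h.continuousOn.comp (by fun_prop) fun s hs => add_nonneg ht hs
  eq_integral := fun s hs => by
    have h1 := h.eq_integral (t + s) (add_nonneg ht hs)
    rw [intervalIntegral.integral_comp_add_left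
      (fun r => P.f (y r) + P.B (y r) (u r)) t, add_zero, h1, h.eq_integral t ht, add_assoc,
      intervalIntegral.integral_add_adjacent_intervals
        (h.intervalIntegrable_field hP le_rfl ht)
        (h.intervalIntegrable_field hP ht (add_nonneg ht hs))]

theorem lintegral_add_cost_shift {t : ℝ} (ht : 0 ≤ t) :
    (∫⁻ s in Ioc 0 t, ENNReal.ofReal (P.runCost u y s))
      + P.cost (fun s => u (t + s)) (fun s => y (t + s)) = P.cost u y := by
  have h1 : P.cost (fun s => u (t + s)) (fun s => y (t + s))
      = ∫⁻ s in Ioi t, ENNReal.ofReal (P.runCost u y s) :=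
    (measurePreserving_add_left_Ioi t).lintegral_comp_emb
      (measurableEmbedding_addLeft t) (fun s => ENNReal.ofReal (P.runCost u y s))
  rw [h1, cost, ← Ioc_union_Ioi_eq_Ioi ht, lintegral_union measurableSet_Ioi
    (by rw [Set.disjoint_left]; exact fun s hs => not_lt.2 hs.2)]
  rfl

end IsOpenLoop

theorem valueENN_le (P : ControlProblem d m) {y₀ : E d} {u : ℝ → E m} {y : ℝ → E d}
    (h : P.IsOpenLoop y₀ u y) : P.valueENN y₀ ≤ P.cost u y :=
  iInf_le_of_le u (iInf_le_of_le y (iInf_le _ h))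

theorem Standing.ofReal_integral_runCost (hP : P.Standing) {u : ℝ → E m} {y : ℝ → E d} {t : ℝ}
    (ht : 0 ≤ t) (h : IntegrableOn (P.runCost u y) (Icc 0 t)) :
    ENNReal.ofReal (∫ s in (0 : ℝ)..t, P.runCost u y s)
      = ∫⁻ s in Ioc 0 t, ENNReal.ofReal (P.runCost u y s) := by
  rw [intervalIntegral.integral_of_le ht]
  exact ofReal_integral_eq_lintegral_ofReal (h.mono_set Ioc_subset_Icc_self)
    (ae_of_all _ fun s => hP.runCost_nonneg u y s)

/-- Almost optimal controls satisfy the dynamic programming inequality. -/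
theorem Standing.exists_isOpenLoop_le (hP : P.Standing) (hV : ∀ y₀, P.valueENN y₀ ≠ ⊤) (p : E d)
    {η : ℝ} (hη : 0 < η) :
    ∃ u y, P.IsOpenLoop p u y ∧ ∀ t, 0 ≤ t →
      (∫ s in (0 : ℝ)..t, P.runCost u y s) + P.value (y t) ≤ P.value p + η := by
  have hlt : P.valueENN p < P.valueENN p + ENNReal.ofReal η :=
    ENNReal.lt_add_right (hV p) (by simpa using hη)
  nth_rewrite 1 [valueENN] at hlt
  simp only [iInf_lt_iff] at hlt
  obtain ⟨u, y, h, hlt⟩ := hlt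
  refine ⟨u, y, h, fun t ht => ?_⟩
  have h1 : ENNReal.ofReal (∫ s in (0 : ℝ)..t, P.runCost u y s) + P.valueENN (y t)
      ≤ P.valueENN p + ENNReal.ofReal η := by
    rw [hP.ofReal_integral_runCost ht (h.integrableOn_runCost hP t)]
    refine le_trans ?_ hlt.le
    rw [← IsOpenLoop.lintegral_add_cost_shift ht]
    exact add_le_add le_rfl (P.valueENN_le (h.shift hP ht))
  have h2 := ENNReal.toReal_mono (ENNReal.add_ne_top.2 ⟨hV p, ENNReal.ofReal_ne_top⟩) h1
  rwa [ENNReal.toReal_add ENNReal.ofReal_ne_top (hV _), ENNReal.toReal_add (hV _)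
    ENNReal.ofReal_ne_top, ENNReal.toReal_ofReal hη.le, ENNReal.toReal_ofReal
    (intervalIntegral.integral_nonneg ht fun s _ => hP.runCost_nonneg u y s)] at h2

/-- Following a control on `[0, T]` and an open loop control afterwards. -/
theorem Standing.isOpenLoop_concat (hP : P.Standing) {T : ℝ} (hT : 0 ≤ T) {v : ℝ → E m}
    {y : ℝ → E d} (hv : ContinuousOn v (Icc 0 T)) (hy : ContinuousOn y (Icc 0 T))
    (hint : ∀ t ∈ Icc 0 T, y t = y 0 + ∫ s in (0 : ℝ)..t, (P.f (y s) + P.B (y s) (v s)))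
    {u' : ℝ → E m} {y' : ℝ → E d} (h : P.IsOpenLoop (y T) u' y') :
    P.IsOpenLoop (y 0) (fun s => if s ≤ T then v s else u' (-T + s))
      (fun s => if s ≤ T then y s else y' (-T + s)) where
  memLp := by
    rw [← Ioc_union_Ioi_eq_Ioi hT]
    have hpw : (fun s => if s ≤ T then v s else u' (-T + s))
        = (Iic T).piecewise v fun s => u' (-T + s) := by
      funext s
      simp only [Set.piecewise, mem_Iic]
    rw [hpw]
    refine MemLp.piecewise measurableSet_Iic ?_ ?_
    · rw [Measure.restrict_restrict measurableSet_Iic]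
      have h1 : Iic T ∩ (Ioc 0 T ∪ Ioi T) = Ioc 0 T := by
        rw [Ioc_union_Ioi_eq_Ioi hT, inter_comm, Ioi_inter_Iic]
      rw [h1]
      obtain ⟨c, hc⟩ := isCompact_Icc.exists_bound_of_continuousOn hv
      refine MemLp.of_bound ((hv.mono Ioc_subset_Icc_self).aestronglyMeasurable
        measurableSet_Ioc) c ?_
      filter_upwards [ae_restrict_mem measurableSet_Ioc] with s hs
      exact hc s (Ioc_subset_Icc_self hs)
    · rw [Measure.restrict_restrict measurableSet_Iic.compl]
      have h1 : (Iic T)ᶜ ∩ (Ioc 0 T ∪ Ioi T) = Ioi T := by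
        rw [Ioc_union_Ioi_eq_Ioi hT, compl_Iic, Ioi_inter_Ioi, sup_eq_left.2 hT]
      rw [h1]
      have h2 : MeasurePreserving (fun s : ℝ => -T + s) (volume.restrict (Ioi T))
          (volume.restrict (Ioi 0)) := by
        have h := (measurePreserving_add_left (volume : Measure ℝ) (-T)).restrict_preimage
          (measurableSet_Ioi (a := (0 : ℝ)))
        have h2 : (fun s : ℝ => -T + s) ⁻¹' Ioi 0 = Ioi T := by
          ext s
          simp only [mem_preimage, mem_Ioi]
          constructor <;> intro h <;> linarith
        rwa [h2] at h
      exact h.memLp.comp_measurePreserving h2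
  continuousOn := by
    refine ContinuousOn.if (p := fun s => s ≤ T) ?_ ?_ ?_
    · intro s hs
      have : s = T := by
        have := frontier_Iic_subset T (show s ∈ frontier (Iic T) from hs.2)
        simpa using this
      rw [this, neg_add_cancel, h.init]
    · refine hy.mono fun s hs => ?_
      have h1 : s ∈ closure (Iic T) := hs.2
      rw [closure_Iic] at h1
      exact ⟨hs.1, h1⟩
    · refine h.continuousOn.comp (by fun_prop) fun s hs => ?_
      have h1 : s ∈ closure {a | ¬ a ≤ T} := hs.2
      simp only [not_le] at h1
      have h2 : s ∈ closure (Ioi T) := h1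
      rw [closure_Ioi] at h2
      simp only [mem_Ici] at h2 ⊢
      linarith
  eq_integral := fun t ht => by
    have hcongr : ∀ a b : ℝ, a ≤ b → b ≤ T →
        ∫ s in a..b, (P.f (if s ≤ T then y s else y' (-T + s))
          + P.B (if s ≤ T then y s else y' (-T + s)) (if s ≤ T then v s else u' (-T + s)))
        = ∫ s in a..b, (P.f (y s) + P.B (y s) (v s)) := by
      intro a b hab hb
      refine intervalIntegral.integral_congr fun s hs => ?_
      rw [uIcc_of_le hab] at hs
      simp only [if_pos (hs.2.trans hb)]
    by_cases htT : t ≤ T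
    · rw [hcongr 0 t ht htT]
      simp only [if_pos htT]
      exact hint t ⟨ht, htT⟩
    · have htT' : T < t := not_le.1 htT
      simp only [if_neg htT]
      have hi1 : IntervalIntegrable (fun s => P.f (if s ≤ T then y s else y' (-T + s))
          + P.B (if s ≤ T then y s else y' (-T + s)) (if s ≤ T then v s else u' (-T + s)))
          volume 0 T := by
        rw [intervalIntegrable_iff_integrableOn_Icc_of_le hT]
        refine (hP.integrableOn_field hv.integrableOn_Icc hy).congr_fun (fun s hs => ?_)
          measurableSet_Icc
        simp only [if_pos hs.2]
      have hi2 : IntervalIntegrable (fun s => P.f (y' (-T + s)) + P.B (y' (-T + s)) (u' (-T + s)))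
          volume T t := by
        have h3 := (h.intervalIntegrable_field hP le_rfl (sub_nonneg.2 htT'.le)).comp_add_left (-T)
        simpa using h3
      have heq : EqOn (fun s => P.f (y' (-T + s)) + P.B (y' (-T + s)) (u' (-T + s)))
          (fun s => P.f (if s ≤ T then y s else y' (-T + s))
          + P.B (if s ≤ T then y s else y' (-T + s)) (if s ≤ T then v s else u' (-T + s)))
          (Ioc T t) := by
        intro s hs
        simp only [if_neg (not_le.2 hs.1)]
      have hi3 := hi2
      rw [intervalIntegrable_iff_integrableOn_Ioc_of_le htT'.le] at hi3
      have hi4 := hi3.congr_fun heq measurableSet_Ioc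
      rw [← intervalIntegrable_iff_integrableOn_Ioc_of_le htT'.le] at hi4
      rw [← intervalIntegral.integral_add_adjacent_intervals hi1 hi4, hcongr 0 T hT le_rfl]
      have h5 : ∫ s in T..t, (P.f (if s ≤ T then y s else y' (-T + s))
          + P.B (if s ≤ T then y s else y' (-T + s)) (if s ≤ T then v s else u' (-T + s)))
          = ∫ s in T..t, (P.f (y' (-T + s)) + P.B (y' (-T + s)) (u' (-T + s))) := by
        rw [intervalIntegral.integral_of_le htT'.le, intervalIntegral.integral_of_le htT'.le]
        exact (setIntegral_congr_fun measurableSet_Ioc heq).symm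
      rw [h5, intervalIntegral.integral_comp_add_left
        (fun s => P.f (y' s) + P.B (y' s) (u' s)) (-T), neg_add_cancel, ← add_assoc,
        ← hint T ⟨hT, le_rfl⟩]
      exact h.eq_integral (-T + t) (by linarith)

/-- The dynamic programming inequality along a given trajectory. -/
theorem Standing.value_le (hP : P.Standing) (hV : ∀ y₀, P.valueENN y₀ ≠ ⊤) {T : ℝ} (hT : 0 ≤ T)
    {v : ℝ → E m} {y : ℝ → E d} (hv : ContinuousOn v (Icc 0 T)) (hy : ContinuousOn y (Icc 0 T))
    (hint : ∀ t ∈ Icc 0 T, y t = y 0 + ∫ s in (0 : ℝ)..t, (P.f (y s) + P.B (y s) (v s))) :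
    P.value (y 0) ≤ (∫ s in (0 : ℝ)..T, P.runCost v y s) + P.value (y T) := by
  have hr : IntegrableOn (P.runCost v y) (Icc 0 T) :=
    ((hP.continuous_ell.comp_continuousOn hy).add
      (continuousOn_const.mul (hv.norm.pow 2))).integrableOn_Icc
  have key : P.valueENN (y 0)
      ≤ ENNReal.ofReal (∫ s in (0 : ℝ)..T, P.runCost v y s) + P.valueENN (y T) := by
    conv_rhs => rw [valueENN]
    simp only [ENNReal.add_iInf]
    refine le_iInf fun u' => le_iInf fun y' => le_iInf fun h => ?_
    refine (P.valueENN_le (hP.isOpenLoop_concat hT hv hy hint h)).trans ?_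
    rw [← IsOpenLoop.lintegral_add_cost_shift hT, hP.ofReal_integral_runCost hT hr]
    refine add_le_add (le_of_eq ?_) (le_of_eq ?_)
    · refine setLIntegral_congr_fun measurableSet_Ioc fun s hs => ?_
      simp only [runCost, if_pos hs.2]
    · unfold cost
      refine setLIntegral_congr_fun measurableSet_Ioi fun s hs => ?_
      have hs' : ¬ T + s ≤ T := by have : 0 < s := hs; linarith
      simp only [if_neg hs', neg_add_cancel_left]
  have h2 := ENNReal.toReal_mono (ENNReal.add_ne_top.2 ⟨ENNReal.ofReal_ne_top, hV _⟩) key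
  rwa [ENNReal.toReal_add ENNReal.ofReal_ne_top (hV _), ENNReal.toReal_ofReal
    (intervalIntegral.integral_nonneg hT fun s _ => hP.runCost_nonneg v y s)] at h2

end ControlProblem

/-! ### The value function is a super-solution of the Hamilton-Jacobi-Bellman equation -/

/-- A first exit argument: if `φ < r` is a consequence of `φ ≤ r` up to the current time, then it
holds for all times. -/
theorem forall_lt_of_forall_le_imp_lt {φ : ℝ → ℝ} {T r : ℝ} (hφ : ContinuousOn φ (Icc 0 T))
    (h0 : φ 0 < r)
    (h : ∀ s ∈ Icc 0 T, (∀ s' ∈ Icc 0 s, φ s' ≤ r) → φ s < r) : ∀ s ∈ Icc 0 T, φ s < r := by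
  by_contra! hcon
  obtain ⟨s₁, hs₁, hr₁⟩ := hcon
  have hcl : IsClosed (Icc 0 T ∩ φ ⁻¹' Ici r) := hφ.preimage_isClosed_of_isClosed isClosed_Icc
    isClosed_Ici
  have hcomp : IsCompact (Icc 0 T ∩ φ ⁻¹' Ici r) :=
    isCompact_Icc.of_isClosed_subset hcl inter_subset_left
  obtain ⟨s, ⟨hs, hsr⟩, hmin⟩ := hcomp.exists_isLeast ⟨s₁, hs₁, hr₁⟩
  refine (h s hs fun s' hs' => ?_).not_ge hsr
  by_contra! hlt
  have hsub : Icc 0 s' ⊆ Icc 0 T := Icc_subset_Icc_right (hs'.2.trans hs.2)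
  obtain ⟨q, hq, hqr⟩ := intermediate_value_Icc hs'.1 (hφ.mono hsub) ⟨h0.le, hlt.le⟩
  have h1 := hmin ⟨hsub hq, hqr.ge⟩
  have h2 : s' = q := le_antisymm (hs'.2.trans h1) hq.2
  rw [h2, hqr] at hlt
  exact lt_irrefl _ hlt

namespace ControlProblem

variable {d m : ℕ} {P : ControlProblem d m}

theorem value_nonneg (P : ControlProblem d m) (y : E d) : 0 ≤ P.value y := ENNReal.toReal_nonneg

/-- `f(x)ᵀξ + ℓ(x) - |B(x)ᵀξ|² / (2β)`, the negative of the Hamiltonian. -/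
noncomputable def negHam (P : ControlProblem d m) (x ξ : E d) : ℝ :=
  inner ℝ (P.f x) ξ + P.ell x
    - 1 / (2 * P.β) * ‖ContinuousLinearMap.adjoint (P.B x) ξ‖ ^ 2

/-- Completion of the square: the last term on the left measures how far `v` is from the feedback
`-β⁻¹ Bᵀξ`. -/
theorem negHam_add (P : ControlProblem d m) (hβ : 0 < P.β) (x ξ : E d) (v : E m) :
    P.negHam x ξ + P.β / 2 * ‖v + P.β⁻¹ • ContinuousLinearMap.adjoint (P.B x) ξ‖ ^ 2
      = inner ℝ (P.f x + P.B x v) ξ + (P.ell x + P.β / 2 * ‖v‖ ^ 2) := by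
  rw [norm_add_sq_real, inner_smul_right, ContinuousLinearMap.adjoint_inner_right, norm_smul,
    Real.norm_eq_abs, abs_of_pos (inv_pos.2 hβ), inner_add_left, negHam]
  field_simp
  ring

theorem Standing.continuous_adjoint (hP : P.Standing) :
    Continuous fun x => ContinuousLinearMap.adjoint (P.B x) :=
  ContinuousLinearMap.adjoint.continuous.comp hP.continuous_B

theorem Standing.continuous_negHam (hP : P.Standing) (ξ : E d) :
    Continuous fun x => P.negHam x ξ := by
  have h1 := hP.continuous_f
  have h2 := hP.continuous_ell
  have h3 := hP.continuous_adjoint.clm_apply (continuous_const (y := ξ))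
  unfold negHam
  fun_prop

/-- Suppose the value is `c > 0` at `p`; then it exceeds `c/2` nearby. Along an almost optimal
trajectory on a short interval `[0,t]` the subgradient inequality and dynamic programming give `⟨ξ,
y(t) - p⟩ + cost ≤ ct/8 + C/2 |y(t) - p|²`. By completion of the square the left side is at least
`ct/2 + β/2 Q`, where `Q` is the squared `L²` distance of the control from the feedback. The
controls have no pointwise bound, so the quadratic error is estimated through `Q` itself: it is at
most `ct/8 + β/2 Q` for small `t`, a contradiction. -/
theorem Standing.negHam_nonpos (hP : P.Standing) (hV : ∀ y₀, P.valueENN y₀ ≠ ⊤) {Ω : Set (E d)}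
    (hΩ : IsOpen Ω) {C : ℝ} (hC : 0 ≤ C) {p ξ : E d} (hp : p ∈ Ω)
    (h : IsSubgrad C Ω P.value p ξ) : P.negHam p ξ ≤ 0 := by
  by_contra! hc
  set c := P.negHam p ξ with hcdef
  have hβ := hP.β_pos
  obtain ⟨r, hr, hball⟩ : ∃ r > 0, Metric.closedBall p r ⊆ Ω ∩ {x | c / 2 < P.negHam x ξ} := by
    refine Metric.nhds_basis_closedBall.mem_iff.1 (inter_mem (hΩ.mem_nhds hp) ?_)
    exact (isOpen_lt continuous_const (hP.continuous_negHam ξ)).mem_nhds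
      (show c / 2 < P.negHam p ξ by linarith)
  obtain ⟨Mf, hMf⟩ := (isCompact_closedBall p r).exists_bound_of_continuousOn
    hP.continuous_f.continuousOn
  obtain ⟨Mb, hMb⟩ := (isCompact_closedBall p r).exists_bound_of_continuousOn
    hP.continuous_B.continuousOn
  have hcζ : Continuous fun x => P.β⁻¹ • ContinuousLinearMap.adjoint (P.B x) ξ := by
    have h1 := hP.continuous_adjoint.clm_apply (continuous_const (y := ξ))
    fun_prop
  obtain ⟨k, hk⟩ := (isCompact_closedBall p r).exists_bound_of_continuousOn hcζ.continuousOn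
  have hpb : p ∈ Metric.closedBall p r := Metric.mem_closedBall_self hr.le
  have hMf0 := (norm_nonneg _).trans (hMf p hpb)
  have hMb0 := (norm_nonneg _).trans (hMb p hpb)
  have hk0 := (norm_nonneg _).trans (hk p hpb)
  set A₀ := 2 / P.β * (P.value p + 1) with hA₀
  -- The time is fixed before the control, which depends on it through the tolerance `ct/8`. The
  -- conditions serve, in this order: tolerance below `1`; displacement by `f` and by the control
  -- below `r/2` each; absorption of the `Q`-part and of the `t²`-part of `C/2 |y(t) - p|²`.
  obtain ⟨t, ht0, ht1, ht2, ht3, ht4, ht5⟩ : ∃ t : ℝ, 0 < t ∧ c * t / 8 < 1 ∧ Mf * t < r / 2 ∧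
      Mb ^ 2 * (t * A₀) < (r / 2) ^ 2 ∧ 2 * C * Mb ^ 2 * t < P.β / 2 ∧
      (C * Mf ^ 2 + 2 * C * Mb ^ 2 * k ^ 2) * t < c / 8 := by
    have hev : ∀ (g : ℝ → ℝ) (b : ℝ), Continuous g → g 0 < b → ∀ᶠ t in 𝓝[>] (0 : ℝ), g t < b :=
      fun g b hg h0 => (hg.tendsto 0).mono_left nhdsWithin_le_nhds |>.eventually_lt_const h0
    have h1 := hev (fun t => c * t / 8) 1 (by fun_prop) (by simp)
    have h2 := hev (fun t => Mf * t) (r / 2) (by fun_prop) (by simpa using hr)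
    have h3 := hev (fun t => Mb ^ 2 * (t * A₀)) ((r / 2) ^ 2) (by fun_prop)
      (by simp only [zero_mul, mul_zero]; positivity)
    have h4 := hev (fun t => 2 * C * Mb ^ 2 * t) (P.β / 2) (by fun_prop) (by simpa using hβ)
    have h5 := hev (fun t => (C * Mf ^ 2 + 2 * C * Mb ^ 2 * k ^ 2) * t) (c / 8) (by fun_prop)
      (by simpa using hc)
    have h6 : ∀ᶠ t in 𝓝[>] (0 : ℝ), 0 < t := self_mem_nhdsWithin
    obtain ⟨t, ht⟩ := (h6.and (h1.and (h2.and (h3.and (h4.and h5))))).exists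
    exact ⟨t, ht⟩
  obtain ⟨u, y, hop, hdp⟩ := hP.exists_isOpenLoop_le hV p (η := c * t / 8) (by positivity)
  have hi1 : ∀ s, 0 ≤ s → IntervalIntegrable (fun q => ‖u q‖) volume 0 s := fun s hs =>
    (intervalIntegrable_iff_integrableOn_Icc_of_le hs).2 (hop.integrableOn s).norm
  have hi2 : ∀ s, 0 ≤ s → IntervalIntegrable (fun q => ‖u q‖ ^ 2) volume 0 s := fun s hs =>
    (intervalIntegrable_iff_integrableOn_Icc_of_le hs).2 (hop.integrableOn_sq s)
  have hA : ∀ s ∈ Icc 0 t, ∫ q in (0 : ℝ)..s, ‖u q‖ ^ 2 ≤ A₀ := by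
    intro s hs
    have h1 := hdp s hs.1
    have h2 : P.β / 2 * (∫ q in (0 : ℝ)..s, ‖u q‖ ^ 2) ≤ ∫ q in (0 : ℝ)..s, P.runCost u y q := by
      rw [← intervalIntegral.integral_const_mul]
      refine intervalIntegral.integral_mono_on hs.1 ((hi2 s hs.1).const_mul _)
        ((intervalIntegrable_iff_integrableOn_Icc_of_le hs.1).2 (hop.integrableOn_runCost hP s))
        fun q _ => ?_
      have := hP.ell_nonneg (y q)
      unfold runCost
      linarith
    have h3 := P.value_nonneg (y s)
    have h4 : P.β / 2 * (∫ q in (0 : ℝ)..s, ‖u q‖ ^ 2) ≤ P.value p + 1 := by linarith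
    calc (∫ q in (0 : ℝ)..s, ‖u q‖ ^ 2)
        = 2 / P.β * (P.β / 2 * (∫ q in (0 : ℝ)..s, ‖u q‖ ^ 2)) := by field_simp
      _ ≤ A₀ := mul_le_mul_of_nonneg_left h4 (by positivity)
  have hdist : ∀ s ∈ Icc 0 t, (∀ q ∈ Icc 0 s, ‖y q - p‖ ≤ r) →
      ‖y s - p‖ ≤ Mf * s + Mb * ∫ q in (0 : ℝ)..s, ‖u q‖ := by
    intro s hs hq
    rw [hop.eq_integral s hs.1, add_sub_cancel_left]
    have h1 : ‖∫ q in (0 : ℝ)..s, (P.f (y q) + P.B (y q) (u q))‖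
        ≤ ∫ q in (0 : ℝ)..s, (Mf + Mb * ‖u q‖) := by
      refine intervalIntegral.norm_integral_le_of_norm_le hs.1 (ae_of_all _ fun q hq' => ?_)
        (intervalIntegrable_const.add ((hi1 s hs.1).const_mul _))
      have hqb : y q ∈ Metric.closedBall p r := by
        rw [Metric.mem_closedBall, dist_eq_norm]
        exact hq q (Ioc_subset_Icc_self hq')
      refine (norm_add_le _ _).trans (add_le_add (hMf _ hqb) ?_)
      exact ((P.B (y q)).le_opNorm _).trans
        (mul_le_mul_of_nonneg_right (hMb _ hqb) (norm_nonneg _))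
    refine h1.trans (le_of_eq ?_)
    rw [intervalIntegral.integral_add intervalIntegrable_const ((hi1 s hs.1).const_mul _),
      intervalIntegral.integral_const, intervalIntegral.integral_const_mul, smul_eq_mul, sub_zero,
      mul_comm s]
  -- The displacement bound only holds while the trajectory is in the ball; the first exit argument
  -- removes this circularity.
  have hstay : ∀ s ∈ Icc 0 t, ‖y s - p‖ < r := by
    refine forall_lt_of_forall_le_imp_lt ?_ (by simpa [hop.init] using hr) fun s hs hq => ?_
    · exact ((hop.continuousOn.mono Icc_subset_Ici_self).sub continuousOn_const).norm
    · have h1 := hdist s hs hq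
      have h2 : Mf * s ≤ Mf * t := mul_le_mul_of_nonneg_left hs.2 hMf0
      have h3 : Mb * ∫ q in (0 : ℝ)..s, ‖u q‖ < r / 2 := by
        refine lt_of_pow_lt_pow_left₀ 2 (by positivity) (lt_of_le_of_lt ?_ ht3)
        rw [mul_pow]
        refine mul_le_mul_of_nonneg_left ?_ (by positivity)
        refine (sq_intervalIntegral_le hs.1 (hi1 s hs.1) (hi2 s hs.1)).trans ?_
        exact mul_le_mul hs.2 (hA s hs) (intervalIntegral.integral_nonneg hs.1
          fun _ _ => sq_nonneg _) ht0.le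
      linarith
  have htt : t ∈ Icc 0 t := ⟨ht0.le, le_rfl⟩
  have hyb : ∀ s ∈ Icc 0 t, y s ∈ Metric.closedBall p r := fun s hs => by
    rw [Metric.mem_closedBall, dist_eq_norm]; exact (hstay s hs).le
  have hyc : ContinuousOn y (Icc 0 t) := hop.continuousOn.mono Icc_subset_Ici_self
  set Q := ∫ q in (0 : ℝ)..t,
    ‖u q + P.β⁻¹ • ContinuousLinearMap.adjoint (P.B (y q)) ξ‖ ^ 2 with hQ
  have hζc : ContinuousOn (fun q => P.β⁻¹ • ContinuousLinearMap.adjoint (P.B (y q)) ξ)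
    (Icc 0 t) := hcζ.comp_continuousOn hyc
  have hi3 : IntervalIntegrable (fun q =>
      ‖u q + P.β⁻¹ • ContinuousLinearMap.adjoint (P.B (y q)) ξ‖ ^ 2) volume 0 t := by
    rw [intervalIntegrable_iff_integrableOn_Icc_of_le ht0.le]
    have hm : MemLp (fun q => P.β⁻¹ • ContinuousLinearMap.adjoint (P.B (y q)) ξ) 2
        (volume.restrict (Icc 0 t)) := by
      refine MemLp.of_bound (hζc.aestronglyMeasurable measurableSet_Icc) k ?_
      filter_upwards [ae_restrict_mem measurableSet_Icc] with q hq using hk _ (hyb q hq)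
    exact ((hop.memLp_Icc t).add hm).integrable_norm_pow (by norm_num)
  have hAQ : ∫ q in (0 : ℝ)..t, ‖u q‖ ^ 2 ≤ 2 * Q + 2 * k ^ 2 * t := by
    have h1 : ∫ q in (0 : ℝ)..t, ‖u q‖ ^ 2 ≤ ∫ q in (0 : ℝ)..t,
        (2 * ‖u q + P.β⁻¹ • ContinuousLinearMap.adjoint (P.B (y q)) ξ‖ ^ 2 + 2 * k ^ 2) := by
      refine intervalIntegral.integral_mono_on ht0.le (hi2 t ht0.le)
        ((hi3.const_mul _).add intervalIntegrable_const) fun q hq => ?_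
      have h2 := hk _ (hyb q hq)
      set ζ := P.β⁻¹ • ContinuousLinearMap.adjoint (P.B (y q)) ξ
      have h3 : ‖u q‖ ≤ ‖u q + ζ‖ + ‖ζ‖ := norm_le_add_norm_add (u q) ζ
      have h4 : ‖u q‖ ≤ ‖u q + ζ‖ + k := by linarith
      have h5 : ‖u q‖ ^ 2 ≤ (‖u q + ζ‖ + k) ^ 2 := by gcongr
      nlinarith [sq_nonneg (‖u q + ζ‖ - k)]
    rw [intervalIntegral.integral_add (hi3.const_mul _) intervalIntegrable_const,
      intervalIntegral.integral_const_mul, intervalIntegral.integral_const, smul_eq_mul, sub_zero,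
      ← hQ] at h1
    linarith
  have hX : ‖y t - p‖ ^ 2 ≤ 2 * Mf ^ 2 * t ^ 2 + 2 * Mb ^ 2 * (t * (2 * Q + 2 * k ^ 2 * t)) := by
    have h1 := hdist t htt fun q hq => (hstay q hq).le
    have h2 := sq_intervalIntegral_le ht0.le (hi1 t ht0.le) (hi2 t ht0.le)
    set I := ∫ q in (0 : ℝ)..t, ‖u q‖
    have h3 : I ^ 2 ≤ t * (2 * Q + 2 * k ^ 2 * t) :=
      h2.trans (mul_le_mul_of_nonneg_left hAQ ht0.le)
    have h4 : ‖y t - p‖ ^ 2 ≤ (Mf * t + Mb * I) ^ 2 := by gcongr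
    have h5 : (Mf * t + Mb * I) ^ 2 ≤ 2 * Mf ^ 2 * t ^ 2 + 2 * Mb ^ 2 * I ^ 2 := by
      nlinarith [sq_nonneg (Mf * t - Mb * I)]
    have h6 := mul_le_mul_of_nonneg_left h3 (by positivity : 0 ≤ 2 * Mb ^ 2)
    linarith
  have hfield : ∫ q in (0 : ℝ)..t, inner ℝ (P.f (y q) + P.B (y q) (u q)) ξ
      = inner ℝ ξ (y t - p) := by
    have hI := (intervalIntegrable_iff_integrableOn_Ioc_of_le ht0.le).1
      (hop.intervalIntegrable_field hP le_rfl ht0.le)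
    rw [hop.eq_integral t ht0.le, add_sub_cancel_left, intervalIntegral.integral_of_le ht0.le,
      intervalIntegral.integral_of_le ht0.le, ← integral_inner hI]
    exact integral_congr_ae (ae_of_all _ fun q => real_inner_comm _ _)
  have hmain : c / 2 * t + P.β / 2 * Q
      ≤ inner ℝ ξ (y t - p) + ∫ q in (0 : ℝ)..t, P.runCost u y q := by
    have hir : IntervalIntegrable (P.runCost u y) volume 0 t :=
      (intervalIntegrable_iff_integrableOn_Icc_of_le ht0.le).2 (hop.integrableOn_runCost hP t)
    have hif : IntervalIntegrable (fun q => inner ℝ (P.f (y q) + P.B (y q) (u q)) ξ) volume 0 t :=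
      (intervalIntegrable_iff_integrableOn_Icc_of_le ht0.le).2
        ((hop.integrableOn_field hP t).inner_const ξ)
    rw [← hfield, ← intervalIntegral.integral_add hif hir, hQ,
      ← intervalIntegral.integral_const_mul]
    have h1 : c / 2 * t = ∫ q in (0 : ℝ)..t, c / 2 := by
      rw [intervalIntegral.integral_const, smul_eq_mul, sub_zero, mul_comm]
    rw [h1, ← intervalIntegral.integral_add intervalIntegrable_const (hi3.const_mul _)]
    refine intervalIntegral.integral_mono_on ht0.le
      (intervalIntegrable_const.add (hi3.const_mul _)) (hif.add hir) fun q hq => ?_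
    have h2 := P.negHam_add hβ (y q) ξ (u q)
    have h3 : c / 2 < P.negHam (y q) ξ := (hball (hyb q hq)).2
    unfold runCost
    linarith
  have h1 := hdp t ht0.le
  have h2 := h (y t) (hball (hyb t htt)).1
  have hQ0 : 0 ≤ Q := intervalIntegral.integral_nonneg ht0.le fun _ _ => sq_nonneg _
  have h3 := mul_le_mul_of_nonneg_left hX (by positivity : 0 ≤ C / 2)
  have h4 := mul_le_mul_of_nonneg_right ht4.le hQ0
  have h5 := mul_le_mul_of_nonneg_right ht5.le ht0.le
  have h6 : 0 < c * t := by positivity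
  nlinarith [h1, h2, h3, h4, h5, h6, hmain]

end ControlProblem

/-! ### The norms on a set -/

section Norms

variable {n : ℕ} {Y : Type*} [NormedAddCommGroup Y] {F : E n → Y} {s : Set (E n)}

theorem supNorm_le_ofReal {c : ℝ} (h : ∀ x ∈ s, ‖F x‖ ≤ c) : supNorm F s ≤ ENNReal.ofReal c :=
  iSup₂_le fun x hx => ENNReal.ofReal_le_ofReal (h x hx)

theorem ofReal_norm_le_supNorm {x : E n} (hx : x ∈ s) : ENNReal.ofReal ‖F x‖ ≤ supNorm F s :=
  le_iSup₂_of_le x hx le_rfl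

theorem norm_le_toReal_supNorm (hF : supNorm F s ≠ ⊤) {x : E n} (hx : x ∈ s) :
    ‖F x‖ ≤ (supNorm F s).toReal :=
  (ENNReal.ofReal_le_iff_le_toReal hF).1 (ofReal_norm_le_supNorm hx)

theorem Continuous.supNorm_ne_top (hF : Continuous F) (hs : Bornology.IsBounded s) :
    supNorm F s ≠ ⊤ := by
  obtain ⟨c, hc⟩ := hs.isCompact_closure.exists_bound_of_continuousOn hF.continuousOn
  exact ne_top_of_le_ne_top ENNReal.ofReal_ne_top
    (supNorm_le_ofReal fun x hx => hc x (subset_closure hx))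

theorem LocallyLipschitz.lipNorm_ne_top (hF : LocallyLipschitz F) (hs : Bornology.IsBounded s) :
    lipNorm F s ≠ ⊤ := by
  obtain ⟨c, hc⟩ := hs.isCompact_closure.exists_bound_of_continuousOn hF.continuous.continuousOn
  obtain ⟨K, hK⟩ := (hF.locallyLipschitzOn (s := closure s)).exists_lipschitzOnWith_of_compact
    hs.isCompact_closure
  refine ne_top_of_le_ne_top (ENNReal.ofReal_ne_top (r := K + c)) ?_
  refine iSup₂_le fun x hx => iSup₂_le fun y hy => ENNReal.ofReal_le_ofReal ?_
  refine add_le_add (div_le_of_le_mul₀ (norm_nonneg _) K.2 ?_) (hc x (subset_closure hx))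
  simpa [dist_eq_norm] using hK.dist_le_mul x (subset_closure hx) y (subset_closure hy)

theorem div_add_norm_le_lipNorm (hF : lipNorm F s ≠ ⊤) {x y : E n} (hx : x ∈ s) (hy : y ∈ s) :
    ‖F x - F y‖ / ‖x - y‖ + ‖F x‖ ≤ (lipNorm F s).toReal :=
  (ENNReal.ofReal_le_iff_le_toReal hF).1 (le_iSup₂_of_le x hx (le_iSup₂_of_le y hy le_rfl))

theorem norm_le_lipNorm (hF : lipNorm F s ≠ ⊤) {x : E n} (hx : x ∈ s) :
    ‖F x‖ ≤ (lipNorm F s).toReal := by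
  simpa using div_add_norm_le_lipNorm hF hx hx

theorem norm_sub_le_lipNorm (hF : lipNorm F s ≠ ⊤) {x y : E n} (hx : x ∈ s) (hy : y ∈ s) :
    ‖F x - F y‖ ≤ (lipNorm F s).toReal * ‖x - y‖ := by
  have h := div_add_norm_le_lipNorm hF hx hy
  have h1 : ‖F x - F y‖ / ‖x - y‖ ≤ (lipNorm F s).toReal := by linarith [norm_nonneg (F x)]
  rcases (norm_nonneg (x - y)).eq_or_lt with h0 | h0
  · have : x = y := by rw [← sub_eq_zero, ← norm_eq_zero, ← h0]
    simp [this]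
  · exact (div_le_iff₀ h0).1 h1

theorem modulus_nonneg (F : E n → Y) (s : Set (E n)) (r : ℝ) : 0 ≤ modulus F s r :=
  Real.sSup_nonneg (by rintro _ ⟨x, _, y, _, _, rfl⟩; exact norm_nonneg _)

theorem modulus_le {r c : ℝ} (hc : 0 ≤ c)
    (h : ∀ x ∈ s, ∀ y ∈ s, ‖x - y‖ ≤ r → ‖F x - F y‖ ≤ c) : modulus F s r ≤ c :=
  Real.sSup_le (by rintro _ ⟨x, hx, y, hy, hxy, rfl⟩; exact h x hx y hy hxy) hc

/-- The bound on `F` is essential: over an unbounded set the real `sSup` in `modulus` would be `0`.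
-/
theorem norm_sub_le_modulus {c r : ℝ} (hF : ∀ x ∈ s, ‖F x‖ ≤ c) {x y : E n} (hx : x ∈ s)
    (hy : y ∈ s) (hxy : ‖x - y‖ ≤ r) : ‖F x - F y‖ ≤ modulus F s r := by
  refine le_csSup ⟨c + c, ?_⟩ ⟨x, hx, y, hy, hxy, rfl⟩
  rintro _ ⟨x, hx, y, hy, _, rfl⟩
  exact (norm_sub_le _ _).trans (add_le_add (hF x hx) (hF y hy))

theorem IsCompact.exists_norm_sub_lt (hs : IsCompact s) (hF : ContinuousOn F s) {η : ℝ}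
    (hη : 0 < η) : ∃ q > 0, ∀ x ∈ s, ∀ y ∈ s, ‖x - y‖ < q → ‖F x - F y‖ < η := by
  obtain ⟨q, hq, h⟩ := Metric.uniformContinuousOn_iff.1
    (hs.uniformContinuousOn_of_continuous hF) η hη
  exact ⟨q, hq, fun x hx y hy hxy => by
    simpa [dist_eq_norm] using h x hx y hy (by simpa [dist_eq_norm] using hxy)⟩

theorem continuousOn_gradient {w : E n → ℝ} (hs : IsOpen s) (hw : ContDiffOn ℝ 1 w s) :
    ContinuousOn (gradient w) s :=
  (InnerProductSpace.toDual ℝ (E n)).symm.continuous.comp_continuousOn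
    (hw.continuousOn_fderiv_of_isOpen hs le_rfl)

theorem supNorm_gradient_ne_top {w : E n → ℝ} (hs : IsOpen s) (hne : s.Nonempty)
    (hc : Convex ℝ s) (hb : Bornology.IsBounded s) (hw : ContDiffOn ℝ 1 w (closure s)) :
    supNorm (gradient w) s ≠ ⊤ := by
  have hu : UniqueDiffOn ℝ (closure s) := uniqueDiffOn_convex hc.closure
    (hne.mono (interior_maximal subset_closure hs))
  obtain ⟨c, hcc⟩ := hb.isCompact_closure.exists_bound_of_continuousOn
    (hw.continuousOn_fderivWithin hu le_rfl)
  refine ne_top_of_le_ne_top ENNReal.ofReal_ne_top (supNorm_le_ofReal (c := c) fun x hx => ?_)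
  have h1 : closure s ∈ 𝓝 x := mem_of_superset (hs.mem_nhds hx) subset_closure
  rw [gradient, LinearIsometryEquiv.norm_map, ← fderivWithin_of_mem_nhds h1]
  exact hcc x (subset_closure hx)

end Norms

/-! ### The Moreau envelope of the value function near `ω_δ` -/

namespace ControlProblem

variable {d m : ℕ}

/-- The hypotheses of the theorem, together with a margin `r` around `ω_δ`, an upper bound `Vb` of
the value function and a bound `L` of its subgradients near `ω_δ`. -/
structure Frame (P : ControlProblem d m) (Ω ω : Set (E d)) (δ : ℝ) (w : E d → ℝ)
    (C r Vb L : ℝ) : Prop where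
  standing : P.Standing
  fin : ∀ y₀, P.valueENN y₀ ≠ ⊤
  cont : Continuous P.value
  isOpen : IsOpen Ω
  bounded : Bornology.IsBounded Ω
  w_C1 : ContDiffOn ℝ 1 w (closure Ω)
  lyap : P.Lyapunov Ω ω δ w P.value 0
  C_pos : 0 < C
  semiconvex : SemiconvexOn C Ω P.value
  r_pos : 0 < r
  cthickening_subset : Metric.cthickening (4 * r) (sublevel Ω ω w δ) ⊆ Ω
  Vb_pos : 0 < Vb
  value_le : ∀ x ∈ Ω, P.value x ≤ Vb
  L_pos : 0 < L
  norm_le : ∀ p ∈ Metric.thickening (3 * r) (sublevel Ω ω w δ), ∀ ξ,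
    IsSubgrad C Ω P.value p ξ → ‖ξ‖ ≤ L

theorem exists_frame {P : ControlProblem d m} (hP : P.Standing)
    (hVfin : ∀ y₀, P.valueENN y₀ ≠ ⊤) (hVcont : Continuous P.value)
    {Ω ω : Set (E d)} (hΩo : IsOpen Ω) (hΩb : Bornology.IsBounded Ω)
    {δ : ℝ} {w : E d → ℝ} (hw : ContDiffOn ℝ 1 w (closure Ω))
    (hL : P.Lyapunov Ω ω δ w P.value 0) (hδΩ : closure (sublevel Ω ω w δ) ⊆ Ω)
    {C : ℝ} (hC : 0 < C) (hV : SemiconvexOn C Ω P.value) :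
    ∃ r Vb L, P.Frame Ω ω δ w C r Vb L := by
  have hsub : sublevel Ω ω w δ ⊆ Ω := fun x hx => hx.1
  have hcomp : IsCompact (closure (sublevel Ω ω w δ)) := (hΩb.subset hsub).isCompact_closure
  obtain ⟨s, hs, hsΩ⟩ := hcomp.exists_cthickening_subset_open hΩo hδΩ
  rw [Metric.cthickening_closure] at hsΩ
  obtain ⟨c, hc⟩ := hΩb.isCompact_closure.exists_bound_of_continuousOn hVcont.continuousOn
  have hVb : ∀ x ∈ Ω, P.value x ≤ |c| + 1 := fun x hx => by
    have := (le_abs_self _).trans (hc x (subset_closure hx))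
    linarith [le_abs_self c]
  have hs4 : 4 * (s / 4) = s := by ring
  -- The distance to the complement is divided into four layers of width `r`: subgradients are
  -- bounded on the `3r`-neighbourhood by `IsSubgrad.norm_le` with balls of radius `r`, the envelope
  -- is used on the `2r`-neighbourhood, and proximal points and mollification each move by at most
  -- `r`.
  refine ⟨s / 4, |c| + 1, (|c| + 1) / (s / 4) + C / 2 * (s / 4), hP, hVfin, hVcont, hΩo, hΩb, hw,
    hL, hC, hV, by positivity, by rwa [hs4], by positivity, hVb, by positivity,
    fun p hp ξ hξ => ?_⟩
  refine hξ.norm_le hC.le (fun x _ => P.value_nonneg x) hVb (by positivity) fun y hy => hsΩ ?_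
  refine Metric.thickening_subset_cthickening _ _ ?_
  rw [Metric.mem_thickening_iff] at hp ⊢
  obtain ⟨x, hx, hpx⟩ := hp
  refine ⟨x, hx, ?_⟩
  rw [Metric.mem_closedBall] at hy
  linarith [dist_triangle y p x]

/-- The parameters `λ` for which the Moreau envelope is smooth near `ω_δ`. -/
structure SmallLam (C r Vb lam : ℝ) : Prop where
  pos : 0 < lam
  mul_C_le : lam * C ≤ 1 / 2
  mul_Vb_le : 2 * lam * Vb ≤ r ^ 2

namespace Frame

variable {P : ControlProblem d m} {Ω ω : Set (E d)} {δ : ℝ} {w : E d → ℝ} {C r Vb L lam : ℝ}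

theorem sublevel_subset : sublevel Ω ω w δ ⊆ Ω := fun _ hx => hx.1

theorem thickening_subset (h : P.Frame Ω ω δ w C r Vb L) {s : ℝ} (hs : s ≤ 4 * r) :
    Metric.thickening s (sublevel Ω ω w δ) ⊆ Ω :=
  (Metric.thickening_mono hs _).trans
    ((Metric.thickening_subset_cthickening _ _).trans h.cthickening_subset)

theorem isCompact_cthickening (h : P.Frame Ω ω δ w C r Vb L) :
    IsCompact (Metric.cthickening (4 * r) (sublevel Ω ω w δ)) :=
  (h.bounded.subset h.cthickening_subset).isCompact_closure.of_isClosed_subset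
    Metric.isClosed_cthickening subset_closure

theorem ball_subset_thickening {x : E d} (hx : x ∈ sublevel Ω ω w δ) (s : ℝ) :
    Metric.ball x s ⊆ Metric.thickening s (sublevel Ω ω w δ) := fun _ hy =>
  Metric.mem_thickening_iff.2 ⟨x, hx, hy⟩

theorem isOpen_sublevel (h : P.Frame Ω ω δ w C r Vb L) : IsOpen (sublevel Ω ω w δ) :=
  h.lyap.w_C1.continuousOn.isOpen_inter_preimage h.isOpen isOpen_Iio

theorem nonneg (P : ControlProblem d m) (Ω : Set (E d)) : ∀ x ∈ Ω, 0 ≤ P.value x :=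
  fun x _ => P.value_nonneg x

theorem exists_prox (h : P.Frame Ω ω δ w C r Vb L) (hl : SmallLam C r Vb lam) {y : E d}
    (hy : y ∈ Metric.thickening (2 * r) (sublevel Ω ω w δ)) :
    (proxSet Ω P.value lam y).Nonempty := by
  refine exists_mem_proxSet hl.pos h.cont.continuousOn (nonneg P Ω) h.value_le h.r_pos
    hl.mul_Vb_le fun z hz => h.thickening_subset le_rfl ?_
  rw [Metric.mem_thickening_iff] at hy ⊢
  obtain ⟨x, hx, hyx⟩ := hy
  rw [Metric.mem_closedBall] at hz
  exact ⟨x, hx, by linarith [dist_triangle z y x, h.r_pos]⟩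

theorem hasGradientAt_of_mem (h : P.Frame Ω ω δ w C r Vb L) (hl : SmallLam C r Vb lam) {y p : E d}
    (hy : y ∈ Metric.thickening (2 * r) (sublevel Ω ω w δ)) (hp : p ∈ proxSet Ω P.value lam y) :
    HasGradientAt (moreau Ω P.value lam) (lam⁻¹ • (y - p)) y :=
  h.semiconvex.hasGradientAt_moreau hl.pos h.C_pos.le hl.mul_C_le (nonneg P Ω) hp
    (by filter_upwards [Metric.isOpen_thickening.mem_nhds hy] with y' hy' using h.exists_prox hl hy')

theorem eq_sub_smul_gradient (h : P.Frame Ω ω δ w C r Vb L) (hl : SmallLam C r Vb lam) {y p : E d}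
    (hy : y ∈ Metric.thickening (2 * r) (sublevel Ω ω w δ)) (hp : p ∈ proxSet Ω P.value lam y) :
    p = y - lam • gradient (moreau Ω P.value lam) y := by
  rw [(h.hasGradientAt_of_mem hl hy hp).gradient, smul_smul, mul_inv_cancel₀ hl.pos.ne', one_smul,
    sub_sub_cancel]

theorem prox_mem (h : P.Frame Ω ω δ w C r Vb L) (hl : SmallLam C r Vb lam) {y : E d}
    (hy : y ∈ Metric.thickening (2 * r) (sublevel Ω ω w δ)) :
    y - lam • gradient (moreau Ω P.value lam) y ∈ proxSet Ω P.value lam y := by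
  obtain ⟨p, hp⟩ := h.exists_prox hl hy
  rwa [← h.eq_sub_smul_gradient hl hy hp]

theorem proxSet_eq (h : P.Frame Ω ω δ w C r Vb L) (hl : SmallLam C r Vb lam) {y : E d}
    (hy : y ∈ Metric.thickening (2 * r) (sublevel Ω ω w δ)) :
    proxSet Ω P.value lam y = {y - lam • gradient (moreau Ω P.value lam) y} :=
  Subset.antisymm (fun _ hp => h.eq_sub_smul_gradient hl hy hp)
    (singleton_subset_iff.2 (h.prox_mem hl hy))

theorem hasGradientAt (h : P.Frame Ω ω δ w C r Vb L) (hl : SmallLam C r Vb lam) {y : E d}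
    (hy : y ∈ Metric.thickening (2 * r) (sublevel Ω ω w δ)) :
    HasGradientAt (moreau Ω P.value lam) (gradient (moreau Ω P.value lam) y) y :=
  (h.hasGradientAt_of_mem hl hy (h.prox_mem hl hy)).differentiableAt.hasGradientAt

theorem isSubgrad (h : P.Frame Ω ω δ w C r Vb L) (hl : SmallLam C r Vb lam) {y : E d}
    (hy : y ∈ Metric.thickening (2 * r) (sublevel Ω ω w δ)) :
    IsSubgrad C Ω P.value (y - lam • gradient (moreau Ω P.value lam) y)
      (gradient (moreau Ω P.value lam) y) := by
  have := h.semiconvex.isSubgrad_of_mem_proxSet hl.pos (h.prox_mem hl hy)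
  rwa [sub_sub_cancel, smul_smul, inv_mul_cancel₀ hl.pos.ne', one_smul] at this

/-- The gradient at `y` is a subgradient at the proximal point, which lies within `√(2λVb) ≤ r` of
`y` and so in the `3r`-neighbourhood where `L` is valid. -/
theorem norm_gradient_le (h : P.Frame Ω ω δ w C r Vb L) (hl : SmallLam C r Vb lam) {y : E d}
    (hy : y ∈ Metric.thickening (2 * r) (sublevel Ω ω w δ)) :
    ‖gradient (moreau Ω P.value lam) y‖ ≤ L := by
  refine h.norm_le _ ?_ _ (h.isSubgrad hl hy)
  have hyΩ : y ∈ Ω := h.thickening_subset (by linarith [h.r_pos]) hy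
  have h1 := norm_sub_sq_le_of_mem_proxSet hl.pos (nonneg P Ω) h.value_le hyΩ (h.prox_mem hl hy)
  have h2 := abs_le_of_sq_le_sq (h1.trans hl.mul_Vb_le) h.r_pos.le
  rw [abs_norm] at h2
  rw [Metric.mem_thickening_iff] at hy ⊢
  obtain ⟨x, hx, hyx⟩ := hy
  refine ⟨x, hx, ?_⟩
  have h3 := dist_triangle (y - lam • gradient (moreau Ω P.value lam) y) y x
  rw [← dist_eq_norm, dist_comm] at h2
  linarith

theorem norm_smul_gradient_le (h : P.Frame Ω ω δ w C r Vb L) (hl : SmallLam C r Vb lam) {y : E d}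
    (hy : y ∈ Metric.thickening (2 * r) (sublevel Ω ω w δ)) :
    ‖lam • gradient (moreau Ω P.value lam) y‖ ≤ lam * L := by
  rw [norm_smul, Real.norm_eq_abs, abs_of_pos hl.pos]
  exact mul_le_mul_of_nonneg_left (h.norm_gradient_le hl hy) hl.pos.le

/-- This transfers a lower bound for a single subgradient of `V` to the envelope at every small `λ`,
and hence to the growth rate. -/
theorem gradient_add_smul (h : P.Frame Ω ω δ w C r Vb L) (hl : SmallLam C r Vb lam) {p ξ : E d}
    (hp : p ∈ Ω) (hξ : IsSubgrad C Ω P.value p ξ)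
    (hy : p + lam • ξ ∈ Metric.thickening (2 * r) (sublevel Ω ω w δ)) :
    gradient (moreau Ω P.value lam) (p + lam • ξ) = ξ := by
  have h1 := hξ.mem_proxSet hl.pos (hl.mul_C_le.trans (by norm_num)) hp
  rw [(h.hasGradientAt_of_mem hl hy h1).gradient, add_sub_cancel_left, smul_smul,
    inv_mul_cancel₀ hl.pos.ne', one_smul]

theorem continuousOn_gradient_moreau (h : P.Frame Ω ω δ w C r Vb L) (hl : SmallLam C r Vb lam) :
    ContinuousOn (gradient (moreau Ω P.value lam))
      (Metric.thickening (2 * r) (sublevel Ω ω w δ)) := by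
  have hlip : LipschitzOnWith 2 (fun y => y - lam • gradient (moreau Ω P.value lam) y)
      (Metric.thickening (2 * r) (sublevel Ω ω w δ)) := by
    refine LipschitzOnWith.of_dist_le_mul fun y hy y' hy' => ?_
    rw [dist_eq_norm, dist_eq_norm]
    exact h.semiconvex.proxSet_lipschitz hl.pos hl.mul_C_le (h.prox_mem hl hy') (h.prox_mem hl hy)
  have h1 : ContinuousOn (fun y => lam⁻¹ • (y - (y - lam • gradient (moreau Ω P.value lam) y)))
      (Metric.thickening (2 * r) (sublevel Ω ω w δ)) := by
    have h2 := hlip.continuousOn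
    fun_prop
  refine h1.congr fun y _ => ?_
  simp only
  rw [sub_sub_cancel, smul_smul, inv_mul_cancel₀ hl.pos.ne', one_smul]

theorem le_moreau_sub (h : P.Frame Ω ω δ w C r Vb L) (hl : SmallLam C r Vb lam) {y : E d}
    (hy : y ∈ Metric.thickening (2 * r) (sublevel Ω ω w δ)) (y' : E d) :
    inner ℝ (gradient (moreau Ω P.value lam) y) (y' - y) - C * ‖y' - y‖ ^ 2
      ≤ moreau Ω P.value lam y' - moreau Ω P.value lam y := by
  have := h.semiconvex.le_moreau_sub hl.pos h.C_pos.le hl.mul_C_le (nonneg P Ω) (h.prox_mem hl hy) y'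
  rwa [sub_sub_cancel, smul_smul, inv_mul_cancel₀ hl.pos.ne', one_smul] at this

theorem continuous_moreau (h : P.Frame Ω ω δ w C r Vb L) (hl : SmallLam C r Vb lam)
    (hne : Ω.Nonempty) : Continuous (moreau Ω P.value lam) :=
  _root_.continuous_moreau hl.pos (nonneg P Ω) hne h.bounded

/-- The Moreau envelope converges to the value function uniformly on `ω_δ`. -/
theorem exists_value_sub_moreau_le (h : P.Frame Ω ω δ w C r Vb L) {η : ℝ} (hη : 0 < η) :
    ∃ l > 0, ∀ lam, SmallLam C r Vb lam → lam < l → ∀ y ∈ sublevel Ω ω w δ,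
      P.value y - moreau Ω P.value lam y ≤ η := by
  obtain ⟨q, hq, hq'⟩ := h.bounded.isCompact_closure.exists_norm_sub_lt h.cont.continuousOn hη
  refine ⟨q / L, by have := h.L_pos; positivity, fun lam hl hlam y hy => ?_⟩
  have hy2 : y ∈ Metric.thickening (2 * r) (sublevel Ω ω w δ) :=
    Metric.self_subset_thickening (by linarith [h.r_pos]) _ hy
  have hp := h.prox_mem hl hy2
  have h1 := hq' y (subset_closure hy.1) _ (subset_closure hp.1) (by
    rw [sub_sub_cancel]
    refine (h.norm_smul_gradient_le hl hy2).trans_lt ?_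
    rwa [lt_div_iff₀ h.L_pos] at hlam)
  rw [moreau_eq hl.pos (nonneg P Ω) hp]
  have h2 := (le_abs_self _).trans h1.le
  have h3 : 0 ≤ 1 / (2 * lam) * ‖y - lam • gradient (moreau Ω P.value lam) y - y‖ ^ 2 := by
    have := hl.pos
    positivity
  linarith

theorem lipNorm_f_ne_top (h : P.Frame Ω ω δ w C r Vb L) : lipNorm P.f Ω ≠ ⊤ :=
  h.standing.f_lip.lipNorm_ne_top h.bounded

theorem lipNorm_B_ne_top (h : P.Frame Ω ω δ w C r Vb L) : lipNorm P.B Ω ≠ ⊤ :=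
  h.standing.B_lip.lipNorm_ne_top h.bounded

theorem lipNorm_ell_ne_top (h : P.Frame Ω ω δ w C r Vb L) : lipNorm P.ell Ω ≠ ⊤ :=
  h.standing.ell_lip.lipNorm_ne_top h.bounded

theorem supNorm_gradient_ne_top (h : P.Frame Ω ω δ w C r Vb L) (hne : Ω.Nonempty) :
    supNorm (gradient w) Ω ≠ ⊤ :=
  _root_.supNorm_gradient_ne_top h.isOpen hne h.semiconvex.1 h.bounded h.w_C1

end Frame

end ControlProblem

/-! ### The Hamilton–Jacobi–Bellman and Lyapunov inequalities for the envelope -/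

namespace ControlProblem

variable {d m : ℕ} {P : ControlProblem d m}

theorem norm_adjoint_apply_le (P : ControlProblem d m) (x ξ : E d) :
    ‖ContinuousLinearMap.adjoint (P.B x) ξ‖ ≤ ‖P.B x‖ * ‖ξ‖ := by
  refine (ContinuousLinearMap.le_opNorm _ _).trans (le_of_eq ?_)
  rw [LinearIsometryEquiv.norm_map]

theorem norm_adjoint_sub_apply_le (P : ControlProblem d m) (x y ξ : E d) :
    ‖ContinuousLinearMap.adjoint (P.B x) ξ - ContinuousLinearMap.adjoint (P.B y) ξ‖
      ≤ ‖P.B x - P.B y‖ * ‖ξ‖ := by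
  rw [← sub_apply, ← map_sub]
  refine (ContinuousLinearMap.le_opNorm _ _).trans (le_of_eq ?_)
  rw [LinearIsometryEquiv.norm_map]

/-- `∇w(x)ᵀ (f(x) - B(x) B(x)ᵀ ξ / β)`. -/
noncomputable def lyapDrift (P : ControlProblem d m) (w : E d → ℝ) (x ξ : E d) : ℝ :=
  inner ℝ (gradient w x) (P.f x) - P.β⁻¹ * inner ℝ (ContinuousLinearMap.adjoint (P.B x)
    (gradient w x)) (ContinuousLinearMap.adjoint (P.B x) ξ)

theorem inner_closedLoop_eq_lyapDrift (P : ControlProblem d m) (w v : E d → ℝ) (x : E d) :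
    inner ℝ (gradient w x) (P.f x + P.B x (P.feedback v x)) = P.lyapDrift w x (gradient v x) := by
  rw [lyapDrift, feedback, inner_add_right, map_neg, map_smul, inner_neg_right, inner_smul_right,
    ContinuousLinearMap.adjoint_inner_left]
  ring

/-- The constant in the approximate Hamilton-Jacobi-Bellman equation of the Moreau envelope. -/
noncomputable def hamConst (P : ControlProblem d m) (Ω : Set (E d)) (L : ℝ) : ℝ :=
  ((lipNorm P.f Ω).toReal * L + (lipNorm P.ell Ω).toReal
    + P.β⁻¹ * (lipNorm P.B Ω).toReal ^ 2 * L ^ 2) * L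

theorem hasGradientAt_quadratic {n : ℕ} (C : ℝ) (p ξ : E n) :
    HasGradientAt (fun z => inner ℝ ξ (z - p) - C / 2 * ‖z - p‖ ^ 2) ξ p := by
  rw [hasGradientAt_iff_isLittleO]
  have h1 := Asymptotics.isLittleO_norm_pow_id (E' := E n) one_lt_two
  have h2 := h1.comp_tendsto (show Tendsto (fun z => z - p) (𝓝 p) (𝓝 0) from by
    have : Tendsto (fun z => z - p) (𝓝 p) (𝓝 (p - p)) := Continuous.tendsto (by fun_prop) p
    simpa using this)
  refine (h2.const_mul_left (-(C / 2))).congr_left fun z => ?_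
  simp

namespace Frame

variable {Ω ω : Set (E d)} {δ : ℝ} {w : E d → ℝ} {C r Vb L lam : ℝ}

theorem sub_smul_gradient_mem (h : P.Frame Ω ω δ w C r Vb L) (hl : SmallLam C r Vb lam) {y : E d}
    (hy : y ∈ Metric.thickening (2 * r) (sublevel Ω ω w δ)) :
    y - lam • gradient (moreau Ω P.value lam) y ∈ Ω := (h.prox_mem hl hy).1

theorem hamConst_nonneg (h : P.Frame Ω ω δ w C r Vb L) : 0 ≤ P.hamConst Ω L := by
  have := h.L_pos
  have := h.standing.β_pos
  unfold hamConst
  positivity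

theorem sublevel_subset_thickening (h : P.Frame Ω ω δ w C r Vb L) :
    sublevel Ω ω w δ ⊆ Metric.thickening (2 * r) (sublevel Ω ω w δ) :=
  Metric.self_subset_thickening (by linarith [h.r_pos]) _

theorem norm_adjoint_sub_le (h : P.Frame Ω ω δ w C r Vb L) {x y : E d} (hx : x ∈ Ω) (hy : y ∈ Ω)
    (ξ : E d) :
    ‖ContinuousLinearMap.adjoint (P.B x) ξ - ContinuousLinearMap.adjoint (P.B y) ξ‖
      ≤ (lipNorm P.B Ω).toReal * ‖x - y‖ * ‖ξ‖ :=
  (P.norm_adjoint_sub_apply_le x y ξ).trans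
    (mul_le_mul_of_nonneg_right (norm_sub_le_lipNorm h.lipNorm_B_ne_top hx hy) (norm_nonneg _))

theorem norm_adjoint_le (h : P.Frame Ω ω δ w C r Vb L) {x : E d} (hx : x ∈ Ω) (ξ : E d) :
    ‖ContinuousLinearMap.adjoint (P.B x) ξ‖ ≤ (lipNorm P.B Ω).toReal * ‖ξ‖ :=
  (P.norm_adjoint_apply_le x ξ).trans
    (mul_le_mul_of_nonneg_right (norm_le_lipNorm h.lipNorm_B_ne_top hx) (norm_nonneg _))

/-- The Moreau envelope is an approximate super-solution of the Hamilton-Jacobi-Bellman equation. -/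
theorem negHam_le (h : P.Frame Ω ω δ w C r Vb L) (hl : SmallLam C r Vb lam) {y : E d}
    (hy : y ∈ sublevel Ω ω w δ) :
    P.negHam y (gradient (moreau Ω P.value lam) y) ≤ P.hamConst Ω L * lam := by
  have hy2 := h.sublevel_subset_thickening hy
  have hβ := h.standing.β_pos
  set ξ := gradient (moreau Ω P.value lam) y with hξ
  set p := y - lam • ξ with hp
  have hpΩ : p ∈ Ω := h.sub_smul_gradient_mem hl hy2
  -- The inequality is exact at the proximal point `p` for the same `ξ`; only the base point is
  -- moved from `p` to `y`, over a distance at most `λL`.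
  have h0 : P.negHam p ξ ≤ 0 :=
    h.standing.negHam_nonpos h.fin h.isOpen h.C_pos.le hpΩ (h.isSubgrad hl hy2)
  have hξL : ‖ξ‖ ≤ L := h.norm_gradient_le hl hy2
  have hyp : ‖y - p‖ ≤ lam * L := by
    rw [hp, sub_sub_cancel]; exact h.norm_smul_gradient_le hl hy2
  set bf := (lipNorm P.f Ω).toReal
  set bB := (lipNorm P.B Ω).toReal with hbB
  set bl := (lipNorm P.ell Ω).toReal
  have hbB0 : 0 ≤ bB := ENNReal.toReal_nonneg
  have e1 : inner ℝ (P.f y) ξ - inner ℝ (P.f p) ξ ≤ bf * L * ‖y - p‖ := by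
    rw [← inner_sub_left]
    refine (real_inner_le_norm _ _).trans ?_
    refine (mul_le_mul (norm_sub_le_lipNorm h.lipNorm_f_ne_top hy.1 hpΩ) hξL (norm_nonneg _)
      (by positivity)).trans (le_of_eq (by ring))
  have e2 : P.ell y - P.ell p ≤ bl * ‖y - p‖ :=
    (le_abs_self _).trans (norm_sub_le_lipNorm h.lipNorm_ell_ne_top hy.1 hpΩ)
  have e3 : ‖ContinuousLinearMap.adjoint (P.B p) ξ‖ ^ 2 - ‖ContinuousLinearMap.adjoint (P.B y) ξ‖ ^ 2
      ≤ 2 * (bB ^ 2 * L ^ 2) * ‖y - p‖ := by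
    have h1 := h.norm_adjoint_sub_le hpΩ hy.1 ξ
    have h2 := h.norm_adjoint_le hpΩ ξ
    have h3 := h.norm_adjoint_le hy.1 ξ
    have h4 := norm_sub_norm_le (ContinuousLinearMap.adjoint (P.B p) ξ)
      (ContinuousLinearMap.adjoint (P.B y) ξ)
    rw [norm_sub_rev p y] at h1
    set α := ‖ContinuousLinearMap.adjoint (P.B p) ξ‖
    set γ := ‖ContinuousLinearMap.adjoint (P.B y) ξ‖
    have h5 : bB * ‖y - p‖ * ‖ξ‖ ≤ bB * ‖y - p‖ * L := mul_le_mul_of_nonneg_left hξL (by positivity)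
    have h6 : bB * ‖ξ‖ ≤ bB * L := mul_le_mul_of_nonneg_left hξL hbB0
    have hL := h.L_pos
    calc α ^ 2 - γ ^ 2 = (α - γ) * (α + γ) := by ring
      _ ≤ (bB * ‖y - p‖ * L) * (bB * L + bB * L) :=
        mul_le_mul (by linarith) (by linarith) (by positivity) (by positivity)
      _ = _ := by ring
  have e4 : P.negHam y ξ - P.negHam p ξ
      ≤ (bf * L + bl + P.β⁻¹ * bB ^ 2 * L ^ 2) * ‖y - p‖ := by
    have h1 := mul_le_mul_of_nonneg_left e3 (by positivity : 0 ≤ 1 / (2 * P.β))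
    have h2 : 1 / (2 * P.β) * (2 * (bB ^ 2 * L ^ 2) * ‖y - p‖)
        = P.β⁻¹ * bB ^ 2 * L ^ 2 * ‖y - p‖ := by field_simp
    unfold negHam
    linarith
  have hL := h.L_pos
  have e5 := mul_le_mul_of_nonneg_left hyp
    (by positivity : 0 ≤ bf * L + bl + P.β⁻¹ * bB ^ 2 * L ^ 2)
  have e6 : P.hamConst Ω L * lam = (bf * L + bl + P.β⁻¹ * bB ^ 2 * L ^ 2) * (lam * L) := by
    unfold hamConst; ring
  rw [e6]
  linarith

/-- The energy inequality along controlled trajectories in `ω_δ`. -/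
theorem energy_le (h : P.Frame Ω ω δ w C r Vb L) (hl : SmallLam C r Vb lam) {T e : ℝ}
    (hT : 0 ≤ T) {y : ℝ → E d} {v : ℝ → E m} (hv : ContinuousOn v (Icc 0 T))
    (hy : ∀ t ∈ Icc 0 T, HasDerivWithinAt y (P.f (y t) + P.B (y t) (v t)) (Icc 0 T) t)
    (hmem : ∀ t ∈ Icc 0 T, y t ∈ sublevel Ω ω w δ)
    (he : ∀ t ∈ Icc 0 T, ‖v t + P.β⁻¹ • ContinuousLinearMap.adjoint (P.B (y t))
      (gradient (moreau Ω P.value lam) (y t))‖ ≤ e) :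
    moreau Ω P.value lam (y T) - moreau Ω P.value lam (y 0)
      + (∫ t in (0 : ℝ)..T, P.runCost v y t) ≤ (P.hamConst Ω L * lam + P.β / 2 * e ^ 2) * T := by
  have hyc : ContinuousOn y (Icc 0 T) := fun t ht => (hy t ht).continuousWithinAt
  have hβ := h.standing.β_pos
  have hrc : ContinuousOn (P.runCost v y) (Icc 0 T) :=
    (h.standing.continuous_ell.comp_continuousOn hyc).add
      (continuousOn_const.mul (hv.norm.pow 2))
  have hgrad : ∀ t ∈ Icc 0 T, HasGradientAt (moreau Ω P.value lam)
      (gradient (moreau Ω P.value lam) (y t)) (y t) := fun t ht =>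
    h.hasGradientAt hl (h.sublevel_subset_thickening (hmem t ht))
  have hMc : ContinuousOn (fun t => moreau Ω P.value lam (y t)) (Icc 0 T) := fun t ht =>
    (hgrad t ht).continuousAt.comp_continuousWithinAt (hyc t ht)
  have key := intervalIntegral.sub_le_integral_of_hasDeriv_right_of_le hT hMc
    (g' := fun t => inner ℝ (gradient (moreau Ω P.value lam) (y t))
      (P.f (y t) + P.B (y t) (v t)))
    (φ := fun t => (P.hamConst Ω L * lam + P.β / 2 * e ^ 2) - P.runCost v y t) ?_
    (continuousOn_const.sub hrc).integrableOn_Icc ?_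
  · rw [intervalIntegral.integral_sub intervalIntegrable_const
      (by rw [intervalIntegrable_iff_integrableOn_Icc_of_le hT]; exact hrc.integrableOn_Icc),
      intervalIntegral.integral_const, smul_eq_mul, sub_zero] at key
    linarith
  · intro t ht
    have ht' := Ioo_subset_Icc_self ht
    have h1 := (hgrad t ht').hasFDerivAt.comp_hasDerivAt t
      ((hy t ht').hasDerivAt (Icc_mem_nhds ht.1 ht.2))
    exact h1.hasDerivWithinAt
  · intro t ht
    have ht' := Ioo_subset_Icc_self ht
    have h1 := P.negHam_add hβ (y t) (gradient (moreau Ω P.value lam) (y t)) (v t)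
    have h2 := h.negHam_le hl (hmem t ht')
    have h3 : P.β / 2 * ‖v t + P.β⁻¹ • ContinuousLinearMap.adjoint (P.B (y t))
      (gradient (moreau Ω P.value lam) (y t))‖ ^ 2 ≤ P.β / 2 * e ^ 2 := by
      have := he t ht'
      gcongr
    rw [real_inner_comm] at h1
    simp only [runCost]
    linarith

/-! ### The Lyapunov function -/

/-- The subgradient inequality says that `V` minus the quadratic `⟨ξ, z - p⟩ - C/2 |z - p|²` has a
minimum at `p`, so this quadratic, with gradient `ξ` at `p`, is a test function for the Lyapunov
condition. -/
theorem lyapDrift_nonpos (h : P.Frame Ω ω δ w C r Vb L) {p ξ : E d}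
    (hp : p ∈ sublevel Ω ω w δ) (hξ : IsSubgrad C Ω P.value p ξ) : P.lyapDrift w p ξ ≤ 0 := by
  set q : E d → ℝ := fun z => inner ℝ ξ (z - p) - C / 2 * ‖z - p‖ ^ 2 with hq
  have hg : gradient q p = ξ := (hasGradientAt_quadratic C p ξ).gradient
  have h1 := h.lyap.super p hp q
    (by
      refine ContDiff.contDiffOn ?_
      exact (contDiff_const.inner ℝ (contDiff_id.sub contDiff_const)).sub
        (contDiff_const.mul ((contDiff_id.sub contDiff_const).norm_sq ℝ)))
    (by
      filter_upwards [h.isOpen.mem_nhds hp.1] with z hz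
      have := hξ z hz
      simp only [hq, sub_self, inner_zero_right, norm_zero]
      norm_num
      linarith)
  rw [P.inner_closedLoop_eq_lyapDrift, hg] at h1
  exact h1

theorem norm_gradient_w_le (h : P.Frame Ω ω δ w C r Vb L) {x : E d} (hx : x ∈ Ω) :
    ‖gradient w x‖ ≤ (supNorm (gradient w) Ω).toReal :=
  norm_le_toReal_supNorm (h.supNorm_gradient_ne_top ⟨x, hx⟩) hx

/-- The supremum in `gLam` runs over a single proximal point, at distance `λ|∇M_λV(y)|` from `y`. -/
theorem gLam_eq (h : P.Frame Ω ω δ w C r Vb L) (hl : SmallLam C r Vb lam) {y : E d}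
    (hy : y ∈ Metric.thickening (2 * r) (sublevel Ω ω w δ)) :
    P.gLam Ω ω δ w P.value 0 lam y
      = modulus (gradient w) (sublevel Ω ω w δ) ‖lam • gradient (moreau Ω P.value lam) y‖ *
        ((supNorm P.f Ω).toReal
          + P.β⁻¹ * ‖gradient (moreau Ω P.value lam) y‖ * (supNorm P.B Ω).toReal ^ 2)
      + (lipNorm P.f Ω).toReal * (supNorm (gradient w) Ω).toReal
          * ‖lam • gradient (moreau Ω P.value lam) y‖
      + 2 * P.β⁻¹ * (lam * ‖gradient (moreau Ω P.value lam) y‖ ^ 2) * (lipNorm P.B Ω).toReal ^ 2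
          * (supNorm (gradient w) Ω).toReal := by
  have h1 : ‖lam • gradient (moreau Ω P.value lam) y‖
      = lam * ‖gradient (moreau Ω P.value lam) y‖ := by
    rw [norm_smul, Real.norm_eq_abs, abs_of_pos hl.pos]
  have hl0 := hl.pos.ne'
  rw [gLam, h.proxSet_eq hl hy, image_singleton, csSup_singleton, sub_sub_cancel, h1,
    mul_div_cancel_left₀ _ hl0, one_div, div_eq_mul_inv, mul_pow,
    show lam ^ 2 * ‖gradient (moreau Ω P.value lam) y‖ ^ 2 / lam
      = lam * ‖gradient (moreau Ω P.value lam) y‖ ^ 2 by field_simp]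
  simp

/-- The last summand of `g_λ` alone is of order `λ|∇M_λV|²`. It is the lower bound of order `λ` for
the growth rate that absorbs the excess when `ε` is small compared to `λ`. -/
theorem le_gLam (h : P.Frame Ω ω δ w C r Vb L) (hl : SmallLam C r Vb lam) {y : E d}
    (hy : y ∈ Metric.thickening (2 * r) (sublevel Ω ω w δ)) :
    2 * P.β⁻¹ * (lam * ‖gradient (moreau Ω P.value lam) y‖ ^ 2) * (lipNorm P.B Ω).toReal ^ 2
          * (supNorm (gradient w) Ω).toReal ≤ P.gLam Ω ω δ w P.value 0 lam y := by
  rw [h.gLam_eq hl hy]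
  have := h.standing.β_pos
  have := modulus_nonneg (gradient w) (sublevel Ω ω w δ)
    ‖lam • gradient (moreau Ω P.value lam) y‖
  refine le_add_of_nonneg_left ?_
  positivity

theorem gLam_nonneg (h : P.Frame Ω ω δ w C r Vb L) (hl : SmallLam C r Vb lam) {y : E d}
    (hy : y ∈ Metric.thickening (2 * r) (sublevel Ω ω w δ)) :
    0 ≤ P.gLam Ω ω δ w P.value 0 lam y := by
  refine le_trans ?_ (h.le_gLam hl hy)
  have := h.standing.β_pos
  have := hl.pos
  positivity

/-- The closed loop vector field with `∇v(x)` replaced by `ξ`. -/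
noncomputable def _root_.ControlProblem.gradField (P : ControlProblem d m) (x ξ : E d) : E d :=
  P.f x - P.β⁻¹ • P.B x (ContinuousLinearMap.adjoint (P.B x) ξ)

theorem _root_.ControlProblem.lyapDrift_eq_inner (P : ControlProblem d m) (w : E d → ℝ)
    (x ξ : E d) : P.lyapDrift w x ξ = inner ℝ (gradient w x) (P.gradField x ξ) := by
  rw [lyapDrift, gradField, inner_sub_right, inner_smul_right,
    ContinuousLinearMap.adjoint_inner_left]

theorem norm_gradField_le (h : P.Frame Ω ω δ w C r Vb L) {y : E d} (hy : y ∈ Ω) (ξ : E d) :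
    ‖P.gradField y ξ‖
      ≤ (supNorm P.f Ω).toReal + P.β⁻¹ * ‖ξ‖ * (supNorm P.B Ω).toReal ^ 2 := by
  have hβ := h.standing.β_pos
  have hfy : ‖P.f y‖ ≤ (supNorm P.f Ω).toReal :=
    norm_le_toReal_supNorm (h.standing.continuous_f.supNorm_ne_top h.bounded) hy
  have hBy : ‖P.B y‖ ≤ (supNorm P.B Ω).toReal :=
    norm_le_toReal_supNorm (h.standing.continuous_B.supNorm_ne_top h.bounded) hy
  refine (norm_sub_le _ _).trans (add_le_add hfy ?_)
  rw [norm_smul, Real.norm_eq_abs, abs_of_pos (inv_pos.2 hβ), mul_assoc]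
  refine mul_le_mul_of_nonneg_left ?_ (inv_pos.2 hβ).le
  refine ((P.B y).le_opNorm _).trans ?_
  have h2 : ‖ContinuousLinearMap.adjoint (P.B y) ξ‖ ≤ (supNorm P.B Ω).toReal * ‖ξ‖ :=
    (P.norm_adjoint_apply_le y ξ).trans (mul_le_mul_of_nonneg_right hBy (norm_nonneg _))
  exact (mul_le_mul hBy h2 (norm_nonneg _) ENNReal.toReal_nonneg).trans (le_of_eq (by ring))

theorem norm_gradField_sub_le (h : P.Frame Ω ω δ w C r Vb L) {y p : E d} (hy : y ∈ Ω)
    (hp : p ∈ Ω) (ξ : E d) :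
    ‖P.gradField y ξ - P.gradField p ξ‖ ≤ (lipNorm P.f Ω).toReal * ‖y - p‖
      + 2 * P.β⁻¹ * (‖y - p‖ * ‖ξ‖) * (lipNorm P.B Ω).toReal ^ 2 := by
  have hβ := h.standing.β_pos
  have hbB0 : 0 ≤ (lipNorm P.B Ω).toReal := ENNReal.toReal_nonneg
  set ay := ContinuousLinearMap.adjoint (P.B y) ξ with hay
  set ap := ContinuousLinearMap.adjoint (P.B p) ξ with hap
  have e1 : P.gradField y ξ - P.gradField p ξ = (P.f y - P.f p)
      - P.β⁻¹ • ((P.B y - P.B p) ay + P.B p (ay - ap)) := by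
    simp only [gradField, sub_apply, map_sub, ← hay, ← hap]
    module
  rw [e1]
  refine (norm_sub_le _ _).trans (add_le_add (norm_sub_le_lipNorm h.lipNorm_f_ne_top hy hp) ?_)
  rw [norm_smul, Real.norm_eq_abs, abs_of_pos (inv_pos.2 hβ)]
  have e2 : ‖(P.B y - P.B p) ay‖
      ≤ ((lipNorm P.B Ω).toReal * ‖y - p‖) * ((lipNorm P.B Ω).toReal * ‖ξ‖) :=
    (ContinuousLinearMap.le_opNorm _ _).trans (mul_le_mul
      (norm_sub_le_lipNorm h.lipNorm_B_ne_top hy hp) (h.norm_adjoint_le hy ξ)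
      (norm_nonneg _) (by positivity))
  have e3 : ‖P.B p (ay - ap)‖
      ≤ (lipNorm P.B Ω).toReal * ((lipNorm P.B Ω).toReal * ‖y - p‖ * ‖ξ‖) :=
    (ContinuousLinearMap.le_opNorm _ _).trans (mul_le_mul
      (norm_le_lipNorm h.lipNorm_B_ne_top hp) (h.norm_adjoint_sub_le hy hp ξ)
      (norm_nonneg _) hbB0)
  have e4 := (norm_add_le _ _).trans (add_le_add e2 e3)
  exact (mul_le_mul_of_nonneg_left e4 (inv_pos.2 hβ).le).trans (le_of_eq (by ring))

/-- The drift at `p` is non-positive. Passing from `p` to `y` with `ξ` fixed costs the oscillation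
of `∇w` times the size of the field, plus `|∇w|` times the oscillation of the field; these are the
terms of `g_λ`. -/
theorem lyapDrift_le_of_isSubgrad (h : P.Frame Ω ω δ w C r Vb L) (hlam : 0 < lam) {y p ξ : E d}
    (hy : y ∈ sublevel Ω ω w δ) (hp : p ∈ sublevel Ω ω w δ) (hξ : IsSubgrad C Ω P.value p ξ)
    (hyp : y - p = lam • ξ) :
    P.lyapDrift w y ξ ≤ modulus (gradient w) (sublevel Ω ω w δ) ‖lam • ξ‖ *
        ((supNorm P.f Ω).toReal + P.β⁻¹ * ‖ξ‖ * (supNorm P.B Ω).toReal ^ 2)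
      + (lipNorm P.f Ω).toReal * (supNorm (gradient w) Ω).toReal * ‖lam • ξ‖
      + 2 * P.β⁻¹ * (lam * ‖ξ‖ ^ 2) * (lipNorm P.B Ω).toReal ^ 2
          * (supNorm (gradient w) Ω).toReal := by
  have h0 := h.lyapDrift_nonpos hp hξ
  have hnorm : ‖y - p‖ = lam * ‖ξ‖ := by
    rw [hyp, norm_smul, Real.norm_eq_abs, abs_of_pos hlam]
  rw [← hyp]
  have hμ : ‖gradient w y - gradient w p‖
      ≤ modulus (gradient w) (sublevel Ω ω w δ) ‖y - p‖ :=
    norm_sub_le_modulus (c := (supNorm (gradient w) Ω).toReal)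
      (fun x hx => h.norm_gradient_w_le (sublevel_subset hx)) hy hp le_rfl
  rw [P.lyapDrift_eq_inner] at h0 ⊢
  have e5 : inner ℝ (gradient w y) (P.gradField y ξ)
      = inner ℝ (gradient w y - gradient w p) (P.gradField y ξ)
      + inner ℝ (gradient w p) (P.gradField y ξ - P.gradField p ξ)
      + inner ℝ (gradient w p) (P.gradField p ξ) := by
    rw [inner_sub_left, inner_sub_right]; ring
  have e6 := (real_inner_le_norm (gradient w y - gradient w p) (P.gradField y ξ)).trans
    (mul_le_mul hμ (h.norm_gradField_le hy.1 ξ) (norm_nonneg _) ((norm_nonneg _).trans hμ))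
  have e7 := (real_inner_le_norm (gradient w p) (P.gradField y ξ - P.gradField p ξ)).trans
    (mul_le_mul (h.norm_gradient_w_le hp.1) (h.norm_gradField_sub_le hy.1 hp.1 ξ)
      (norm_nonneg _) ENNReal.toReal_nonneg)
  rw [e5]
  refine (add_le_add (add_le_add e6 e7) h0).trans (le_of_eq ?_)
  rw [hnorm]
  ring

theorem lyapDrift_le_gLam (h : P.Frame Ω ω δ w C r Vb L) (hl : SmallLam C r Vb lam) {y : E d}
    (hy : y ∈ sublevel Ω ω w δ)
    (hp : y - lam • gradient (moreau Ω P.value lam) y ∈ sublevel Ω ω w δ) :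
    P.lyapDrift w y (gradient (moreau Ω P.value lam) y) ≤ P.gLam Ω ω δ w P.value 0 lam y := by
  have hy2 := h.sublevel_subset_thickening hy
  rw [h.gLam_eq hl hy2]
  exact h.lyapDrift_le_of_isSubgrad hl.pos hy hp (h.isSubgrad hl hy2) (sub_sub_cancel _ _)

end Frame

end ControlProblem

/-! ### Mollified envelopes, good `ε`, and the growth rate -/

namespace ControlProblem

variable {d m : ℕ} {P : ControlProblem d m}

/-- The growth rate of the Lyapunov function that enters the definition of the horizon. -/
noncomputable def rate (P : ControlProblem d m) (Ω ω : Set (E d)) (δ : ℝ) (w : E d → ℝ)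
    (ε lam : ℝ) : ℝ≥0∞ :=
  P.sigma1 Ω ω δ w P.value 0 ε lam
    + P.sigma2 Ω ω δ w ε *
      supNorm (fun x => ContinuousLinearMap.adjoint (P.B x)
        (gradient (moreau Ω P.value lam) x)) (sublevel Ω ω w δ) / ENNReal.ofReal P.β

namespace Frame

variable {Ω ω : Set (E d)} {δ : ℝ} {w : E d → ℝ} {C r Vb L lam ε : ℝ} {ρ : E d → ℝ}

theorem ball_subset (h : P.Frame Ω ω δ w C r Vb L) (hεr : ε < r) {x : E d}
    (hx : x ∈ sublevel Ω ω w δ) :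
    Metric.closedBall x ε ⊆ Metric.thickening (2 * r) (sublevel Ω ω w δ) :=
  (Metric.closedBall_subset_ball (by linarith [h.r_pos])).trans (ball_subset_thickening hx _)

theorem gradient_smoothValue (h : P.Frame Ω ω δ w C r Vb L) (hl : SmallLam C r Vb lam)
    (hρ : IsSmoothMollifier ρ) (hε : 0 < ε) (hεr : ε < r) {x : E d} (hx : x ∈ sublevel Ω ω w δ) :
    gradient (P.smoothValue Ω ρ ε lam) x
      = ∫ z, ρ z • gradient (moreau Ω P.value lam) (x - ε • z) := by
  have hsub : Metric.ball x (ε + r) ⊆ Metric.thickening (2 * r) (sublevel Ω ω w δ) :=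
    (Metric.ball_subset_ball (by linarith)).trans (ball_subset_thickening hx _)
  exact (hρ.hasGradientAt_mollify hε h.r_pos (h.continuous_moreau hl ⟨x, hx.1⟩)
    (fun y hy => h.hasGradientAt hl (hsub hy))
    ((h.continuousOn_gradient_moreau hl).mono hsub)
    (fun y hy => h.norm_gradient_le hl (hsub hy))).gradient

/-- The hypothesis `4λVb ≤ r²` means `2√λ√Vb ≤ r`, and every point within `r` of `B(x,ε)` still lies
in the `2r`-neighbourhood of `ω_δ`, hence off the frontier of the open set `Ω`. -/
theorem ball_subset_innerDomain (h : P.Frame Ω ω δ w C r Vb L) (hlam : 0 < lam)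
    (hl : 4 * lam * Vb ≤ r ^ 2) (hεr : ε < r) {x : E d} (hx : x ∈ sublevel Ω ω w δ) :
    Metric.ball x ε ⊆ innerDomain Ω P.value lam := by
  intro y hy
  have hVb := h.Vb_pos
  have hyΩ : y ∈ Ω := h.thickening_subset (by linarith [h.r_pos])
    (h.ball_subset hεr hx (Metric.ball_subset_closedBall hy))
  have h1 : supNorm P.value Ω ≤ ENNReal.ofReal Vb := supNorm_le_ofReal fun x hx => by
    rw [Real.norm_eq_abs, abs_of_nonneg (P.value_nonneg x)]; exact h.value_le x hx
  have h2 : 2 * ENNReal.ofReal (Real.sqrt lam) * (supNorm P.value Ω) ^ (1 / 2 : ℝ)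
      ≤ ENNReal.ofReal r := by
    have h3 : (supNorm P.value Ω) ^ (1 / 2 : ℝ) ≤ ENNReal.ofReal (Real.sqrt Vb) := by
      refine (ENNReal.rpow_le_rpow h1 (by norm_num)).trans (le_of_eq ?_)
      rw [ENNReal.ofReal_rpow_of_nonneg h.Vb_pos.le (by norm_num), Real.sqrt_eq_rpow]
    refine (mul_le_mul_right h3 _).trans ?_
    have h4 : (2 : ℝ≥0∞) = ENNReal.ofReal 2 := by simp
    rw [h4, ← ENNReal.ofReal_mul (by norm_num), ← ENNReal.ofReal_mul (by positivity)]
    refine ENNReal.ofReal_le_ofReal (abs_le_of_sq_le_sq' ?_ h.r_pos.le).2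
    rw [mul_pow, mul_pow, Real.sq_sqrt hlam.le, Real.sq_sqrt h.Vb_pos.le]
    linarith
  refine ⟨hyΩ, h2.trans (Metric.le_infEDist.2 fun z hz => ?_)⟩
  have hzΩ : z ∉ Ω := by
    rw [h.isOpen.frontier_eq] at hz
    exact hz.2
  rw [edist_dist]
  refine ENNReal.ofReal_le_ofReal (not_lt.1 fun hlt => hzΩ ?_)
  refine h.thickening_subset (s := 2 * r) (by linarith [h.r_pos])
    (ball_subset_thickening hx _ ?_)
  rw [Metric.mem_ball] at hy ⊢
  rw [dist_comm] at hlt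
  linarith [dist_triangle z y x]

/-- On the compact `r`-neighbourhood `∇M_λV` is uniformly continuous, and an average over `B(x,ε)`
deviates from the value at `x` by at most the oscillation, which is made smaller than `√λ`. -/
theorem exists_goodEps (h : P.Frame Ω ω δ w C r Vb L) (hl : SmallLam C r Vb lam)
    (hl' : 4 * lam * Vb ≤ r ^ 2) (hρ : IsSmoothMollifier ρ) :
    ∃ ε₀ : ℝ, 0 < ε₀ ∧ ∀ ε ∈ Ioo 0 ε₀, P.GoodEps Ω ω δ w ρ ε lam := by
  have hr := h.r_pos
  have hsub : Metric.cthickening r (sublevel Ω ω w δ)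
      ⊆ Metric.thickening (2 * r) (sublevel Ω ω w δ) :=
    Metric.cthickening_subset_thickening' (by linarith) (by linarith) _
  have hcomp : IsCompact (Metric.cthickening r (sublevel Ω ω w δ)) :=
    h.isCompact_cthickening.of_isClosed_subset Metric.isClosed_cthickening
      (Metric.cthickening_mono (by linarith) _)
  have hlam := hl.pos
  obtain ⟨q, hq, hq'⟩ := hcomp.exists_norm_sub_lt
    ((h.continuousOn_gradient_moreau hl).mono hsub) (Real.sqrt_pos.2 hl.pos)
  refine ⟨min q r, lt_min hq h.r_pos, fun ε hε => ⟨?_, fun x hx =>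
    h.ball_subset_innerDomain hl.pos hl' (hε.2.trans_le (min_le_right _ _)) hx⟩⟩
  have hεr := hε.2.trans_le (min_le_right _ _)
  have h1 : supNorm (fun x => gradient (P.smoothValue Ω ρ ε lam) x
      - gradient (moreau Ω P.value lam) x) (sublevel Ω ω w δ) ≤ ENNReal.ofReal (Real.sqrt lam) := by
    refine supNorm_le_ofReal fun x hx => ?_
    rw [h.gradient_smoothValue hl hρ hε.1 hεr hx]
    refine hρ.norm_integral_sub_le hε.1 ((h.continuousOn_gradient_moreau hl).mono
      (h.ball_subset hεr hx)) fun y hy => (hq' y ?_ x ?_ ?_).le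
    · refine Metric.thickening_subset_cthickening _ _ (ball_subset_thickening hx _ ?_)
      exact Metric.ball_subset_ball hεr.le hy
    · exact Metric.self_subset_cthickening _ hx
    · rw [← dist_eq_norm]
      exact (Metric.mem_ball.1 hy).trans (hε.2.trans_le (min_le_left _ _))
  refine (pow_le_pow_left₀ (zero_le) h1 2).trans (le_of_eq ?_)
  rw [← ENNReal.ofReal_pow (Real.sqrt_nonneg _), Real.sq_sqrt hl.pos.le]

theorem norm_gradient_sub_sq_le (hg : P.GoodEps Ω ω δ w ρ ε lam) (hlam : 0 < lam) {x : E d}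
    (hx : x ∈ sublevel Ω ω w δ) :
    ‖gradient (P.smoothValue Ω ρ ε lam) x - gradient (moreau Ω P.value lam) x‖ ^ 2 ≤ lam := by
  have h1 := ofReal_norm_le_supNorm (F := fun x => gradient (P.smoothValue Ω ρ ε lam) x
      - gradient (moreau Ω P.value lam) x) hx
  have h2 := (pow_le_pow_left₀ (zero_le) h1 2).trans hg.1
  rw [← ENNReal.ofReal_pow (norm_nonneg _)] at h2
  exact (ENNReal.ofReal_le_ofReal_iff hlam.le).1 h2

/-! ### Smallness of the growth rate -/

theorem continuousOn_gradient_w (h : P.Frame Ω ω δ w C r Vb L) : ContinuousOn (gradient w) Ω :=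
  continuousOn_gradient h.isOpen h.lyap.w_C1

theorem continuousOn_inner_f (h : P.Frame Ω ω δ w C r Vb L) :
    ContinuousOn (fun x => inner ℝ (gradient w x) (P.f x)) Ω :=
  h.continuousOn_gradient_w.inner h.standing.continuous_f.continuousOn

theorem continuousOn_adjoint_w (h : P.Frame Ω ω δ w C r Vb L) :
    ContinuousOn (fun x => ContinuousLinearMap.adjoint (P.B x) (gradient w x)) Ω :=
  h.standing.continuous_adjoint.continuousOn.clm_apply h.continuousOn_gradient_w

/-- With `|∇M_λV| ≤ L` every argument in `g_λ` is `O(λ)`: the modulus tends to `0` by uniform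
continuity of `∇w` on the compact closure of `ω_δ`, the other terms are linear in `λ`. -/
theorem exists_gLam_le (h : P.Frame Ω ω δ w C r Vb L) {η : ℝ} (hη : 0 < η) :
    ∃ l > 0, ∀ lam, SmallLam C r Vb lam → lam < l →
      ∀ y ∈ Metric.thickening (2 * r) (sublevel Ω ω w δ),
        P.gLam Ω ω δ w P.value 0 lam y ≤ η := by
  have hβ := h.standing.β_pos
  have hL := h.L_pos
  set A := (supNorm P.f Ω).toReal + P.β⁻¹ * L * (supNorm P.B Ω).toReal ^ 2 + 1 with hA
  have hA0 : 0 < A := by positivity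
  set A₁ := (lipNorm P.f Ω).toReal * (supNorm (gradient w) Ω).toReal * L
    + 2 * P.β⁻¹ * L ^ 2 * (lipNorm P.B Ω).toReal ^ 2 * (supNorm (gradient w) Ω).toReal + 1 with hA₁
  have hA₁0 : 0 < A₁ := by positivity
  have hcl : closure (sublevel Ω ω w δ) ⊆ Ω :=
    (Metric.closure_subset_cthickening _ _).trans h.cthickening_subset
  obtain ⟨q, hq, hq'⟩ := ((h.bounded.subset sublevel_subset).isCompact_closure).exists_norm_sub_lt
    (h.continuousOn_gradient_w.mono hcl) (η := η / 2 / A) (by positivity)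
  refine ⟨min (q / L) (η / 2 / A₁), lt_min (by positivity) (by positivity),
    fun lam hl hlam y hy => ?_⟩
  have hlam0 := hl.pos
  have h1 : lam * L < q := (lt_div_iff₀ hL).1 (hlam.trans_le (min_le_left _ _))
  have h2 : lam * A₁ < η / 2 := (lt_div_iff₀ hA₁0).1 (hlam.trans_le (min_le_right _ _))
  have h3 := h.norm_smul_gradient_le hl hy
  have h4 := h.norm_gradient_le hl hy
  rw [h.gLam_eq hl hy]
  have h5 : modulus (gradient w) (sublevel Ω ω w δ) ‖lam • gradient (moreau Ω P.value lam) y‖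
      ≤ η / 2 / A := modulus_le (by positivity) fun a ha b hb hab =>
        (hq' a (subset_closure ha) b (subset_closure hb) (by linarith)).le
  have h6 := modulus_nonneg (gradient w) (sublevel Ω ω w δ)
    ‖lam • gradient (moreau Ω P.value lam) y‖
  have h7 : modulus (gradient w) (sublevel Ω ω w δ) ‖lam • gradient (moreau Ω P.value lam) y‖ *
        ((supNorm P.f Ω).toReal
          + P.β⁻¹ * ‖gradient (moreau Ω P.value lam) y‖ * (supNorm P.B Ω).toReal ^ 2)
      ≤ η / 2 / A * A := by
    refine mul_le_mul h5 ?_ (by positivity) (by positivity)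
    have : P.β⁻¹ * ‖gradient (moreau Ω P.value lam) y‖ * (supNorm P.B Ω).toReal ^ 2
        ≤ P.β⁻¹ * L * (supNorm P.B Ω).toReal ^ 2 := by gcongr
    linarith
  rw [div_mul_cancel₀ _ hA0.ne'] at h7
  have h8 : (lipNorm P.f Ω).toReal * (supNorm (gradient w) Ω).toReal
          * ‖lam • gradient (moreau Ω P.value lam) y‖
      ≤ (lipNorm P.f Ω).toReal * (supNorm (gradient w) Ω).toReal * (lam * L) := by gcongr
  have h9 : 2 * P.β⁻¹ * (lam * ‖gradient (moreau Ω P.value lam) y‖ ^ 2)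
        * (lipNorm P.B Ω).toReal ^ 2 * (supNorm (gradient w) Ω).toReal
      ≤ 2 * P.β⁻¹ * (lam * L ^ 2) * (lipNorm P.B Ω).toReal ^ 2
        * (supNorm (gradient w) Ω).toReal := by gcongr
  have h10 : lam * A₁ = (lipNorm P.f Ω).toReal * (supNorm (gradient w) Ω).toReal * (lam * L)
      + 2 * P.β⁻¹ * (lam * L ^ 2) * (lipNorm P.B Ω).toReal ^ 2
        * (supNorm (gradient w) Ω).toReal + lam := by rw [hA₁]; ring
  linarith

theorem exists_sigma_le (h : P.Frame Ω ω δ w C r Vb L) {η : ℝ} (hη : 0 < η) :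
    ∃ l > 0, ∀ lam ε, SmallLam C r Vb lam → lam < l → 0 < ε → ε < l →
      P.sigma1 Ω ω δ w P.value 0 ε lam ≤ ENNReal.ofReal η ∧
      P.sigma2 Ω ω δ w ε ≤ ENNReal.ofReal η := by
  obtain ⟨l₁, hl₁, hg⟩ := h.exists_gLam_le (half_pos hη)
  have hr := h.r_pos
  have hcomp := h.isCompact_cthickening
  obtain ⟨q₁, hq₁, hF⟩ := hcomp.exists_norm_sub_lt
    (h.continuousOn_inner_f.mono h.cthickening_subset) (half_pos hη)
  obtain ⟨q₂, hq₂, ha⟩ := hcomp.exists_norm_sub_lt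
    (h.continuousOn_adjoint_w.mono h.cthickening_subset) hη
  refine ⟨min (min l₁ r) (min q₁ q₂), by positivity, fun lam ε hl hlam hε hεl => ?_⟩
  simp only [lt_min_iff] at hlam hεl
  have hmem : ∀ x ∈ sublevel Ω ω w δ, ∀ y ∈ Metric.ball x ε,
      y ∈ Metric.thickening (2 * r) (sublevel Ω ω w δ) := fun x hx y hy =>
    h.ball_subset hεl.1.2 hx (Metric.ball_subset_closedBall hy)
  have hmem' : Metric.thickening (2 * r) (sublevel Ω ω w δ)
      ⊆ Metric.cthickening (4 * r) (sublevel Ω ω w δ) :=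
    (Metric.thickening_subset_cthickening _ _).trans (Metric.cthickening_mono (by linarith) _)
  constructor
  · refine iSup₂_le fun x hx => iSup₂_le fun y hy => ENNReal.ofReal_le_ofReal ?_
    have h1 := hg lam hl hlam.1.1 y (hmem x hx y hy)
    have h2 := h.gLam_nonneg hl (hmem x hx y hy)
    have h3 := hF x (Metric.self_subset_cthickening _ hx) y (hmem' (hmem x hx y hy)) (by
      rw [← dist_eq_norm, dist_comm]; exact (Metric.mem_ball.1 hy).trans hεl.2.1)
    rw [Real.norm_eq_abs, abs_lt] at h3
    rw [abs_le]
    constructor <;> linarith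
  · refine iSup₂_le fun x hx => iSup₂_le fun y hy => ENNReal.ofReal_le_ofReal ?_
    exact (ha x (Metric.self_subset_cthickening _ hx) y (hmem' (hmem x hx y hy)) (by
      rw [← dist_eq_norm, dist_comm]; exact (Metric.mem_ball.1 hy).trans hεl.2.2)).le

theorem supNorm_adjoint_le (h : P.Frame Ω ω δ w C r Vb L) (hl : SmallLam C r Vb lam) :
    supNorm (fun x => ContinuousLinearMap.adjoint (P.B x) (gradient (moreau Ω P.value lam) x))
      (sublevel Ω ω w δ) ≤ ENNReal.ofReal ((lipNorm P.B Ω).toReal * L) :=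
  supNorm_le_ofReal fun _ hx => (h.norm_adjoint_le hx.1 _).trans
    (mul_le_mul_of_nonneg_left (h.norm_gradient_le hl (h.sublevel_subset_thickening hx))
      ENNReal.toReal_nonneg)

theorem exists_rate_le (h : P.Frame Ω ω δ w C r Vb L) {η : ℝ} (hη : 0 < η) :
    ∃ l > 0, ∀ lam ε, SmallLam C r Vb lam → lam < l → 0 < ε → ε < l →
      P.rate Ω ω δ w ε lam ≤ ENNReal.ofReal η := by
  have hβ := h.standing.β_pos
  have hL := h.L_pos
  set K := (lipNorm P.B Ω).toReal * L with hK
  have hK0 : 0 ≤ K := by positivity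
  obtain ⟨l, hl0, hσ⟩ := h.exists_sigma_le (η := η / (1 + K / P.β)) (by positivity)
  refine ⟨l, hl0, fun lam ε hl hlam hε hεl => ?_⟩
  obtain ⟨h1, h2⟩ := hσ lam ε hl hlam hε hεl
  have h3 := h.supNorm_adjoint_le hl
  refine (add_le_add h1 (ENNReal.div_le_div_right (mul_le_mul' h2 h3) _)).trans (le_of_eq ?_)
  rw [← ENNReal.ofReal_mul (by positivity), ← ENNReal.ofReal_div_of_pos hβ,
    ← ENNReal.ofReal_add (by positivity) (by positivity)]
  congr 1
  field_simp
  rw [hK]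

/-! ### The drift of the Lyapunov function along the closed loop -/

/-- The drift at `x` is affine in the gradient, and `∇V_{ε,λ}(x)` is an average of `ξ = ∇M_λV(y)`,
so it suffices to bound the integrand for each `y`. With `a` for `Bᵀ∇w`, the product `⟨a(x),
B(x)ᵀξ⟩` is compared with `⟨a(y), B(y)ᵀξ⟩`: the change of `a` gives the `σ²`-term of the rate,
whereas the change of `Bᵀ` in front of `ξ` gives the term `ε q`, which the rate does not contain. -/
theorem closedLoop_drift_le (h : P.Frame Ω ω δ w C r Vb L) (hl : SmallLam C r Vb lam)
    (hρ : IsSmoothMollifier ρ) (hε : 0 < ε) (hεr : ε < r)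
    (hrate : P.rate Ω ω δ w ε lam ≠ ⊤) (hσ2 : P.sigma2 Ω ω δ w ε ≠ ⊤) {x : E d} {q : ℝ}
    (hx : x ∈ sublevel Ω ω w δ) (hball : Metric.ball x ε ⊆ sublevel Ω ω w δ)
    (hprox : ∀ y ∈ Metric.ball x ε,
      y - lam • gradient (moreau Ω P.value lam) y ∈ sublevel Ω ω w δ)
    (hq : ∀ y ∈ Metric.ball x ε, ‖gradient (moreau Ω P.value lam) y‖ ≤ q) :
    P.lyapDrift w x (gradient (P.smoothValue Ω ρ ε lam) x) ≤ (P.rate Ω ω δ w ε lam).toReal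
      + P.β⁻¹ * (lipNorm P.B Ω).toReal ^ 2 * (supNorm (gradient w) Ω).toReal * ε * q := by
  have hβ := h.standing.β_pos
  set K := supNorm (fun x => ContinuousLinearMap.adjoint (P.B x)
        (gradient (moreau Ω P.value lam) x)) (sublevel Ω ω w δ) with hK
  have hKtop : K ≠ ⊤ := ne_top_of_le_ne_top ENNReal.ofReal_ne_top (h.supNorm_adjoint_le hl)
  have hσ1 : P.sigma1 Ω ω δ w P.value 0 ε lam ≠ ⊤ := (ENNReal.add_ne_top.1 hrate).1
  have hrate' : (P.rate Ω ω δ w ε lam).toReal = (P.sigma1 Ω ω δ w P.value 0 ε lam).toReal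
      + P.β⁻¹ * ((P.sigma2 Ω ω δ w ε).toReal * K.toReal) := by
    rw [rate, ENNReal.toReal_add hσ1 (ENNReal.add_ne_top.1 hrate).2, ENNReal.toReal_div,
      ENNReal.toReal_mul, ENNReal.toReal_ofReal hβ.le, ← hK, div_eq_inv_mul]
  set a := ContinuousLinearMap.adjoint (P.B x) (gradient w x) with ha
  have hD : P.lyapDrift w x (gradient (P.smoothValue Ω ρ ε lam) x)
      = inner ℝ (gradient w x) (P.f x)
        + inner ℝ (-(P.β⁻¹ • P.B x a)) (gradient (P.smoothValue Ω ρ ε lam) x) := by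
    rw [lyapDrift, inner_neg_left, inner_smul_left, ContinuousLinearMap.adjoint_inner_right]
    simp [ha, sub_eq_add_neg]
  rw [hD, h.gradient_smoothValue hl hρ hε hεr hx, ← le_sub_iff_add_le']
  refine hρ.inner_integral_le hε ((h.continuousOn_gradient_moreau hl).mono
      (h.ball_subset hεr hx)) fun y hy => ?_
  have hyS := hball hy
  set ξ := gradient (moreau Ω P.value lam) y with hξ
  have h1 := h.lyapDrift_le_gLam hl hyS (hprox y hy)
  rw [← hξ] at h1
  have h2 : P.gLam Ω ω δ w P.value 0 lam y - inner ℝ (gradient w y) (P.f y)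
      + inner ℝ (gradient w x) (P.f x) ≤ (P.sigma1 Ω ω δ w P.value 0 ε lam).toReal :=
    (le_abs_self _).trans ((ENNReal.ofReal_le_iff_le_toReal hσ1).1
      (le_iSup₂_of_le x hx (le_iSup₂_of_le y hy le_rfl)))
  set ay := ContinuousLinearMap.adjoint (P.B y) (gradient w y) with hay
  have h3 : ‖a - ay‖ ≤ (P.sigma2 Ω ω δ w ε).toReal :=
    (ENNReal.ofReal_le_iff_le_toReal hσ2).1
      (le_iSup₂_of_le x hx (le_iSup₂_of_le y hy le_rfl))
  have h4 : ‖ContinuousLinearMap.adjoint (P.B y) ξ‖ ≤ K.toReal :=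
    norm_le_toReal_supNorm hKtop hyS
  have h5 : ‖a‖ ≤ (lipNorm P.B Ω).toReal * (supNorm (gradient w) Ω).toReal :=
    (h.norm_adjoint_le hx.1 _).trans
      (mul_le_mul_of_nonneg_left (h.norm_gradient_w_le hx.1) ENNReal.toReal_nonneg)
  have h6 : ‖ContinuousLinearMap.adjoint (P.B y) ξ - ContinuousLinearMap.adjoint (P.B x) ξ‖
      ≤ (lipNorm P.B Ω).toReal * ε * q := by
    refine (h.norm_adjoint_sub_le hyS.1 hx.1 ξ).trans ?_
    have : ‖y - x‖ ≤ ε := by rw [← dist_eq_norm]; exact (Metric.mem_ball.1 hy).le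
    exact mul_le_mul (mul_le_mul_of_nonneg_left this ENNReal.toReal_nonneg) (hq y hy)
      (norm_nonneg _) (by positivity)
  have h7 : inner ℝ (ay - a) (ContinuousLinearMap.adjoint (P.B y) ξ)
      ≤ (P.sigma2 Ω ω δ w ε).toReal * K.toReal := by
    refine (real_inner_le_norm _ _).trans ?_
    rw [norm_sub_rev]
    exact mul_le_mul h3 h4 (norm_nonneg _) ENNReal.toReal_nonneg
  have h8 := (real_inner_le_norm a (ContinuousLinearMap.adjoint (P.B y) ξ
    - ContinuousLinearMap.adjoint (P.B x) ξ)).trans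
    (mul_le_mul h5 h6 (norm_nonneg _) (by positivity))
  have h9 : inner ℝ (-(P.β⁻¹ • P.B x a)) ξ
      = -(P.β⁻¹ * inner ℝ a (ContinuousLinearMap.adjoint (P.B x) ξ)) := by
    rw [inner_neg_left, inner_smul_left, ContinuousLinearMap.adjoint_inner_right]
    simp
  rw [lyapDrift, ← hay] at h1
  rw [h9, hrate']
  rw [inner_sub_left] at h7
  rw [inner_sub_right] at h8
  have h10 := mul_le_mul_of_nonneg_left (add_le_add h7 h8) (inv_pos.2 hβ).le
  linarith

/-! ### Energy along the closed loop -/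

theorem norm_feedback_add_le (h : P.Frame Ω ω δ w C r Vb L) (hlam : 0 < lam)
    (hg : P.GoodEps Ω ω δ w ρ ε lam) {x : E d} (hx : x ∈ sublevel Ω ω w δ) :
    ‖P.feedback (P.smoothValue Ω ρ ε lam) x + P.β⁻¹ • ContinuousLinearMap.adjoint (P.B x)
      (gradient (moreau Ω P.value lam) x)‖
      ≤ P.β⁻¹ * ((lipNorm P.B Ω).toReal * Real.sqrt lam) := by
  have hβ := h.standing.β_pos
  rw [feedback, neg_add_eq_sub, ← smul_sub, ← map_sub, norm_smul, Real.norm_eq_abs,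
    abs_of_pos (inv_pos.2 hβ)]
  refine mul_le_mul_of_nonneg_left ((h.norm_adjoint_le hx.1 _).trans
    (mul_le_mul_of_nonneg_left ?_ ENNReal.toReal_nonneg)) (inv_pos.2 hβ).le
  rw [norm_sub_rev]
  exact Real.le_sqrt_of_sq_le (norm_gradient_sub_sq_le hg hlam hx)

/-- The constant in the energy inequality of the closed loop. -/
noncomputable def _root_.ControlProblem.energyConst (P : ControlProblem d m) (Ω : Set (E d))
    (L : ℝ) : ℝ := P.hamConst Ω L + P.β⁻¹ * (lipNorm P.B Ω).toReal ^ 2 / 2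

theorem energyConst_nonneg (h : P.Frame Ω ω δ w C r Vb L) : 0 ≤ P.energyConst Ω L := by
  have := h.hamConst_nonneg
  have := h.standing.β_pos
  unfold energyConst
  positivity

/-- The feedback of the mollified envelope deviates from that of the envelope by `O(√λ)`; the
deviation enters the energy inequality squared, hence as `O(λ)`. -/
theorem closedLoop_energy_le (h : P.Frame Ω ω δ w C r Vb L) (hl : SmallLam C r Vb lam)
    (hg : P.GoodEps Ω ω δ w ρ ε lam)
    (hu : Continuous (P.feedback (P.smoothValue Ω ρ ε lam))) {T : ℝ} (hT : 0 ≤ T) {y₀ : E d}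
    {y : ℝ → E d}
    (hy : P.IsClosedLoop (sublevel Ω ω w δ) (P.feedback (P.smoothValue Ω ρ ε lam)) T y₀ y) :
    moreau Ω P.value lam (y T) - moreau Ω P.value lam (y 0)
      + (∫ t in (0 : ℝ)..T, P.runCost (fun t => P.feedback (P.smoothValue Ω ρ ε lam) (y t)) y t)
      ≤ P.energyConst Ω L * lam * T := by
  have hyc : ContinuousOn y (Icc 0 T) := fun t ht => (hy.deriv t ht).continuousWithinAt
  have h1 := h.energy_le hl hT (v := fun t => P.feedback (P.smoothValue Ω ρ ε lam) (y t))
    (hu.comp_continuousOn hyc) hy.deriv hy.mem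
    (fun t ht => h.norm_feedback_add_le hl.pos hg (hy.mem t ht))
  refine h1.trans (le_of_eq ?_)
  have hβ := h.standing.β_pos
  rw [mul_pow, mul_pow, Real.sq_sqrt hl.pos.le, energyConst]
  field_simp

end Frame

end ControlProblem

/-! ### Trajectories with small cost -/

namespace ControlProblem
variable {d m : ℕ} {P : ControlProblem d m}

/-- `y` is a trajectory of the control `v` that stays in `D` on `[0,T]`. -/
structure IsControlled (P : ControlProblem d m) (D : Set (E d)) (T : ℝ) (v : ℝ → E m)
    (y : ℝ → E d) : Prop where
  cont : ContinuousOn v (Icc 0 T)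
  deriv : ∀ t ∈ Icc 0 T, HasDerivWithinAt y (P.f (y t) + P.B (y t) (v t)) (Icc 0 T) t
  mem : ∀ t ∈ Icc 0 T, y t ∈ D

namespace IsControlled
variable {D : Set (E d)} {T : ℝ} {v : ℝ → E m} {y : ℝ → E d}

theorem mono (hy : P.IsControlled D T v y) {t : ℝ} (ht : t ≤ T) : P.IsControlled D t v y where
  cont := hy.cont.mono (Icc_subset_Icc_right ht)
  deriv s hs := (hy.deriv s (Icc_subset_Icc_right ht hs)).mono (Icc_subset_Icc_right ht)
  mem s hs := hy.mem s (Icc_subset_Icc_right ht hs)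

theorem continuousOn (hy : P.IsControlled D T v y) : ContinuousOn y (Icc 0 T) :=
  fun t ht => (hy.deriv t ht).continuousWithinAt

theorem continuousOn_field (hP : P.Standing) (hy : P.IsControlled D T v y) :
    ContinuousOn (fun t => P.B (y t) (v t)) (Icc 0 T) :=
  (hP.continuous_B.comp_continuousOn hy.continuousOn).clm_apply hy.cont

theorem continuousOn_runCost (hP : P.Standing) (hy : P.IsControlled D T v y) :
    ContinuousOn (P.runCost v y) (Icc 0 T) :=
  (hP.continuous_ell.comp_continuousOn hy.continuousOn).add
    (continuousOn_const.mul (hy.cont.norm.pow 2))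

theorem eq_integral (hP : P.Standing) (hy : P.IsControlled D T v y) {t : ℝ} (ht : t ∈ Icc 0 T) :
    y t = y 0 + ∫ s in (0 : ℝ)..t, (P.f (y s) + P.B (y s) (v s)) := by
  have hy' := hy.mono ht.2
  rw [intervalIntegral.integral_eq_sub_of_hasDerivAt_of_le ht.1 hy'.continuousOn
    (fun s hs => (hy'.deriv s (Ioo_subset_Icc_self hs)).hasDerivAt (Icc_mem_nhds hs.1 hs.2))]
  · simp
  · refine ContinuousOn.intervalIntegrable ?_
    rw [uIcc_of_le ht.1]
    exact (hP.continuous_f.comp_continuousOn hy'.continuousOn).add (hy'.continuousOn_field hP)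

/-- The difference is the accumulated effect `∫ B(y)v` of the control, and `|v|² ≤ (2/β)` times the
running cost since `ℓ ≥ 0`. -/
theorem norm_sub_sq_le {b : ℝ} (hP : P.Standing) (hb : ∀ x ∈ D, ‖P.B x‖ ≤ b)
    (hy : P.IsControlled D T v y) (hT : 0 ≤ T) :
    ‖y T - (y 0 + ∫ s in (0 : ℝ)..T, P.f (y s))‖ ^ 2
      ≤ T * (b ^ 2 * (2 / P.β) * ∫ s in (0 : ℝ)..T, P.runCost v y s) := by
  have hβ := hP.β_pos
  have hII : ∀ {Y : Type} [NormedAddCommGroup Y] {g : ℝ → Y}, ContinuousOn g (Icc 0 T) →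
      IntervalIntegrable g volume 0 T := fun hg => by
    refine ContinuousOn.intervalIntegrable ?_
    rwa [uIcc_of_le hT]
  have hBv := hy.continuousOn_field hP
  have hg : ContinuousOn (fun s => b * ‖v s‖) (Icc 0 T) := continuousOn_const.mul hy.cont.norm
  have h1 : y T - (y 0 + ∫ s in (0 : ℝ)..T, P.f (y s)) = ∫ s in (0 : ℝ)..T, P.B (y s) (v s) := by
    nth_rw 1 [hy.eq_integral hP (right_mem_Icc.2 hT)]
    have hf : ContinuousOn (fun s => P.f (y s)) (Icc 0 T) :=
      hP.continuous_f.comp_continuousOn hy.continuousOn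
    rw [intervalIntegral.integral_add (hII hf) (hII hBv)]
    abel
  have h2 : ‖∫ s in (0 : ℝ)..T, P.B (y s) (v s)‖ ≤ ∫ s in (0 : ℝ)..T, b * ‖v s‖ := by
    refine (intervalIntegral.norm_integral_le_integral_norm hT).trans
      (intervalIntegral.integral_mono_on hT (hII hBv.norm) (hII hg) fun s hs => ?_)
    refine ((P.B (y s)).le_opNorm _).trans ?_
    gcongr
    exact hb _ (hy.mem s hs)
  rw [h1]
  calc _ ≤ (∫ s in (0 : ℝ)..T, b * ‖v s‖) ^ 2 := by gcongr
    _ ≤ T * ∫ s in (0 : ℝ)..T, (b * ‖v s‖) ^ 2 :=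
      sq_intervalIntegral_le hT (hII hg) (hII (hg.pow 2))
    _ ≤ T * (b ^ 2 * (2 / P.β) * ∫ s in (0 : ℝ)..T, P.runCost v y s) := by
      refine mul_le_mul_of_nonneg_left ?_ hT
      rw [← intervalIntegral.integral_const_mul]
      refine intervalIntegral.integral_mono_on hT (hII (hg.pow 2))
        ((hII (hy.continuousOn_runCost hP)).const_mul _) fun s _ => ?_
      have := hP.ell_nonneg (y s)
      calc (b * ‖v s‖) ^ 2 = b ^ 2 * (2 / P.β) * (0 + P.β / 2 * ‖v s‖ ^ 2) := by field_simp; ring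
        _ ≤ _ := by simp only [runCost]; gcongr

theorem integral_runCost_mono (hP : P.Standing) (hy : P.IsControlled D T v y) {t : ℝ}
    (ht : t ∈ Icc 0 T) :
    ∫ s in (0 : ℝ)..t, P.runCost v y s ≤ ∫ s in (0 : ℝ)..T, P.runCost v y s := by
  refine intervalIntegral.integral_mono_interval le_rfl ht.1 ht.2
    (Eventually.of_forall fun s => hP.runCost_nonneg v y s) ?_
  refine ContinuousOn.intervalIntegrable ?_
  rw [uIcc_of_le (ht.1.trans ht.2)]
  exact hy.continuousOn_runCost hP

/-- The control is small in `L²` only, so Grönwall is not applied to `y` itself but to `q(t) = y(0)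
+ ∫ f(y)`, which stays within `e` of `y` and solves the uncontrolled equation up to the error `Ke`.
-/
theorem dist_flow_le {b η : ℝ} {K : NNReal} {X : E d → E d} {z : ℝ → E d} (hP : P.Standing)
    (hb : ∀ x ∈ D, ‖P.B x‖ ≤ b) (hy : P.IsControlled D T v y) (hX : LipschitzWith K X)
    (hXf : EqOn X P.f D) (hz : ∀ t, HasDerivAt z (X (z t)) t)
    (hη : ∫ s in (0 : ℝ)..T, P.runCost v y s ≤ η) {t : ℝ} (ht : t ∈ Icc 0 T) :
    dist (y t) (z t) ≤ Real.sqrt (T * (b ^ 2 * (2 / P.β) * η))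
      + gronwallBound (dist (y 0) (z 0)) K (K * Real.sqrt (T * (b ^ 2 * (2 / P.β) * η))) t := by
  have hβ := hP.β_pos
  have hT : 0 ≤ T := ht.1.trans ht.2
  set e := Real.sqrt (T * (b ^ 2 * (2 / P.β) * η)) with he
  set q : ℝ → E d := fun t => y 0 + ∫ s in (0 : ℝ)..t, P.f (y s) with hq
  have hyq : ∀ s ∈ Icc 0 T, dist (y s) (q s) ≤ e := fun s hs => by
    rw [dist_eq_norm]
    refine Real.le_sqrt_of_sq_le (((hy.mono hs.2).norm_sub_sq_le hP hb hs.1).trans ?_)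
    have h1 := (hy.integral_runCost_mono hP hs).trans hη
    have h0 : 0 ≤ ∫ r in (0 : ℝ)..s, P.runCost v y r :=
      intervalIntegral.integral_nonneg hs.1 fun r _ => hP.runCost_nonneg v y r
    have := hs.2
    gcongr
  have hfy : ContinuousOn (fun s => P.f (y s)) (Icc 0 T) :=
    hP.continuous_f.comp_continuousOn hy.continuousOn
  have hqd : ∀ s ∈ Ico 0 T, HasDerivWithinAt q (P.f (y s)) (Ici s) s := fun s hs => by
    refine HasDerivWithinAt.const_add _ ?_
    have hs' : s ∈ Icc 0 T := Ico_subset_Icc_self hs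
    refine intervalIntegral.integral_hasDerivWithinAt_right (t := Ioi s) ?_ ?_ ?_
    · refine ContinuousOn.intervalIntegrable ?_
      rw [uIcc_of_le hs.1]
      exact hfy.mono (Icc_subset_Icc_right hs.2.le)
    · exact ⟨Icc 0 T, mem_of_superset (Ioc_mem_nhdsGT hs.2) (fun x hx => ⟨hs.1.trans hx.1.le, hx.2⟩),
        hfy.aestronglyMeasurable measurableSet_Icc⟩
    · exact (hfy s hs').mono_of_mem_nhdsWithin
        (mem_of_superset (Ioc_mem_nhdsGT hs.2) (fun x hx => ⟨hs.1.trans hx.1.le, hx.2⟩))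
  have hqc : ContinuousOn q (Icc 0 T) := by
    refine continuousOn_const.add ?_
    have := intervalIntegral.continuousOn_primitive_interval (f := fun s => P.f (y s))
      (a := 0) (b := T) (μ := volume) (by
        rw [uIcc_of_le hT]; exact hfy.integrableOn_Icc)
    rwa [uIcc_of_le hT] at this
  have key := dist_le_of_approx_trajectories_ODE (v := fun _ => X) (K := K) (fun _ => hX)
    (f := q) (g := z) (a := 0) (b := T) (εf := K * e) (εg := 0)
    (δ := dist (y 0) (z 0)) hqc hqd ?_ (fun s _ => (hz s).continuousAt.continuousWithinAt)
    (fun s _ => (hz s).hasDerivWithinAt) (fun s _ => by simp) (by simp [hq]) t ht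
  · rw [add_zero, sub_zero] at key
    exact (dist_triangle _ (q t) _).trans (add_le_add (hyq t ht) key)
  · intro s hs
    have hs' : s ∈ Icc 0 T := Ico_subset_Icc_self hs
    rw [← hXf (hy.mem s hs')]
    exact (hX.dist_le_mul _ _).trans (by have := hyq s hs'; gcongr)

end IsControlled

theorem gronwallBound_tendsto_zero {ι : Type*} {l : Filter ι} {δ ε : ι → ℝ} (K t : ℝ)
    (hδ : Tendsto δ l (𝓝 0)) (hε : Tendsto ε l (𝓝 0)) :
    Tendsto (fun i => gronwallBound (δ i) K (ε i) t) l (𝓝 0) := by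
  by_cases hK : K = 0
  · simp only [hK, gronwallBound_K0]
    simpa using hδ.add (hε.mul_const t)
  · simp only [gronwallBound_of_K_ne_0 hK]
    simpa using (hδ.mul_const (Real.exp (K * t))).add
      ((hε.div_const K).mul_const (Real.exp (K * t) - 1))

/-- A trajectory of the uncontrolled system along which the running cost vanishes starts at a
zero of the value function. -/
theorem Standing.value_eq_zero_of_flow (hP : P.Standing) {z : ℝ → E d}
    (hz : ∀ t, 0 ≤ t → HasDerivAt z (P.f (z t)) t)
    (h0 : ∀ t, 0 ≤ t → P.ell (z t) = 0) : P.value (z 0) = 0 := by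
  have hop : P.IsOpenLoop (z 0) (fun _ => 0) z := by
    refine ⟨by simp, fun t ht => (hz t ht).continuousAt.continuousWithinAt, fun t ht => ?_⟩
    have hc : ContinuousOn z (Icc 0 t) := fun s hs => (hz s hs.1).continuousAt.continuousWithinAt
    simp only [map_zero, add_zero]
    rw [intervalIntegral.integral_eq_sub_of_hasDerivAt (f := z)]
    · simp
    · intro s hs
      rw [uIcc_of_le ht] at hs
      exact hz s hs.1
    · refine ContinuousOn.intervalIntegrable ?_
      rw [uIcc_of_le ht]
      exact hP.continuous_f.comp_continuousOn hc
  have hcost : P.cost (fun _ => 0) z = 0 := by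
    rw [cost, setLIntegral_congr_fun (g := fun _ => 0) measurableSet_Ioi]
    · simp
    · intro t ht
      simp [h0 t (le_of_lt ht)]
  have := P.valueENN_le hop
  rw [hcost] at this
  rw [value, nonpos_iff_eq_zero.1 this, ENNReal.toReal_zero]

namespace Frame
variable {Ω ω : Set (E d)} {δ : ℝ} {w : E d → ℝ} {C r Vb L lam ε : ℝ} {ρ : E d → ℝ}

theorem closure_subset (h : P.Frame Ω ω δ w C r Vb L) : closure (sublevel Ω ω w δ) ⊆ Ω :=
  (Metric.closure_subset_cthickening _ _).trans h.cthickening_subset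

theorem isCompact_closure (h : P.Frame Ω ω δ w C r Vb L) :
    IsCompact (closure (sublevel Ω ω w δ)) :=
  h.isCompact_cthickening.of_isClosed_subset isClosed_closure
    (Metric.closure_subset_cthickening _ _)

/-- A trajectory in `ω_δ` with small cost on a long time window starts at a point of small
value. -/
theorem exists_window (h : P.Frame Ω ω δ w C r Vb L) {μ : ℝ} (hμ : 0 < μ) :
    ∃ S > 0, ∃ η > 0, ∀ v y, P.IsControlled (sublevel Ω ω w δ) S v y →
      ∫ s in (0 : ℝ)..S, P.runCost v y s ≤ η → P.value (y 0) ≤ μ := by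
  -- A counterexample would be a sequence of trajectories over windows `n + 1` with cost at most
  -- `1/(n + 1)` and `V(y(0)) > μ`. Along a subsequence they converge on bounded time intervals to
  -- an uncontrolled trajectory `z` with `ℓ(z) = 0`; then `V(z(0)) = 0`, against continuity of `V`.
  by_contra! hcon
  have hP := h.standing
  choose! v y hy hη hlt using fun n : ℕ => hcon ((n : ℝ) + 1) (by positivity)
    (1 / ((n : ℝ) + 1)) (by positivity)
  obtain ⟨x, hx, φ, hφ, hlim⟩ := h.isCompact_closure.tendsto_subseq
    (x := fun n => y n 0) fun n => subset_closure ((hy n).mem 0 (by simp; positivity))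
  obtain ⟨X, K, L', hX, hL', hXf⟩ := hP.f_lip.exists_lipschitzWith_eqOn h.bounded
  obtain ⟨z, hz0, hz⟩ := hX.exists_flow hL' x
  set η : ℕ → ℝ := fun n => 1 / ((φ n : ℝ) + 1) with hηdef
  have hη0 : Tendsto η atTop (𝓝 0) :=
    tendsto_one_div_add_atTop_nhds_zero_nat.comp hφ.tendsto_atTop
  have hlarge : ∀ t : ℝ, ∀ᶠ n in atTop, t ≤ (φ n : ℝ) + 1 := fun t =>
    ((tendsto_natCast_atTop_atTop.comp hφ.tendsto_atTop).eventually_ge_atTop t).mono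
      fun n hn => hn.trans (by simp)
  have hb : ∀ x ∈ sublevel Ω ω w δ, ‖P.B x‖ ≤ (lipNorm P.B Ω).toReal := fun x hx =>
    norm_le_lipNorm h.lipNorm_B_ne_top hx.1
  set e : ℝ → ℕ → ℝ := fun t n =>
    Real.sqrt (t * ((lipNorm P.B Ω).toReal ^ 2 * (2 / P.β) * η n)) with he
  have he0 : ∀ t, Tendsto (e t) atTop (𝓝 0) := fun t => by
    have := ((hη0.const_mul ((lipNorm P.B Ω).toReal ^ 2 * (2 / P.β))).const_mul t).sqrt
    simpa using this
  have hd0 : Tendsto (fun n => dist (y (φ n) 0) (z 0)) atTop (𝓝 0) := by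
    rw [hz0]; exact tendsto_iff_dist_tendsto_zero.1 hlim
  set D : ℝ → ℕ → ℝ := fun t n => e t n
    + gronwallBound (dist (y (φ n) 0) (z 0)) K (K * e t n) t with hD
  have hD0 : ∀ t, Tendsto (D t) atTop (𝓝 0) := fun t => by
    have := (he0 t).add (gronwallBound_tendsto_zero (K := (K : ℝ)) (t := t) hd0
      (by simpa using (he0 t).const_mul (K : ℝ)))
    simpa using this
  have hcost : ∀ t, 0 ≤ t → ∀ n, t ≤ (φ n : ℝ) + 1 →
      ∫ s in (0 : ℝ)..t, P.runCost (v (φ n)) (y (φ n)) s ≤ η n := fun t ht n hn =>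
    ((hy (φ n)).integral_runCost_mono hP ⟨ht, hn⟩).trans (hη (φ n))
  have hdist : ∀ t, 0 ≤ t → ∀ n, t ≤ (φ n : ℝ) + 1 → ∀ s ∈ Icc 0 t,
      dist (y (φ n) s) (z s) ≤ D t n := fun t ht n hn s hs => by
    refine (((hy (φ n)).mono hn).dist_flow_le hP hb hX
      (hXf.mono sublevel_subset) hz (hcost t ht n hn) hs).trans ?_
    refine add_le_add le_rfl (gronwallBound_mono dist_nonneg ?_ K.2 hs.2)
    exact mul_nonneg K.2 (Real.sqrt_nonneg _)
  have hzmem : ∀ t, 0 ≤ t → z t ∈ closure (sublevel Ω ω w δ) := fun t ht => by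
    refine mem_closure_of_tendsto (f := fun n => y (φ n) t) (b := atTop) ?_ ?_
    · rw [tendsto_iff_dist_tendsto_zero]
      refine squeeze_zero' (Eventually.of_forall fun _ => dist_nonneg) ?_ (hD0 t)
      filter_upwards [hlarge t] with n hn
      exact hdist t ht n hn t (right_mem_Icc.2 ht)
    · filter_upwards [hlarge t] with n hn
      exact (hy (φ n)).mem t ⟨ht, hn⟩
  have hzf : ∀ t, 0 ≤ t → HasDerivAt z (P.f (z t)) t := fun t ht => by
    rw [← hXf (h.closure_subset (hzmem t ht))]; exact hz t
  have hzc : Continuous fun t => P.ell (z t) :=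
    hP.continuous_ell.comp (continuous_iff_continuousAt.2 fun t => (hz t).continuousAt)
  set Ll := (lipNorm P.ell Ω).toReal
  have hint : ∀ t, 0 ≤ t → ∫ s in (0 : ℝ)..t, P.ell (z s) = 0 := fun t ht => by
    refine le_antisymm ?_ (intervalIntegral.integral_nonneg ht fun s _ => hP.ell_nonneg _)
    have hlim' : Tendsto (fun n => η n + t * (Ll * D t n)) atTop (𝓝 0) := by
      simpa using hη0.add (((hD0 t).const_mul Ll).const_mul t)
    refine ge_of_tendsto hlim' ?_
    filter_upwards [hlarge t] with n hn
    have hyt := (hy (φ n)).mono hn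
    have h1 : ∫ s in (0 : ℝ)..t, P.ell (z s)
        ≤ ∫ s in (0 : ℝ)..t, (P.runCost (v (φ n)) (y (φ n)) s + Ll * D t n) := by
      refine intervalIntegral.integral_mono_on ht (hzc.intervalIntegrable _ _) ?_ fun s hs => ?_
      · refine ContinuousOn.intervalIntegrable ?_
        rw [uIcc_of_le ht]
        exact (hyt.continuousOn_runCost hP).add continuousOn_const
      · have h2 := norm_sub_le_lipNorm h.lipNorm_ell_ne_top
          (h.closure_subset (hzmem s hs.1)) (hyt.mem s hs).1
        have h3 := hdist t ht n hn s hs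
        rw [dist_comm, dist_eq_norm] at h3
        have h4 : 0 ≤ P.β / 2 * ‖v (φ n) s‖ ^ 2 := by have := hP.β_pos; positivity
        have h5 : Ll * ‖z s - y (φ n) s‖ ≤ Ll * D t n := by
          have : 0 ≤ Ll := ENNReal.toReal_nonneg
          gcongr
        have h6 := (le_abs_self _).trans (h2.trans h5)
        simp only [runCost]
        linarith
    rw [intervalIntegral.integral_add ?_ intervalIntegrable_const,
      intervalIntegral.integral_const] at h1
    · have := hcost t ht n hn
      simp only [sub_zero, smul_eq_mul] at h1
      linarith
    · refine ContinuousOn.intervalIntegrable ?_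
      rw [uIcc_of_le ht]
      exact hyt.continuousOn_runCost hP
  have hell : ∀ t, 0 ≤ t → P.ell (z t) = 0 := fun t ht => by
    have h1 : HasDerivAt (fun t => ∫ s in (0 : ℝ)..t, P.ell (z s)) (P.ell (z t)) t :=
      (hzc.integral_hasStrictDerivAt 0 t).hasDerivAt
    -- The primitive is known to vanish on `[0,∞)` only, so the derivatives are compared within that
    -- half-line; this includes `t = 0`.
    refine (uniqueDiffOn_Ici (0 : ℝ) t ht).eq_deriv _ h1.hasDerivWithinAt ?_
    exact (hasDerivWithinAt_const t (Ici 0) (0 : ℝ)).congr (fun s hs => hint s hs) (hint t ht)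
  have hVx : P.value x = 0 := by
    rw [← hz0]; exact hP.value_eq_zero_of_flow hzf hell
  have := ge_of_tendsto ((h.cont.tendsto x).comp hlim)
    (Eventually.of_forall fun n => (hlt (φ n)).le)
  linarith

end Frame
end ControlProblem

/-! ### The uncontrolled flow, and small scale oscillation -/

namespace ControlProblem
variable {d m : ℕ} {P : ControlProblem d m}

namespace Frame
variable {Ω ω : Set (E d)} {δ : ℝ} {w : E d → ℝ} {C r Vb L lam ε : ℝ} {ρ : E d → ℝ}

theorem continuousOn_w (h : P.Frame Ω ω δ w C r Vb L) : ContinuousOn w Ω :=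
  h.lyap.w_C1.continuousOn

theorem hasGradientAt_w (h : P.Frame Ω ω δ w C r Vb L) {x : E d} (hx : x ∈ Ω) :
    HasGradientAt w (gradient w x) x :=
  ((h.lyap.w_C1.contDiffAt (h.isOpen.mem_nhds hx)).differentiableAt (by simp)).hasGradientAt

/-- Because the closure of `ω_δ` lies in `Ω`, limits of points with `w ≤ c` stay in `Ω`, and the set
is closed in the whole space. The strict gap below the level of `ω_δ` gives room for `ε`-balls and
proximal points. -/
theorem isCompact_sublevel_le (h : P.Frame Ω ω δ w C r Vb L) {c : ℝ}
    (hc : c < sSup (w '' ω) + δ) : IsCompact {x ∈ Ω | w x ≤ c} := by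
  refine h.isCompact_closure.of_isClosed_subset (isClosed_of_closure_subset fun x hx => ?_) ?_
  · have hxΩ : x ∈ Ω := h.closure_subset
      (closure_mono (show {x ∈ Ω | w x ≤ c} ⊆ sublevel Ω ω w δ from
        fun z hz => ⟨hz.1, lt_of_le_of_lt hz.2 hc⟩) hx)
    refine ⟨hxΩ, ?_⟩
    rw [mem_closure_iff_nhdsWithin_neBot] at hx
    exact le_of_tendsto (((h.continuousOn_w).continuousAt (h.isOpen.mem_nhds hxΩ)).mono_left
      nhdsWithin_le_nhds) (show ∀ᶠ z in 𝓝[{x ∈ Ω | w x ≤ c}] x, w z ≤ c from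
        eventually_mem_nhdsWithin.mono fun z hz => hz.2)
  · exact fun z hz => subset_closure ⟨hz.1, lt_of_le_of_lt hz.2 hc⟩

theorem exists_ball_subset (h : P.Frame Ω ω δ w C r Vb L) {c : ℝ}
    (hc : c < sSup (w '' ω) + δ) :
    ∃ q > 0, ∀ x ∈ Ω, w x ≤ c → Metric.ball x q ⊆ sublevel Ω ω w δ := by
  obtain ⟨q, hq, hsub⟩ := (h.isCompact_sublevel_le hc).exists_thickening_subset_open
    h.isOpen_sublevel fun z hz => ⟨hz.1, lt_of_le_of_lt hz.2 hc⟩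
  exact ⟨q, hq, fun x hx hxc z hz => hsub
    (Metric.mem_thickening_iff.2 ⟨x, ⟨hx, hxc⟩, Metric.mem_ball.1 hz⟩)⟩

/-- If `∇wᵀf = 0` on `ω_δ`, then the uncontrolled flow preserves the level sets of `w`. -/
theorem flow_mem (h : P.Frame Ω ω δ w C r Vb L)
    (hF : ∀ x ∈ sublevel Ω ω w δ, inner ℝ (gradient w x) (P.f x) = 0)
    {X : E d → E d} {z : ℝ → E d} (hXf : EqOn X P.f Ω) (hz : ∀ t, HasDerivAt z (X (z t)) t)
    (h0 : z 0 ∈ sublevel Ω ω w δ) (t : ℝ) : z t ∈ Ω ∧ w (z t) = w (z 0) := by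
  have hzc : Continuous z := continuous_iff_continuousAt.2 fun t => (hz t).continuousAt
  -- This set of times is open because `w(z)` has zero derivative while `z` is in `ω_δ`, and closed
  -- because the closure of `ω_δ` lies in `Ω`. Connectedness of the line gives all times, also
  -- negative ones.
  set A : Set ℝ := {t | z t ∈ Ω ∧ w (z t) = w (z 0)} with hA
  have hsub : ∀ t ∈ A, z t ∈ sublevel Ω ω w δ := fun t ht =>
    ⟨ht.1, by rw [ht.2]; exact h0.2⟩
  have hopen : IsOpen A := by
    rw [Metric.isOpen_iff]
    intro t ht
    obtain ⟨q, hq, hball⟩ := Metric.isOpen_iff.1 (h.isOpen_sublevel.preimage hzc) t (hsub t ht)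
    refine ⟨q, hq, fun s hs => ⟨(hball hs).1, ?_⟩⟩
    rw [← ht.2]
    have hderiv : ∀ s ∈ Metric.ball t q, HasDerivAt (fun s => w (z s)) 0 s := fun s hs => by
      have hs' : z s ∈ sublevel Ω ω w δ := hball hs
      have h1 := (h.hasGradientAt_w hs'.1).hasFDerivAt.comp_hasDerivAt s (hz s)
      rw [InnerProductSpace.toDual_apply_apply, hXf hs'.1, hF _ hs'] at h1
      exact h1
    exact Metric.isOpen_ball.is_const_of_deriv_eq_zero (convex_ball t q).isPreconnected
      (fun s hs => (hderiv s hs).differentiableAt.differentiableWithinAt)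
      (fun s hs => (hderiv s hs).deriv) hs (Metric.mem_ball_self hq)
  have hclosed : IsClosed A := by
    refine isClosed_of_closure_subset fun t ht => ?_
    have hAt := ((mem_closure_iff_nhdsWithin_neBot).1 ht)
    have hzA : Tendsto z (𝓝[A] t) (𝓝 (z t)) := hzc.continuousAt.mono_left nhdsWithin_le_nhds
    have htΩ : z t ∈ Ω := h.closure_subset
      (mem_closure_of_tendsto hzA (eventually_mem_nhdsWithin.mono fun s hs => hsub s hs))
    refine ⟨htΩ, tendsto_nhds_unique
      (((h.continuousOn_w).continuousAt (h.isOpen.mem_nhds htΩ)).tendsto.comp hzA) ?_⟩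
    exact tendsto_const_nhds.congr' (eventually_mem_nhdsWithin.mono fun s hs => hs.2.symm)
  have := (IsClopen.eq_univ ⟨hclosed, hopen⟩ ⟨0, h0.1, rfl⟩ : A = univ)
  exact (this ▸ mem_univ t : t ∈ A)

/-- If neither the drift nor the control changes `w` or `V`, the value function decreases along
the uncontrolled flow by at least the running cost. -/
theorem value_add_integral_le (h : P.Frame Ω ω δ w C r Vb L)
    (hB : ∀ p ∈ sublevel Ω ω w δ, ∀ ξ, IsSubgrad C Ω P.value p ξ →
      ContinuousLinearMap.adjoint (P.B p) ξ = 0)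
    {c : ℝ} (hc : c < sSup (w '' ω) + δ) {T : ℝ} (hT : 0 ≤ T) {y : ℝ → E d}
    (hy : P.IsControlled {x ∈ Ω | w x ≤ c} T (fun _ => 0) y) :
    P.value (y T) + (∫ t in (0 : ℝ)..T, P.runCost (fun _ => 0) y t) ≤ P.value (y 0) := by
  obtain ⟨q, hq, hball⟩ := h.exists_ball_subset hc
  have hβ := h.standing.β_pos
  have hL := h.L_pos
  have hmem : ∀ t ∈ Icc 0 T, y t ∈ sublevel Ω ω w δ := fun t ht =>
    ⟨(hy.mem t ht).1, lt_of_le_of_lt (hy.mem t ht).2 hc⟩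
  set b := (lipNorm P.B Ω).toReal
  have hb : 0 ≤ b := ENNReal.toReal_nonneg
  refine le_of_forall_pos_le_add fun η hη => ?_
  obtain ⟨l, hl0, hVM⟩ := h.exists_value_sub_moreau_le (half_pos hη)
  have hlim : Tendsto (fun lam : ℝ => (P.hamConst Ω L * lam
      + P.β / 2 * (P.β⁻¹ * (b * (lam * L) * L)) ^ 2) * T) (𝓝[>] 0) (𝓝 0) := by
    have : Continuous (fun lam : ℝ => (P.hamConst Ω L * lam
      + P.β / 2 * (P.β⁻¹ * (b * (lam * L) * L)) ^ 2) * T) := by fun_prop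
    simpa using (this.tendsto 0).mono_left nhdsWithin_le_nhds
  have hr := h.r_pos
  have hsmall : ∀ c' : ℝ, 0 < c' → ∀ a : ℝ, ∀ᶠ lam : ℝ in 𝓝[>] 0, lam * a < c' :=
    fun c' hc' a => by
      have : Continuous (fun lam : ℝ => lam * a) := by fun_prop
      exact ((this.tendsto 0).mono_left nhdsWithin_le_nhds).eventually_lt_const (by simpa using hc')
  obtain ⟨lam, h1, h2, h3, h4, h5, hpos⟩ := ((hlim.eventually_lt_const (half_pos hη)).and
    ((hsmall _ hl0 1).and ((hsmall _ hq L).and ((hsmall (1 / 2) (by norm_num) C).and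
    ((hsmall (r ^ 2) (by positivity) (2 * Vb)).and eventually_mem_nhdsWithin))))).exists
  have hpos' : 0 < lam := hpos
  have hl : SmallLam C r Vb lam := ⟨hpos', h4.le, by linarith⟩
  -- The gradient at `y(t)` is a subgradient at the proximal point, where `Bᵀ` annihilates it. At
  -- `y(t)` the envelope feedback is therefore only `O(λ)`, so the zero control is nearly optimal
  -- and the energy inequality becomes exact as `λ → 0`.
  have key := h.energy_le hl hT hy.cont hy.deriv hmem
    (e := P.β⁻¹ * (b * (lam * L) * L)) fun t ht => ?_
  · have h6 := hVM lam hl (by linarith) (y T) (hmem T (right_mem_Icc.2 hT))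
    have h7 := moreau_le_self hpos' (nonneg P Ω) (hmem 0 (left_mem_Icc.2 hT)).1
    linarith
  · have hyt := hmem t ht
    have hth := h.sublevel_subset_thickening hyt
    set ξ := gradient (moreau Ω P.value lam) (y t) with hξ
    have hp : y t - lam • ξ ∈ sublevel Ω ω w δ := by
      refine hball (y t) (hy.mem t ht).1 (hy.mem t ht).2 ?_
      rw [Metric.mem_ball, dist_eq_norm, sub_sub_cancel_left, norm_neg]
      exact (h.norm_smul_gradient_le hl hth).trans_lt h3
    have h6 := hB _ hp ξ (h.isSubgrad hl hth)
    have h7 := h.norm_adjoint_sub_le hyt.1 hp.1 ξ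
    rw [h6, sub_zero, sub_sub_cancel] at h7
    rw [zero_add, norm_smul, Real.norm_of_nonneg (inv_nonneg.2 hβ.le)]
    refine mul_le_mul_of_nonneg_left (h7.trans ?_) (inv_nonneg.2 hβ.le)
    have h8 := h.norm_smul_gradient_le hl hth
    have h9 := h.norm_gradient_le hl hth
    gcongr

/-- The uncontrolled flow through `x` can be followed backwards for ever inside the level set of
`w`, and `V` decreases along it by at least the running cost. If `V(x) > μ`, then `V > μ` at all
earlier points, so by `exists_window` each backward window of length `S` costs more than `η`. Hence
`V ≥ kη` after `k` windows, against `V ≤ Vb`. -/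
theorem value_eq_zero (h : P.Frame Ω ω δ w C r Vb L)
    (hF : ∀ x ∈ sublevel Ω ω w δ, inner ℝ (gradient w x) (P.f x) = 0)
    (hB : ∀ p ∈ sublevel Ω ω w δ, ∀ ξ, IsSubgrad C Ω P.value p ξ →
      ContinuousLinearMap.adjoint (P.B p) ξ = 0) {x : E d} (hx : x ∈ sublevel Ω ω w δ) :
    P.value x = 0 := by
  refine le_antisymm (le_of_forall_pos_le_add fun μ hμ => ?_) (value_nonneg P x)
  rw [zero_add]
  obtain ⟨S, hS, η, hη, hwin⟩ := h.exists_window hμ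
  obtain ⟨X, K, L', hX, hL', hXf⟩ := h.standing.f_lip.exists_lipschitzWith_eqOn h.bounded
  obtain ⟨z, hz0, hz⟩ := hX.exists_flow hL' x
  have hflow := h.flow_mem hF hXf hz (by rwa [hz0])
  rw [hz0] at hflow
  have htraj : ∀ a T, P.IsControlled {y ∈ Ω | w y ≤ w x} T (fun _ => 0) (fun t => z (a + t)) :=
    fun a T => ⟨continuousOn_const, fun t _ => by
      have := (hz (a + t)).comp_const_add a t
      rw [hXf (hflow _).1] at this
      simpa using this.hasDerivWithinAt, fun t _ => ⟨(hflow _).1, (hflow _).2.le⟩⟩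
  have hdec : ∀ a T, 0 ≤ T → P.value (z (a + T))
      + (∫ t in (0 : ℝ)..T, P.runCost (fun _ => 0) (fun t => z (a + t)) t) ≤ P.value (z a) :=
    fun a T hT => by
      simpa using h.value_add_integral_le hB hx.2 hT (htraj a T)
  have hmono : ∀ a T, 0 ≤ T → P.value (z (a + T)) ≤ P.value (z a) := fun a T hT => by
    have h1 := hdec a T hT
    have h2 : 0 ≤ ∫ t in (0 : ℝ)..T, P.runCost (fun _ => (0 : E m)) (fun t => z (a + t)) t :=
      intervalIntegral.integral_nonneg hT fun t _ => h.standing.runCost_nonneg _ _ t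
    linarith
  by_contra! hlt
  have hstep : ∀ k : ℕ, k * η ≤ P.value (z (-(k * S))) := by
    intro k
    induction k with
    | zero => simpa using value_nonneg P _
    | succ k ih =>
      have h1 := hdec (-((k + 1 : ℕ) * S)) S hS.le
      have h2 : -((k + 1 : ℕ) * S) + S = -(k * S) := by push_cast; ring
      rw [h2] at h1
      by_cases hc : ∫ t in (0 : ℝ)..S, P.runCost (fun _ => (0 : E m))
          (fun t => z (-((k + 1 : ℕ) * S) + t)) t ≤ η
      · exfalso
        have htr := htraj (-((k + 1 : ℕ) * S)) S
        have h3 := hwin _ _ ⟨htr.cont, htr.deriv, fun t ht =>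
          ⟨(htr.mem t ht).1, lt_of_le_of_lt (htr.mem t ht).2 hx.2⟩⟩ hc
        have h4 := hmono (-((k + 1 : ℕ) * S)) ((k + 1 : ℕ) * S) (by positivity)
        simp only [neg_add_cancel, hz0] at h4
        simp only [add_zero] at h3
        linarith
      · push Not at hc
        push_cast at h1 hc ⊢
        linarith
  obtain ⟨k, hk⟩ := exists_nat_gt (Vb / η)
  have h1 := h.value_le _ (hflow (-(k * S))).1
  have h2 := hstep k
  rw [div_lt_iff₀ hη] at hk
  linarith

/-- A field on `ω_δ` that vanishes at the critical points of `w` is either zero or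
oscillates at least linearly at small scales. -/
theorem eq_zero_or_exists_norm_sub_ge (h : P.Frame Ω ω δ w C r Vb L) {Y : Type*}
    [NormedAddCommGroup Y] {G : E d → Y}
    (hG0 : ∀ x ∈ sublevel Ω ω w δ, gradient w x = 0 → G x = 0) :
    (∀ x ∈ sublevel Ω ω w δ, G x = 0) ∨ ∃ c > 0, ∃ ε₀ > 0, ∀ ε, 0 < ε → ε < ε₀ →
      ∃ x ∈ sublevel Ω ω w δ, ∃ y ∈ Metric.ball x ε, y ∈ sublevel Ω ω w δ ∧
        c * ε ≤ ‖G x - G y‖ := by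
  by_cases hconst : ∀ x ∈ sublevel Ω ω w δ, ∀ᶠ y in 𝓝 x, G y = G x
  · left
    intro x₁ hx₁
    -- If `G` is locally constant, a minimiser of `w` over the closure of a fibre of `G` is in
    -- `ω_δ`, belongs to the fibre, and is a local minimum of `w`. It is thus a critical point,
    -- where `G` vanishes, so the value on the fibre is zero.
    set A : Set (E d) := {x ∈ sublevel Ω ω w δ | G x = G x₁} with hA
    have hAne : (closure A).Nonempty := ⟨x₁, subset_closure ⟨hx₁, rfl⟩⟩
    have hAsub : closure A ⊆ closure (sublevel Ω ω w δ) := closure_mono fun z hz => hz.1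
    have hAc : IsCompact (closure A) := h.isCompact_closure.of_isClosed_subset isClosed_closure hAsub
    obtain ⟨p, hp, hmin⟩ := hAc.exists_isMinOn hAne
      ((h.continuousOn_w).mono (hAsub.trans h.closure_subset))
    have hpS : p ∈ sublevel Ω ω w δ := ⟨h.closure_subset (hAsub hp),
      lt_of_le_of_lt (hmin (subset_closure ⟨hx₁, rfl⟩)) hx₁.2⟩
    have hGp : G p = G x₁ := by
      obtain ⟨z, hz, hzA⟩ := ((mem_closure_iff_frequently.1 hp).and_eventually
        (hconst p hpS)).exists
      rw [← hzA]; exact hz.2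
    have hloc : IsLocalMin w p := by
      filter_upwards [hconst p hpS, h.isOpen_sublevel.mem_nhds hpS] with z hz hzS
      exact hmin (subset_closure ⟨hzS, hz.trans hGp⟩)
    have hg : gradient w p = 0 := by
      rw [gradient, hloc.fderiv_eq_zero, map_zero]
    rw [← hGp, hG0 p hpS hg]
  · right
    push Not at hconst
    obtain ⟨x, hx, hfreq⟩ := hconst
    obtain ⟨q, hq, hball⟩ := Metric.isOpen_iff.1 h.isOpen_sublevel x hx
    obtain ⟨y, hyq, hyx⟩ : ∃ y ∈ Metric.ball x q, G y ≠ G x := by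
      by_contra! hcon
      exact hfreq (mem_of_superset (Metric.ball_mem_nhds x hq) fun y hy => not_not.2 (hcon y hy))
    have hyx' : 0 < ‖G y - G x‖ := norm_pos_iff.2 (sub_ne_zero.2 hyx)
    -- The segment from `x` to `y` needs `N ≤ q/ε + 1` steps shorter than `ε`. If each changed `G`
    -- by less than `cε`, the total change would be at most `c(q + ε) ≤ 2qc`, half of what is
    -- required.
    refine ⟨‖G y - G x‖ / (2 * (2 * q)), by positivity, q, hq, fun ε hε hεq => ?_⟩
    by_contra! hcon
    -- subdivide the segment from `x` to `y`
    obtain ⟨N, hN1, hN2⟩ : ∃ N : ℕ, q / ε < N ∧ (N : ℝ) ≤ q / ε + 1 :=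
      ⟨⌊q / ε⌋₊ + 1, by exact_mod_cast Nat.lt_floor_add_one _, by
        have := Nat.floor_le (a := q / ε) (by positivity)
        push_cast; linarith⟩
    have hN0 : (0 : ℝ) < N := lt_trans (by positivity) hN1
    set p : ℕ → E d := fun k => x + ((k : ℝ) / N) • (y - x) with hp
    have hyx2 : ‖y - x‖ < q := by rw [← dist_eq_norm]; exact Metric.mem_ball.1 hyq
    have hpm : ∀ k ≤ N, p k ∈ sublevel Ω ω w δ := fun k hk => by
      refine hball ?_
      rw [Metric.mem_ball, dist_eq_norm]
      simp only [hp, add_sub_cancel_left, norm_smul, Real.norm_eq_abs]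
      rw [abs_of_nonneg (by positivity)]
      have : (k : ℝ) / N ≤ 1 := by rw [div_le_one hN0]; exact_mod_cast hk
      nlinarith [norm_nonneg (y - x)]
    have hstep : ∀ k < N, ‖G (p (k + 1)) - G (p k)‖ ≤ ‖G y - G x‖ / (2 * (2 * q)) * ε :=
      fun k hk => by
        rw [norm_sub_rev]
        refine (hcon (p k) (hpm k hk.le) (p (k + 1)) ?_ (hpm (k + 1) hk)).le
        rw [Metric.mem_ball, dist_eq_norm]
        have : p (k + 1) - p k = (1 / (N : ℝ)) • (y - x) := by
          simp only [hp, add_sub_add_left_eq_sub, ← sub_smul]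
          congr 1
          push_cast
          ring
        rw [this, norm_smul, Real.norm_of_nonneg (by positivity), div_mul_eq_mul_div, one_mul,
          div_lt_iff₀ hN0]
        rw [div_lt_iff₀ hε] at hN1
        linarith
    have hsum : ∀ k ≤ N, ‖G (p k) - G x‖ ≤ k * (‖G y - G x‖ / (2 * (2 * q)) * ε) := by
      intro k
      induction k with
      | zero => simp [hp]
      | succ k ih =>
        intro hk
        have h1 := ih (by omega)
        have h2 := hstep k (by omega)
        have h3 := norm_sub_le_norm_sub_add_norm_sub (G (p (k + 1))) (G (p k)) (G x)
        push_cast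
        linarith
    have h1 := hsum N le_rfl
    have h2 : p N = y := by
      simp only [hp, div_self hN0.ne', one_smul, add_sub_cancel]
    rw [h2] at h1
    have h3 : (N : ℝ) * ε ≤ q + ε := by
      calc (N : ℝ) * ε ≤ (q / ε + 1) * ε := by gcongr
        _ = q + ε := by field_simp
    have h4 : (N : ℝ) * (‖G y - G x‖ / (2 * (2 * q)) * ε) < ‖G y - G x‖ := by
      calc (N : ℝ) * (‖G y - G x‖ / (2 * (2 * q)) * ε)
          = ‖G y - G x‖ / (2 * (2 * q)) * (N * ε) := by ring
        _ ≤ ‖G y - G x‖ / (2 * (2 * q)) * (2 * q) :=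
            mul_le_mul_of_nonneg_left (by linarith) (by positivity)
        _ = ‖G y - G x‖ / 2 := by field_simp
        _ < ‖G y - G x‖ := by linarith
    linarith

end Frame
end ControlProblem

/-! ### Functions that are asymptotically invariant under mollification -/

section MollifyLiouville

variable {n : ℕ} {ρ : E n → ℝ} {ι : Type*} {l : Filter ι} {D : ι → E n → ℝ} {s s' : ℝ}

theorem IsSmoothMollifier.integrable_mul (hρ : IsSmoothMollifier ρ) {g : E n → ℝ}
    (hg : Continuous g) : Integrable (fun z => ρ z * g z) :=
  (hρ.smooth.continuous.mul hg).integrable_of_hasCompactSupport hρ.hasCompactSupport.mul_right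

theorem IsSmoothMollifier.exists_pos (hρ : IsSmoothMollifier ρ) : ∃ z, 0 < ρ z := by
  by_contra! h
  have h1 : ρ = 0 := funext fun z => le_antisymm (h z) (hρ.nonneg z)
  have := hρ.integral_eq_one
  simp [h1] at this

/-- Maximum principle: for functions that are asymptotically invariant under mollification and
asymptotically at most `s`, the asymptotic value `s` propagates along the support of `ρ`. -/
theorem IsSmoothMollifier.tendsto_sub (hρ : IsSmoothMollifier ρ) (hc : ∀ i, Continuous (D i))
    (hequi : ∀ q, ∀ κ > 0, ∃ t > 0, ∀ᶠ i in l, ∀ q' ∈ Metric.ball q t, |D i q' - D i q| ≤ κ)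
    (hmol : ∀ q, Tendsto (fun i => (∫ z, ρ z * D i (q - z)) - D i q) l (𝓝 0))
    (hub : ∀ q, ∀ η > 0, ∀ᶠ i in l, ∀ z, ρ z ≠ 0 → D i (q - z) ≤ s + η)
    {q z₀ : E n} (hq : Tendsto (fun i => D i q) l (𝓝 s)) (hz₀ : 0 < ρ z₀) :
    Tendsto (fun i => D i (q - z₀)) l (𝓝 s) := by
  refine tendsto_order.2 ⟨fun a ha => ?_, fun b hb => ?_⟩
  swap
  · filter_upwards [hub q ((b - s) / 2) (by linarith)] with i hi
    have := hi z₀ hz₀.ne'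
    linarith
  obtain ⟨κ, hκ, rfl⟩ : ∃ κ > 0, a = s - κ := ⟨s - a, by linarith, by ring⟩
  obtain ⟨t₁, ht₁, hρt⟩ := Metric.eventually_nhds_iff_ball.1
    (hρ.smooth.continuous.continuousAt.eventually_const_lt (half_lt_self hz₀) :
      ∀ᶠ z in 𝓝 z₀, ρ z₀ / 2 < ρ z)
  obtain ⟨t₂, ht₂, hDt⟩ := hequi (q - z₀) (κ / 2) (by positivity)
  set t := min t₁ t₂ with ht
  have ht0 : 0 < t := lt_min ht₁ ht₂
  -- This is the deficit of the average that a value `≤ s - κ` at `q - z₀` would force: by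
  -- equicontinuity the values stay below `s - κ/2` on a ball around `z₀`, where the weight exceeds
  -- `ρ(z₀)/2`. The average would then be at most `s - k/2`, whereas asymptotic invariance gives
  -- more than `s - k/2`.
  set k := volume.real (Metric.ball z₀ t) * (ρ z₀ / 2 * (κ / 2)) with hk
  have hvol : 0 < volume.real (Metric.ball z₀ t) :=
    ENNReal.toReal_pos (Metric.measure_ball_pos _ _ ht0).ne' measure_ball_lt_top.ne
  have hk0 : 0 < k := by positivity
  filter_upwards [hDt, hub q (k / 2) (by positivity),
    (hmol q).eventually_lt_const (show 0 < k / 4 by positivity),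
    (hmol q).eventually_const_lt (show -(k / 4) < 0 by linarith),
    hq.eventually_const_lt (show s - k / 4 < s by linarith)] with i h1 h2 _ h4 h5
  by_contra! hcon
  have hcont : Continuous fun z => D i (q - z) := (hc i).comp (continuous_const.sub continuous_id)
  have h6 : k ≤ ∫ z, ρ z * (s + k / 2 - D i (q - z)) := by
    have hind : k = ∫ z, (Metric.ball z₀ t).indicator (fun _ => ρ z₀ / 2 * (κ / 2)) z := by
      rw [integral_indicator_const _ measurableSet_ball, smul_eq_mul]
    refine hind.le.trans ?_
    refine integral_mono ((integrable_indicator_iff measurableSet_ball).2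
      (integrableOn_const measure_ball_lt_top.ne)) (hρ.integrable_mul (by fun_prop)) fun z => ?_
    by_cases hz : z ∈ Metric.ball z₀ t
    · rw [indicator_of_mem hz]
      have h7 := hρt z (Metric.ball_subset_ball (min_le_left _ _) hz)
      have h8 := h1 (q - z) (by
        rw [Metric.mem_ball, dist_eq_norm, sub_sub_sub_cancel_left, ← dist_eq_norm, dist_comm]
        exact (Metric.mem_ball.1 hz).trans_le (min_le_right _ _))
      have h9 := (le_abs_self _).trans h8
      exact mul_le_mul h7.le (by linarith) (by positivity) (hρ.nonneg z)
    · rw [indicator_of_notMem hz]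
      by_cases hz0 : ρ z = 0
      · simp [hz0]
      · exact mul_nonneg (hρ.nonneg z) (by linarith [h2 z hz0])
  have h7 : ∫ z, ρ z * (s + k / 2 - D i (q - z)) = s + k / 2 - ∫ z, ρ z * D i (q - z) := by
    simp only [mul_sub]
    rw [integral_sub (hρ.integrable_mul continuous_const) (hρ.integrable_mul hcont),
      integral_mul_const, hρ.integral_eq_one, one_mul]
  linarith

theorem IsSmoothMollifier.tendsto_sub_nsmul (hρ : IsSmoothMollifier ρ)
    (hc : ∀ i, Continuous (D i))
    (hequi : ∀ q, ∀ κ > 0, ∃ t > 0, ∀ᶠ i in l, ∀ q' ∈ Metric.ball q t, |D i q' - D i q| ≤ κ)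
    (hmol : ∀ q, Tendsto (fun i => (∫ z, ρ z * D i (q - z)) - D i q) l (𝓝 0))
    (hub : ∀ q, ∀ η > 0, ∀ᶠ i in l, ∀ z, ρ z ≠ 0 → D i (q - z) ≤ s + η)
    {q z₀ : E n} (hq : Tendsto (fun i => D i q) l (𝓝 s)) (hz₀ : 0 < ρ z₀) (N : ℕ) :
    Tendsto (fun i => D i (q - (N : ℝ) • z₀)) l (𝓝 s) := by
  induction N with
  | zero => simpa using hq
  | succ N ih =>
    have := hρ.tendsto_sub hc hequi hmol hub ih hz₀
    simpa [add_smul, sub_sub] using this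

/-- A Liouville property. The maximum `s` propagates from `q` along multiples of one support point,
the minimum `s'` from `q'` along multiples of another. Since `ρ > 0` on a ball, the two support
points can be chosen so that after `N` steps both chains arrive at the same point. -/
theorem IsSmoothMollifier.eq_of_tendsto (hρ : IsSmoothMollifier ρ) [l.NeBot]
    (hc : ∀ i, Continuous (D i))
    (hequi : ∀ q, ∀ κ > 0, ∃ t > 0, ∀ᶠ i in l, ∀ q' ∈ Metric.ball q t, |D i q' - D i q| ≤ κ)
    (hmol : ∀ q, Tendsto (fun i => (∫ z, ρ z * D i (q - z)) - D i q) l (𝓝 0))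
    (hub : ∀ q, ∀ η > 0, ∀ᶠ i in l, ∀ z, ρ z ≠ 0 → D i (q - z) ≤ s + η)
    (hlb : ∀ q, ∀ η > 0, ∀ᶠ i in l, ∀ z, ρ z ≠ 0 → s' - η ≤ D i (q - z))
    {q q' : E n} (hq : Tendsto (fun i => D i q) l (𝓝 s))
    (hq' : Tendsto (fun i => D i q') l (𝓝 s')) : s = s' := by
  obtain ⟨z₀, hz₀⟩ := hρ.exists_pos
  obtain ⟨t, ht, hρt⟩ := Metric.eventually_nhds_iff_ball.1
    (hρ.smooth.continuous.continuousAt.eventually_const_lt hz₀ : ∀ᶠ z in 𝓝 z₀, 0 < ρ z)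
  obtain ⟨N, hN⟩ := exists_nat_gt (‖q - q'‖ / t)
  have hN0 : (0 : ℝ) < N := lt_of_le_of_lt (by positivity) hN
  rw [div_lt_iff₀ ht] at hN
  have hsmall : ‖(1 / (2 * N : ℝ)) • (q - q')‖ < t := by
    rw [norm_smul, Real.norm_of_nonneg (by positivity), div_mul_eq_mul_div, one_mul,
      div_lt_iff₀ (by positivity)]
    nlinarith
  have h1 := hρ.tendsto_sub_nsmul hc hequi hmol hub hq
    (hρt (z₀ + (1 / (2 * N : ℝ)) • (q - q')) (by simpa [dist_eq_norm] using hsmall)) N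
  have h2 := hρ.tendsto_sub_nsmul (D := fun i q => -D i q) (s := -s') (q := q')
    (fun i => (hc i).neg)
    (fun q κ hκ => by
      obtain ⟨t, ht, h⟩ := hequi q κ hκ
      refine ⟨t, ht, h.mono fun i hi q' hq' => ?_⟩
      rw [neg_sub_neg, abs_sub_comm]
      exact hi q' hq')
    (fun q => by
      have := (hmol q).neg
      simp only [neg_zero] at this
      refine this.congr fun i => ?_
      simp only [mul_neg, integral_neg]
      ring)
    (fun q η hη => (hlb q η hη).mono fun i hi z hz => by linarith [hi z hz])
    hq'.neg
    (hρt (z₀ - (1 / (2 * N : ℝ)) • (q - q')) (by simpa [dist_eq_norm] using hsmall)) N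
  have h3 : q - (N : ℝ) • (z₀ + (1 / (2 * N : ℝ)) • (q - q'))
      = q' - (N : ℝ) • (z₀ - (1 / (2 * N : ℝ)) • (q - q')) := by
    have h4 : (N : ℝ) * (1 / (2 * N)) = 1 / 2 := by field_simp
    have h5 : (N : ℝ) • ((1 / (2 * N : ℝ)) • (q - q')) = (1 / 2 : ℝ) • (q - q') := by
      rw [smul_smul, h4]
    rw [smul_add, smul_sub (N : ℝ) z₀, h5]
    module
  rw [h3] at h1
  have h4 := h2.neg
  simp only [neg_neg] at h4
  exact tendsto_nhds_unique h1 h4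

end MollifyLiouville

/-! ### Compactness and semicontinuity of the subdifferential -/

namespace ControlProblem
variable {d m : ℕ} {P : ControlProblem d m}

namespace Frame
variable {Ω ω : Set (E d)} {δ : ℝ} {w : E d → ℝ} {C r Vb L lam ε : ℝ} {ρ : E d → ℝ}

/-- Compactness and closedness of the graph of the subdifferential. -/
theorem exists_subseq_isSubgrad (h : P.Frame Ω ω δ w C r Vb L) {p ζ : ℕ → E d} {p₀ : E d}
    (hp₀ : p₀ ∈ Metric.thickening (3 * r) (sublevel Ω ω w δ))
    (hp : Tendsto p atTop (𝓝 p₀)) (hζ : ∀ᶠ n in atTop, IsSubgrad C Ω P.value (p n) (ζ n)) :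
    ∃ ζ₀, IsSubgrad C Ω P.value p₀ ζ₀ ∧ ∃ φ : ℕ → ℕ, StrictMono φ ∧
      Tendsto (ζ ∘ φ) atTop (𝓝 ζ₀) := by
  have hb : ∀ᶠ n in atTop, ζ n ∈ Metric.closedBall (0 : E d) L := by
    filter_upwards [hζ, hp.eventually_mem (Metric.isOpen_thickening.mem_nhds hp₀)] with n h1 h2
    rw [mem_closedBall_zero_iff]
    exact h.norm_le _ h2 _ h1
  obtain ⟨ζ₀, -, φ, hφ, hlim⟩ := (isCompact_closedBall (0 : E d) L).tendsto_subseq' hb.frequently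
  exact ⟨ζ₀, IsSubgrad.of_tendsto h.cont.continuousAt (hφ.tendsto_atTop.eventually hζ)
    (hp.comp hφ.tendsto_atTop) hlim, φ, hφ, hlim⟩

/-- Upper semicontinuity of the subdifferential. -/
theorem exists_isSubgrad_norm_sub_lt (h : P.Frame Ω ω δ w C r Vb L) {p₀ : E d}
    (hp₀ : p₀ ∈ Metric.thickening (3 * r) (sublevel Ω ω w δ)) {η : ℝ} (hη : 0 < η) :
    ∃ t > 0, ∀ p ∈ Metric.ball p₀ t, ∀ ζ, IsSubgrad C Ω P.value p ζ →
      ∃ ζ₀, IsSubgrad C Ω P.value p₀ ζ₀ ∧ ‖ζ - ζ₀‖ < η := by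
  by_contra! hcon
  choose! p hp ζ hζ hfar using fun n : ℕ => hcon (1 / ((n : ℝ) + 1)) (by positivity)
  have hlim : Tendsto p atTop (𝓝 p₀) := by
    rw [tendsto_iff_dist_tendsto_zero]
    exact squeeze_zero (fun _ => dist_nonneg) (fun n => (Metric.mem_ball.1 (hp n)).le)
      tendsto_one_div_add_atTop_nhds_zero_nat
  obtain ⟨ζ₀, h0, φ, -, hφ⟩ := h.exists_subseq_isSubgrad hp₀ hlim (Eventually.of_forall hζ)
  have h1 := (tendsto_iff_norm_sub_tendsto_zero.1 hφ).eventually_lt_const hη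
  obtain ⟨n, hn⟩ := h1.exists
  exact absurd hn (not_lt.2 (hfar (φ n) ζ₀ h0))

theorem isCompact_isSubgrad (h : P.Frame Ω ω δ w C r Vb L) {p : E d}
    (hp : p ∈ Metric.thickening (3 * r) (sublevel Ω ω w δ)) :
    IsCompact {ξ | IsSubgrad C Ω P.value p ξ} := by
  refine (isCompact_closedBall (0 : E d) L).of_isClosed_subset
    (isClosed_of_closure_subset fun ξ hξ => ?_) fun ξ hξ => ?_
  · obtain ⟨ζ, hζ, hlim⟩ := mem_closure_iff_seq_limit.1 hξ
    exact IsSubgrad.of_tendsto (l := atTop) (p := fun _ => p) h.cont.continuousAt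
      (Eventually.of_forall hζ) tendsto_const_nhds hlim
  · rw [mem_closedBall_zero_iff]
    exact h.norm_le p hp ξ hξ

end Frame
end ControlProblem

/-! ### Blow-up of the Moreau envelope at a zero of the value function -/

/-- The difference quotient of `M` in direction `e`, blown up around `x₀` at scale `ε`. -/
noncomputable def blowup {n : ℕ} (M : E n → ℝ) (x₀ e : E n) (ε : ℝ) (q : E n) : ℝ :=
  (M (x₀ + ε • (q + e)) - M (x₀ + ε • q)) / ε

/-- Mollification at scale `ε` becomes mollification at unit scale after the blow-up. Together with
the good choice of `ε` this makes the blow-ups asymptotically invariant under averaging with `ρ`. -/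
theorem integral_mul_blowup {n : ℕ} {ρ M : E n → ℝ} (hρ : IsSmoothMollifier ρ)
    (hM : Continuous M) {ε : ℝ} (hε : 0 < ε) (x₀ e q : E n) :
    ∫ z, ρ z * blowup M x₀ e ε (q - z) = blowup (mollify ρ ε M) x₀ e ε q := by
  have h1 : ∀ q : E n, Integrable fun z => ρ z * M (x₀ + ε • q - ε • z) := fun q =>
    hρ.integrable_mul (by fun_prop)
  rw [blowup, mollify_eq hε, mollify_eq hε, ← integral_sub (h1 _) (h1 _), ← integral_div]
  refine integral_congr_ae (Eventually.of_forall fun z => ?_)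
  have h2 : x₀ + ε • (q - z + e) = x₀ + ε • (q + e) - ε • z := by module
  have h3 : x₀ + ε • (q - z) = x₀ + ε • q - ε • z := by module
  simp only [blowup, h2, h3]
  ring

namespace ControlProblem
variable {d m : ℕ} {P : ControlProblem d m}

namespace Frame
variable {Ω ω : Set (E d)} {δ : ℝ} {w : E d → ℝ} {C r Vb L lam ε : ℝ} {ρ : E d → ℝ}

theorem blowup_le (h : P.Frame Ω ω δ w C r Vb L) (hl : SmallLam C r Vb lam) (hε : 0 < ε)
    {x₀ e q : E d} (hy : x₀ + ε • (q + e) ∈ Metric.thickening (2 * r) (sublevel Ω ω w δ)) :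
    blowup (moreau Ω P.value lam) x₀ e ε q
      ≤ inner ℝ (gradient (moreau Ω P.value lam) (x₀ + ε • (q + e))) e + C * ε * ‖e‖ ^ 2 := by
  have h1 := h.le_moreau_sub hl hy (x₀ + ε • q)
  have h2 : x₀ + ε • q - (x₀ + ε • (q + e)) = -(ε • e) := by module
  rw [h2, inner_neg_right, inner_smul_right, norm_neg, norm_smul, Real.norm_of_nonneg hε.le] at h1
  rw [blowup, div_le_iff₀ hε]
  linarith

theorem le_blowup (h : P.Frame Ω ω δ w C r Vb L) (hl : SmallLam C r Vb lam) (hε : 0 < ε)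
    {x₀ e q : E d} (hy : x₀ + ε • q ∈ Metric.thickening (2 * r) (sublevel Ω ω w δ)) :
    inner ℝ (gradient (moreau Ω P.value lam) (x₀ + ε • q)) e - C * ε * ‖e‖ ^ 2
      ≤ blowup (moreau Ω P.value lam) x₀ e ε q := by
  have h1 := h.le_moreau_sub hl hy (x₀ + ε • (q + e))
  have h2 : x₀ + ε • (q + e) - (x₀ + ε • q) = ε • e := by module
  rw [h2, inner_smul_right, norm_smul, Real.norm_of_nonneg hε.le] at h1
  rw [blowup, le_div_iff₀ hε]
  linarith

theorem moreau_sub_le (h : P.Frame Ω ω δ w C r Vb L) (hl : SmallLam C r Vb lam) {y y' : E d}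
    (hy : y ∈ Metric.thickening (2 * r) (sublevel Ω ω w δ)) :
    moreau Ω P.value lam y - moreau Ω P.value lam y' ≤ L * ‖y' - y‖ + C * ‖y' - y‖ ^ 2 := by
  have h1 := h.le_moreau_sub hl hy y'
  have h2 := neg_le_of_abs_le (abs_real_inner_le_norm (gradient (moreau Ω P.value lam) y) (y' - y))
  have h3 := mul_le_mul_of_nonneg_right (h.norm_gradient_le hl hy) (norm_nonneg (y' - y))
  linarith

theorem abs_blowup_sub_le (h : P.Frame Ω ω δ w C r Vb L) (hl : SmallLam C r Vb lam) (hε : 0 < ε)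
    (hε1 : ε ≤ 1) {x₀ e q q' : E d} {t : ℝ}
    (hq : ∀ a ∈ ({q, q', q + e, q' + e} : Set (E d)),
      x₀ + ε • a ∈ Metric.thickening (2 * r) (sublevel Ω ω w δ))
    (ht : ‖q' - q‖ ≤ t) (ht1 : t ≤ 1) :
    |blowup (moreau Ω P.value lam) x₀ e ε q' - blowup (moreau Ω P.value lam) x₀ e ε q|
      ≤ 2 * (L + C) * t := by
  have hL := h.L_pos
  have hC := h.C_pos
  have ht0 : 0 ≤ t := (norm_nonneg _).trans ht
  have hM : ∀ a b : E d, x₀ + ε • a ∈ Metric.thickening (2 * r) (sublevel Ω ω w δ) →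
      ‖b - a‖ ≤ t → moreau Ω P.value lam (x₀ + ε • a) - moreau Ω P.value lam (x₀ + ε • b)
        ≤ ε * ((L + C) * t) := fun a b ha hab => by
    refine (h.moreau_sub_le hl ha).trans ?_
    have h1 : x₀ + ε • b - (x₀ + ε • a) = ε • (b - a) := by module
    rw [h1, norm_smul, Real.norm_of_nonneg hε.le]
    have h2 : ε * ‖b - a‖ ≤ ε * t := by gcongr
    have h3 : (ε * ‖b - a‖) ^ 2 ≤ ε * t := by
      calc (ε * ‖b - a‖) ^ 2 ≤ (ε * t) ^ 2 := by gcongr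
        _ = (ε * t) * (ε * t) := by ring
        _ ≤ 1 * (ε * t) := by gcongr; nlinarith
        _ = ε * t := one_mul _
    nlinarith
  have hrev : ‖q - q'‖ ≤ t := by rwa [norm_sub_rev]
  have h1 := hM q q' (hq _ (by simp)) ht
  have h2 := hM q' q (hq _ (by simp)) hrev
  have h3 := hM (q + e) (q' + e) (hq _ (by simp)) (by simpa using ht)
  have h4 := hM (q' + e) (q + e) (hq _ (by simp)) (by simpa using hrev)
  rw [blowup, blowup, ← sub_div, abs_div, abs_of_pos hε, div_le_iff₀ hε, abs_le]
  constructor <;> linarith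

theorem abs_blowup_mollify_sub_le (h : P.Frame Ω ω δ w C r Vb L) (hl : SmallLam C r Vb lam)
    (hρ : IsSmoothMollifier ρ) (hε : 0 < ε) (hg : P.GoodEps Ω ω δ w ρ ε lam) {x₀ e q : E d}
    {R : ℝ} (hR : Metric.ball x₀ R ⊆ sublevel Ω ω w δ) (hq : x₀ + ε • q ∈ Metric.ball x₀ R)
    (hqe : x₀ + ε • (q + e) ∈ Metric.ball x₀ R) :
    |blowup (mollify ρ ε (moreau Ω P.value lam)) x₀ e ε q
      - blowup (moreau Ω P.value lam) x₀ e ε q| ≤ Real.sqrt lam * ‖e‖ := by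
  have hM := h.continuous_moreau hl ⟨_, (hR hq).1⟩
  have hd : ∀ x ∈ Metric.ball x₀ R, HasGradientAt
      (fun x => P.smoothValue Ω ρ ε lam x - moreau Ω P.value lam x)
      (gradient (P.smoothValue Ω ρ ε lam) x - gradient (moreau Ω P.value lam) x) x :=
    fun x hx => by
      have h1 : HasGradientAt (P.smoothValue Ω ρ ε lam) (gradient (P.smoothValue Ω ρ ε lam) x) x :=
        (((hρ.contDiff_mollify hε hM).differentiable (by simp)) x).hasGradientAt
      have h2 := h.hasGradientAt hl (h.sublevel_subset_thickening (hR hx))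
      rw [hasGradientAt_iff_hasFDerivAt, map_sub]
      exact h1.hasFDerivAt.sub h2.hasFDerivAt
  have key := (convex_ball x₀ R).norm_image_sub_le_of_norm_hasFDerivWithin_le (C := Real.sqrt lam)
    (fun x hx => (hd x hx).hasFDerivAt.hasFDerivWithinAt) (fun x hx => by
      rw [LinearIsometryEquiv.norm_map]
      exact Real.le_sqrt_of_sq_le (norm_gradient_sub_sq_le hg hl.pos (hR hx))) hq hqe
  have h3 : x₀ + ε • (q + e) - (x₀ + ε • q) = ε • e := by module
  rw [h3, norm_smul, Real.norm_of_nonneg hε.le, Real.norm_eq_abs] at key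
  rw [blowup, blowup, ← sub_div, abs_div, abs_of_pos hε, div_le_iff₀ hε]
  refine le_trans (le_of_eq ?_) (key.trans (le_of_eq (by ring)))
  rw [smoothValue]
  congr 1
  ring

/-- Let `ζ₁`, `ζ₂` maximise and minimise `⟨·, e⟩` over the subgradients at `x₀`. By upper
semicontinuity the blow-ups asymptotically lie between these two extreme values, and both are
attained, because `∇M_λV(x₀ + λζ) = ζ` and `λ/ε` converges. The Liouville property makes the extreme
values equal; but the maximum is at least `|e|² > 0`, and the minimum is at most `0` since `0` is a
subgradient at a zero of `V`. -/
theorem false_of_tendsto_blowup (h : P.Frame Ω ω δ w C r Vb L) (hρ : IsSmoothMollifier ρ)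
    {x₀ e : E d} (hx₀ : x₀ ∈ sublevel Ω ω w δ) (hV : P.value x₀ = 0)
    (he : IsSubgrad C Ω P.value x₀ e) (he0 : e ≠ 0) {lam ε : ℕ → ℝ} {r₀ : ℝ}
    (hl : ∀ n, SmallLam C r Vb (lam n)) (hε : ∀ n, 0 < ε n)
    (hg : ∀ n, P.GoodEps Ω ω δ w ρ (ε n) (lam n)) (hlam0 : Tendsto lam atTop (𝓝 0))
    (hε0 : Tendsto ε atTop (𝓝 0)) (hr : Tendsto (fun n => lam n / ε n) atTop (𝓝 r₀)) : False := by
  have hrpos := h.r_pos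
  have hL := h.L_pos
  have hC := h.C_pos
  have hth : ∀ s, 0 < s → x₀ ∈ Metric.thickening s (sublevel Ω ω w δ) := fun s hs =>
    Metric.self_subset_thickening hs _ hx₀
  have hth3 := hth (3 * r) (by positivity)
  obtain ⟨R, hR0, hR⟩ := Metric.isOpen_iff.1 h.isOpen_sublevel x₀ hx₀
  have hRth : Metric.ball x₀ R ⊆ Metric.thickening (2 * r) (sublevel Ω ω w δ) :=
    hR.trans h.sublevel_subset_thickening
  have hcompact := h.isCompact_isSubgrad hth3
  have hinner : ContinuousOn (fun ξ : E d => inner ℝ ξ e) {ξ | IsSubgrad C Ω P.value x₀ ξ} :=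
    (continuous_id.inner continuous_const).continuousOn
  obtain ⟨ζ₁, hζ₁, hmax⟩ := hcompact.exists_isMaxOn ⟨e, he⟩ hinner
  obtain ⟨ζ₂, hζ₂, hmin⟩ := hcompact.exists_isMinOn ⟨e, he⟩ hinner
  set D : ℕ → E d → ℝ := fun n => blowup (moreau Ω P.value (lam n)) x₀ e (ε n) with hD
  set G : ℕ → E d → E d := fun n => gradient (moreau Ω P.value (lam n)) with hGdef
  have hnear : ∀ B t : ℝ, 0 < t → ∀ᶠ n in atTop, ∀ q : E d, ‖q‖ ≤ B →
      x₀ + ε n • q ∈ Metric.ball x₀ t := fun B t ht => by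
    have h1 : Tendsto (fun n => ε n * |B|) atTop (𝓝 0) := by simpa using hε0.mul_const |B|
    filter_upwards [h1.eventually_lt_const ht] with n hn q hq
    rw [Metric.mem_ball, dist_eq_norm, add_sub_cancel_left, norm_smul,
      Real.norm_of_nonneg (hε n).le]
    refine lt_of_le_of_lt ?_ hn
    have := (hε n).le
    have := hq.trans (le_abs_self B)
    gcongr
  have hGnear : ∀ B η : ℝ, 0 < η → ∀ᶠ n in atTop, ∀ q : E d, ‖q‖ ≤ B →
      ∃ ζ, IsSubgrad C Ω P.value x₀ ζ ∧ ‖G n (x₀ + ε n • q) - ζ‖ < η := fun B η hη => by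
    obtain ⟨t, ht, hsub⟩ := h.exists_isSubgrad_norm_sub_lt hth3 hη
    have h1 : Tendsto (fun n => lam n * L) atTop (𝓝 0) := by simpa using hlam0.mul_const L
    filter_upwards [hnear B R hR0, hnear B (t / 2) (half_pos ht),
      h1.eventually_lt_const (half_pos ht)] with n h2 h3 h4 q hq
    have h5 := hRth (h2 q hq)
    refine hsub _ ?_ _ (h.isSubgrad (hl n) h5)
    have h6 := h.norm_smul_gradient_le (hl n) h5
    have h7 := Metric.mem_ball.1 (h3 q hq)
    rw [Metric.mem_ball]
    refine (dist_triangle _ (x₀ + ε n • q) _).trans_lt ?_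
    rw [dist_eq_norm, sub_sub_cancel_left, norm_neg]
    linarith
  have hsmall : ∀ η : ℝ, 0 < η → ∀ᶠ n in atTop, C * ε n * ‖e‖ ^ 2 < η := fun η hη => by
    have h1 : Tendsto (fun n => C * ε n * ‖e‖ ^ 2) atTop (𝓝 0) := by
      simpa using (hε0.const_mul C).mul_const (‖e‖ ^ 2)
    exact h1.eventually_lt_const hη
  have hinn : ∀ {a b : E d} {η : ℝ}, 0 < η → ‖a - b‖ < η / (2 * (‖e‖ + 1)) →
      |inner ℝ a e - inner ℝ b e| ≤ η / 2 := fun {a b η} hη hab => by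
    rw [← inner_sub_left]
    refine (abs_real_inner_le_norm _ _).trans ?_
    have h1 : ‖e‖ ≤ ‖e‖ + 1 := by linarith
    calc ‖a - b‖ * ‖e‖ ≤ η / (2 * (‖e‖ + 1)) * (‖e‖ + 1) := by gcongr
      _ = η / 2 := by field_simp
  have hup : ∀ B η : ℝ, 0 < η → ∀ᶠ n in atTop, ∀ q : E d, ‖q‖ ≤ B →
      D n q ≤ inner ℝ ζ₁ e + η := fun B η hη => by
    filter_upwards [hnear (B + ‖e‖) R hR0,
      hGnear (B + ‖e‖) (η / (2 * (‖e‖ + 1))) (by positivity), hsmall _ (half_pos hη)]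
      with n h1 h2 h3 q hq
    have hqe : ‖q + e‖ ≤ B + ‖e‖ := (norm_add_le _ _).trans (by linarith)
    obtain ⟨ζ, hζ, hζG⟩ := h2 _ hqe
    have h4 := h.blowup_le (hl n) (hε n) (hRth (h1 _ hqe))
    have h5 := (le_abs_self _).trans (hinn hη hζG)
    have h6 : inner ℝ ζ e ≤ inner ℝ ζ₁ e := hmax hζ
    simp only [hD, hGdef] at h5 ⊢
    linarith
  have hlo : ∀ B η : ℝ, 0 < η → ∀ᶠ n in atTop, ∀ q : E d, ‖q‖ ≤ B →
      inner ℝ ζ₂ e - η ≤ D n q := fun B η hη => by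
    filter_upwards [hnear B R hR0,
      hGnear B (η / (2 * (‖e‖ + 1))) (by positivity), hsmall _ (half_pos hη)] with n h1 h2 h3 q hq
    obtain ⟨ζ, hζ, hζG⟩ := h2 _ hq
    have h4 := h.le_blowup (e := e) (hl n) (hε n) (hRth (h1 _ hq))
    have h5 := neg_le_of_abs_le (hinn hη hζG)
    have h6 : inner ℝ ζ₂ e ≤ inner ℝ ζ e := hmin hζ
    simp only [hD, hGdef] at h5 ⊢
    linarith
  have hequi : ∀ q, ∀ κ > 0, ∃ t > 0, ∀ᶠ n in atTop, ∀ q' ∈ Metric.ball q t,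
      |D n q' - D n q| ≤ κ := fun q κ hκ => by
    refine ⟨min 1 (κ / (2 * (L + C))), by positivity, ?_⟩
    filter_upwards [hnear (‖q‖ + 1 + ‖e‖) R hR0, hε0.eventually_le_const one_pos] with n h1 h2 q' hq'
    rw [Metric.mem_ball, dist_eq_norm] at hq'
    have h3 : ‖q'‖ ≤ ‖q‖ + 1 := by
      have h4 := norm_le_norm_add_norm_sub' q' q
      have h5 := hq'.le.trans (min_le_left _ _)
      linarith
    refine (h.abs_blowup_sub_le (hl n) (hε n) h2 (fun a ha => hRth (h1 a ?_)) hq'.le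
      (min_le_left _ _)).trans ?_
    · have h6 := norm_nonneg e
      simp only [mem_insert_iff, mem_singleton_iff] at ha
      rcases ha with rfl | rfl | rfl | rfl
      · linarith
      · linarith
      · exact (norm_add_le _ _).trans (by linarith)
      · exact (norm_add_le _ _).trans (by linarith)
    · calc 2 * (L + C) * min 1 (κ / (2 * (L + C))) ≤ 2 * (L + C) * (κ / (2 * (L + C))) := by
            gcongr; exact min_le_right _ _
        _ = κ := by field_simp
  have hmol : ∀ q, Tendsto (fun n => (∫ z, ρ z * D n (q - z)) - D n q) atTop (𝓝 0) := fun q => by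
    have hs : Tendsto (fun n => Real.sqrt (lam n) * ‖e‖) atTop (𝓝 0) := by
      simpa using (hlam0.sqrt).mul_const ‖e‖
    refine squeeze_zero_norm' ?_ hs
    filter_upwards [hnear (‖q‖ + ‖e‖) R hR0] with n h1
    rw [integral_mul_blowup hρ (h.continuous_moreau (hl n) ⟨x₀, hx₀.1⟩) (hε n)]
    exact h.abs_blowup_mollify_sub_le (hl n) hρ (hε n) (hg n) hR
      (h1 q (by linarith [norm_nonneg e])) (h1 _ (norm_add_le _ _))
  have hcont : ∀ n, Continuous (D n) := fun n => by
    have := h.continuous_moreau (hl n) ⟨x₀, hx₀.1⟩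
    simp only [hD]
    unfold blowup
    fun_prop
  have hzb : ∀ q z : E d, ρ z ≠ 0 → ‖q - z‖ ≤ ‖q‖ + 1 := fun q z hz =>
    (norm_sub_le _ _).trans (by linarith [hρ.norm_lt_one hz])
  have hlamζ : ∀ n (ζ : E d), lam n • ζ = ε n • ((lam n / ε n) • ζ) := fun n ζ => by
    rw [smul_smul, mul_div_cancel₀ _ (hε n).ne']
  have hrζ : ∀ ζ : E d, Tendsto (fun n => (lam n / ε n) • ζ) atTop (𝓝 (r₀ • ζ)) := fun ζ =>
    hr.smul_const ζ
  have hGζ : ∀ ζ, IsSubgrad C Ω P.value x₀ ζ → ∀ᶠ n in atTop,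
      x₀ + ε n • ((lam n / ε n) • ζ) ∈ Metric.ball x₀ R ∧
        G n (x₀ + ε n • ((lam n / ε n) • ζ)) = ζ := fun ζ hζ => by
    filter_upwards [hnear (‖r₀ • ζ‖ + 1) R hR0, ((hrζ ζ).norm.eventually_le_const
      (show ‖r₀ • ζ‖ < ‖r₀ • ζ‖ + 1 by linarith))] with n h1 h2
    have h3 := h1 _ h2
    refine ⟨h3, ?_⟩
    rw [← hlamζ] at h3 ⊢
    exact h.gradient_add_smul (hl n) hx₀.1 hζ (hRth h3)
  have hq₁ : Tendsto (fun n => D n (r₀ • ζ₁)) atTop (𝓝 (inner ℝ ζ₁ e)) := by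
    refine tendsto_order.2 ⟨fun a ha => ?_, fun b hb => ?_⟩
    · obtain ⟨t, ht, hDt⟩ := hequi (r₀ • ζ₁) ((inner ℝ ζ₁ e - a) / 4) (by linarith)
      filter_upwards [hDt, hGζ ζ₁ hζ₁, (hrζ ζ₁).eventually_mem (Metric.ball_mem_nhds _ ht),
        hsmall ((inner ℝ ζ₁ e - a) / 4) (by linarith)] with n h1 h2 h3 h4
      have h5 := h.le_blowup (e := e) (hl n) (hε n) (hRth h2.1)
      have h6 := (le_abs_self _).trans (h1 _ h3)
      have h7 : gradient (moreau Ω P.value (lam n)) (x₀ + ε n • (lam n / ε n) • ζ₁) = ζ₁ := h2.2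
      rw [h7] at h5
      simp only [hD] at h6 ⊢
      linarith
    · filter_upwards [hup ‖r₀ • ζ₁‖ ((b - inner ℝ ζ₁ e) / 2) (by linarith)] with n hn
      linarith [hn _ le_rfl]
  -- The shift by `-e` places the endpoint `q + e` of the difference quotient at `r₀ζ₂`, because the
  -- upper bound `blowup_le` uses the gradient at that endpoint; the lower bound used for `ζ₁` takes
  -- the gradient at `q`.
  have hq₂ : Tendsto (fun n => D n (r₀ • ζ₂ - e)) atTop (𝓝 (inner ℝ ζ₂ e)) := by
    refine tendsto_order.2 ⟨fun a ha => ?_, fun b hb => ?_⟩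
    · filter_upwards [hlo ‖r₀ • ζ₂ - e‖ ((inner ℝ ζ₂ e - a) / 2) (by linarith)] with n hn
      linarith [hn _ le_rfl]
    · obtain ⟨t, ht, hDt⟩ := hequi (r₀ • ζ₂ - e) ((b - inner ℝ ζ₂ e) / 4) (by linarith)
      filter_upwards [hDt, hGζ ζ₂ hζ₂, ((hrζ ζ₂).sub_const e).eventually_mem
        (Metric.ball_mem_nhds _ ht), hsmall ((b - inner ℝ ζ₂ e) / 4) (by linarith)]
        with n h1 h2 h3 h4
      have h5 := h.blowup_le (x₀ := x₀) (e := e) (q := (lam n / ε n) • ζ₂ - e) (hl n) (hε n)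
        (by rw [sub_add_cancel]; exact hRth h2.1)
      have h6 := neg_le_of_abs_le (h1 _ h3)
      have h7 : gradient (moreau Ω P.value (lam n)) (x₀ + ε n • (lam n / ε n) • ζ₂) = ζ₂ := h2.2
      rw [sub_add_cancel, h7] at h5
      simp only [hD] at h6 ⊢
      linarith
  have heq := hρ.eq_of_tendsto hcont hequi hmol
    (fun q η hη => (hup (‖q‖ + 1) η hη).mono fun n hn z hz => hn _ (hzb q z hz))
    (fun q η hη => (hlo (‖q‖ + 1) η hη).mono fun n hn z hz => hn _ (hzb q z hz)) hq₁ hq₂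
  have h1 : inner ℝ e e ≤ inner ℝ ζ₁ e := hmax he
  have h2 : inner ℝ ζ₂ e ≤ inner ℝ (0 : E d) e := hmin (isSubgrad_zero hC.le (nonneg P Ω) hV)
  rw [inner_zero_left] at h2
  rw [real_inner_self_eq_norm_sq] at h1
  have : 0 < ‖e‖ := norm_pos_iff.2 he0
  nlinarith

/-- If `V` has a non-zero subgradient at one of its zeros, then every good choice of `ε` is
small compared to `λ`. -/
theorem exists_eps_lt (h : P.Frame Ω ω δ w C r Vb L) (hρ : IsSmoothMollifier ρ)
    {x₀ e : E d} (hx₀ : x₀ ∈ sublevel Ω ω w δ) (hV : P.value x₀ = 0)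
    (he : IsSubgrad C Ω P.value x₀ e) (he0 : e ≠ 0) {c : ℝ} (hc : 0 < c) :
    ∃ l > 0, ∀ lam ε, SmallLam C r Vb lam → lam < l → 0 < ε → ε < l →
      P.GoodEps Ω ω δ w ρ ε lam → ε < c * lam := by
  by_contra! hcon
  choose! lam ε hl hlam hε hεl hg hle using fun n : ℕ => hcon (1 / ((n : ℝ) + 1)) (by positivity)
  have hlam0 : Tendsto lam atTop (𝓝 0) := squeeze_zero (fun n => (hl n).pos.le)
    (fun n => (hlam n).le) tendsto_one_div_add_atTop_nhds_zero_nat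
  have hε0 : Tendsto ε atTop (𝓝 0) := squeeze_zero (fun n => (hε n).le)
    (fun n => (hεl n).le) tendsto_one_div_add_atTop_nhds_zero_nat
  -- Failure means `ε ≥ cλ`, so the ratios `λ/ε` lie in the compact interval `[0, 1/c]`; the limit
  -- may be `0`.
  obtain ⟨r₀, -, φ, hφ, hr⟩ := isCompact_Icc.tendsto_subseq (x := fun n => lam n / ε n)
    (s := Icc 0 (1 / c)) fun n => ⟨div_nonneg (hl n).pos.le (hε n).le, by
      rw [div_le_div_iff₀ (hε n) hc]; linarith [hle n]⟩
  exact h.false_of_tendsto_blowup hρ hx₀ hV he he0 (fun n => hl (φ n)) (fun n => hε (φ n))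
    (fun n => hg (φ n)) (hlam0.comp hφ.tendsto_atTop) (hε0.comp hφ.tendsto_atTop) hr

end Frame
end ControlProblem

/-! ### The drift of the Lyapunov function against `rate` -/

namespace ControlProblem
variable {d m : ℕ} {P : ControlProblem d m}

namespace IsControlled
variable {D : Set (E d)} {T : ℝ} {v : ℝ → E m} {y : ℝ → E d}

theorem shift (hy : P.IsControlled D T v y) {a b : ℝ} (ha : 0 ≤ a) (hb : a + b ≤ T) :
    P.IsControlled D b (fun t => v (a + t)) (fun t => y (a + t)) := by
  have hm : MapsTo (fun t => a + t) (Icc 0 b) (Icc 0 T) := fun t ht =>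
    ⟨by linarith [ht.1], by linarith [ht.2]⟩
  refine ⟨hy.cont.comp (by fun_prop) hm, fun t ht => ?_, fun t ht => hy.mem _ (hm ht)⟩
  have h1 := (hy.deriv _ (hm ht)).scomp t
    (((hasDerivAt_id t).const_add a).hasDerivWithinAt (s := Icc 0 b)) hm
  rw [one_smul] at h1
  exact h1

theorem integral_runCost_shift (hP : P.Standing) (hy : P.IsControlled D T v y) {a b : ℝ}
    (ha : 0 ≤ a) (hb0 : 0 ≤ b) (hb : a + b ≤ T) :
    ∫ t in (0 : ℝ)..b, P.runCost (fun t => v (a + t)) (fun t => y (a + t)) t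
      = (∫ t in (0 : ℝ)..(a + b), P.runCost v y t) - ∫ t in (0 : ℝ)..a, P.runCost v y t := by
  have hi : ∀ c, 0 ≤ c → c ≤ T → IntervalIntegrable (P.runCost v y) volume 0 c :=
    fun c hc hcT => by
      refine ContinuousOn.intervalIntegrable ?_
      rw [uIcc_of_le hc]
      exact (hy.continuousOn_runCost hP).mono (Icc_subset_Icc_right hcT)
  rw [intervalIntegral.integral_interval_sub_left (hi _ (by linarith) hb) (hi _ ha (by linarith))]
  have := intervalIntegral.integral_comp_add_left (a := 0) (b := b) (P.runCost v y) a
  rw [add_zero] at this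
  exact this

/-- The running cost accumulated over windows of length `S`, averaged over the window. -/
theorem integral_window_le (hP : P.Standing) (hy : P.IsControlled D T v y) {S : ℝ} (hS : 0 ≤ S)
    (hST : S ≤ T) :
    ∫ s in (0 : ℝ)..(T - S), ((∫ t in (0 : ℝ)..(s + S), P.runCost v y t)
      - ∫ t in (0 : ℝ)..s, P.runCost v y t) ≤ S * ∫ t in (0 : ℝ)..T, P.runCost v y t := by
  have hT := hS.trans hST
  set R : ℝ → ℝ := fun s => ∫ t in (0 : ℝ)..s, P.runCost v y t with hR
  have hRc : ContinuousOn R (Icc 0 T) := by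
    have := intervalIntegral.continuousOn_primitive_interval (f := P.runCost v y)
      (a := 0) (b := T) (μ := volume) (by
        rw [uIcc_of_le hT]; exact (hy.continuousOn_runCost hP).integrableOn_Icc)
    rwa [uIcc_of_le hT] at this
  have hi : ∀ a b, 0 ≤ a → a ≤ b → b ≤ T → IntervalIntegrable R volume a b :=
    fun a b ha hab hb => by
      refine ContinuousOn.intervalIntegrable ?_
      rw [uIcc_of_le hab]
      exact hRc.mono (Icc_subset_Icc ha hb)
  have h1 : ∫ s in (0 : ℝ)..(T - S), R (s + S) = ∫ s in S..T, R s := by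
    have := intervalIntegral.integral_comp_add_right (a := 0) (b := T - S) R S
    rwa [zero_add, sub_add_cancel] at this
  have hshift : IntervalIntegrable (fun s => R (s + S)) volume 0 (T - S) := by
    refine ContinuousOn.intervalIntegrable ?_
    rw [uIcc_of_le (by linarith)]
    exact hRc.comp (by fun_prop) fun s hs => ⟨by linarith [hs.1], by linarith [hs.2]⟩
  -- The integral of `R(s + S) - R(s)` telescopes to the integral of `R` over the last window minus
  -- that over the first; `R` is non-negative and non-decreasing.
  rw [intervalIntegral.integral_sub hshift (hi _ _ le_rfl (by linarith) (by linarith)), h1]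
  have h2 := intervalIntegral.integral_add_adjacent_intervals (hi 0 S le_rfl hS hST)
    (hi S T hS hST le_rfl)
  have h3 := intervalIntegral.integral_add_adjacent_intervals
    (hi 0 (T - S) le_rfl (by linarith) (by linarith)) (hi (T - S) T (by linarith) (by linarith) le_rfl)
  have h4 : 0 ≤ ∫ s in (0 : ℝ)..S, R s := intervalIntegral.integral_nonneg hS fun s hs =>
    intervalIntegral.integral_nonneg hs.1 fun t _ => hP.runCost_nonneg v y t
  have h5 : ∫ s in (T - S)..T, R s ≤ ∫ _s in (T - S)..T, R T :=
    intervalIntegral.integral_mono_on (by linarith) (hi _ _ (by linarith) (by linarith) le_rfl)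
      intervalIntegrable_const fun s hs =>
        hy.integral_runCost_mono hP ⟨by linarith [hs.1], hs.2⟩
  rw [intervalIntegral.integral_const, smul_eq_mul, sub_sub_cancel] at h5
  linarith

end IsControlled

namespace IsClosedLoop
variable {D : Set (E d)} {u : E d → E m} {T : ℝ} {y₀ : E d} {y : ℝ → E d}

theorem continuousOn (hy : P.IsClosedLoop D u T y₀ y) : ContinuousOn y (Icc 0 T) :=
  fun t ht => (hy.deriv t ht).continuousWithinAt

theorem isControlled (hy : P.IsClosedLoop D u T y₀ y) (hu : Continuous u) :
    P.IsControlled D T (fun t => u (y t)) y :=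
  ⟨hu.comp_continuousOn hy.continuousOn, hy.deriv, hy.mem⟩

theorem mono (hy : P.IsClosedLoop D u T y₀ y) {t : ℝ} (ht : t ≤ T) {D' : Set (E d)}
    (hD : ∀ s ∈ Icc 0 t, y s ∈ D') : P.IsClosedLoop D' u t y₀ y where
  init := hy.init
  deriv s hs := (hy.deriv s (Icc_subset_Icc_right ht hs)).mono (Icc_subset_Icc_right ht)
  mem := hD

end IsClosedLoop

namespace Frame
variable {Ω ω : Set (E d)} {δ : ℝ} {w : E d → ℝ} {C r Vb L lam ε : ℝ} {ρ : E d → ℝ}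

theorem w_sub_le_integral (h : P.Frame Ω ω δ w C r Vb L) {v : E d → ℝ} {T : ℝ} {y₀ : E d}
    {y : ℝ → E d} (hy : P.IsClosedLoop Ω (P.feedback v) T y₀ y) {a b : ℝ} (ha : 0 ≤ a)
    (hab : a ≤ b) (hb : b ≤ T) {φ : ℝ → ℝ} (hφ : ContinuousOn φ (Icc a b))
    (hle : ∀ t ∈ Icc a b, P.lyapDrift w (y t) (gradient v (y t)) ≤ φ t) :
    w (y b) - w (y a) ≤ ∫ t in a..b, φ t := by
  have hsub : Icc a b ⊆ Icc 0 T := Icc_subset_Icc ha hb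
  refine intervalIntegral.sub_le_integral_of_hasDeriv_right_of_le (g := fun t => w (y t)) hab
    (g' := fun t => P.lyapDrift w (y t) (gradient v (y t)))
    (h.continuousOn_w.comp (hy.continuousOn.mono hsub) fun t ht => hy.mem t (hsub ht))
    (fun t ht => ?_) hφ.integrableOn_Icc fun t ht => hle t (Ioo_subset_Icc_self ht)
  have ht' := hsub (Ioo_subset_Icc_self ht)
  have h1 := (h.hasGradientAt_w (hy.mem t ht')).hasFDerivAt.comp_hasDerivAt t
    ((hy.deriv t ht').hasDerivAt (mem_of_superset (Icc_mem_nhds ht.1 ht.2) hsub))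
  rw [← inner_closedLoop_eq_lyapDrift]
  exact h1.hasDerivWithinAt

/-- The constant in front of the part of the drift of `w` that is not covered by `rate`. -/
noncomputable def _root_.ControlProblem.excessConst (P : ControlProblem d m) (Ω : Set (E d))
    (w : E d → ℝ) : ℝ :=
  P.β⁻¹ * (lipNorm P.B Ω).toReal ^ 2 * (supNorm (gradient w) Ω).toReal

theorem excessConst_nonneg (h : P.Frame Ω ω δ w C r Vb L) : 0 ≤ P.excessConst Ω w := by
  have := h.standing.β_pos
  unfold excessConst
  positivity

/-- The gap between `c` and the level of `ω_δ` leaves a distance `q`, half of which is reserved for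
the mollification ball and half for the step `λL` to the proximal point, so that the Lyapunov
condition is available at all points involved. -/
theorem exists_drift_le (h : P.Frame Ω ω δ w C r Vb L) (hρ : IsSmoothMollifier ρ) {c : ℝ}
    (hc : c < sSup (w '' ω) + δ) :
    ∃ l > 0, ∀ lam ε, SmallLam C r Vb lam → lam < l → 0 < ε → ε < l →
      P.rate Ω ω δ w ε lam ≠ ⊤ ∧ ∀ x ∈ Ω, w x ≤ c →
        (∀ y ∈ Metric.ball x ε, y ∈ sublevel Ω ω w δ ∧
          y - lam • gradient (moreau Ω P.value lam) y ∈ sublevel Ω ω w δ) ∧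
        ∀ Q, (∀ y ∈ Metric.ball x ε, ‖gradient (moreau Ω P.value lam) y‖ ≤ Q) →
          P.lyapDrift w x (gradient (P.smoothValue Ω ρ ε lam) x)
            ≤ (P.rate Ω ω δ w ε lam).toReal + P.excessConst Ω w * ε * Q := by
  have hr := h.r_pos
  have hL := h.L_pos
  obtain ⟨q, hq, hball⟩ := h.exists_ball_subset hc
  obtain ⟨l₁, hl₁, hrate⟩ := h.exists_rate_le one_pos
  obtain ⟨l₂, hl₂, hsig⟩ := h.exists_sigma_le one_pos
  refine ⟨min (min l₁ l₂) (min r (min (q / 2) (q / (2 * L)))), by positivity,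
    fun lam ε hl hlam hε hεl => ?_⟩
  simp only [lt_min_iff] at hlam hεl
  obtain ⟨⟨a1, a2⟩, a3, a4, a5⟩ := hlam
  obtain ⟨⟨b1, b2⟩, b3, b4, b5⟩ := hεl
  have hrt := ne_top_of_le_ne_top ENNReal.ofReal_ne_top (hrate lam ε hl a1 hε b1)
  refine ⟨hrt, fun x hx hxc => ?_⟩
  have hxS : x ∈ sublevel Ω ω w δ := ⟨hx, hxc.trans_lt hc⟩
  have hmem : ∀ y ∈ Metric.ball x ε, y ∈ sublevel Ω ω w δ ∧
          y - lam • gradient (moreau Ω P.value lam) y ∈ sublevel Ω ω w δ := fun y hy => by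
    have hyx := Metric.mem_ball.1 hy
    have hyS : y ∈ sublevel Ω ω w δ :=
      hball x hx hxc (Metric.mem_ball.2 (by linarith))
    refine ⟨hyS, hball x hx hxc (Metric.mem_ball.2 ?_)⟩
    refine (dist_triangle _ y _).trans_lt ?_
    have h1 := h.norm_smul_gradient_le hl (h.sublevel_subset_thickening hyS)
    rw [lt_div_iff₀ (by positivity)] at a5
    rw [dist_eq_norm, sub_sub_cancel_left, norm_neg]
    linarith
  refine ⟨hmem, fun Q hQ => ?_⟩
  exact h.closedLoop_drift_le hl hρ hε b3 hrt
    (ne_top_of_le_ne_top ENNReal.ofReal_ne_top (hsig lam ε hl a2 hε b2).2) hxS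
    (fun y hy => (hmem y hy).1) (fun y hy => (hmem y hy).2) hQ

/-- If `V` has only the trivial subgradient at its zeros, then `∇M_λV` is small where `V` is. -/
theorem exists_norm_gradient_le (h : P.Frame Ω ω δ w C r Vb L) {c : ℝ}
    (hc : c < sSup (w '' ω) + δ)
    (h0 : ∀ x ∈ sublevel Ω ω w δ, P.value x = 0 → ∀ ξ, IsSubgrad C Ω P.value x ξ → ξ = 0)
    {κ : ℝ} (hκ : 0 < κ) :
    ∃ μ > 0, ∃ l > 0, ∀ lam ε, SmallLam C r Vb lam → lam < l → 0 < ε → ε < l →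
      ∀ x ∈ Ω, w x ≤ c → P.value x ≤ μ → ∀ y ∈ Metric.ball x ε,
        ‖gradient (moreau Ω P.value lam) y‖ ≤ κ := by
  have hr := h.r_pos
  -- In the limit the gradients would give a subgradient of norm at least `κ` at a zero of `V` in
  -- `ω_δ`.
  by_contra! hcon
  choose! lam ε hl hlam hε hεl x hx hxc hV y hy hlt using fun n : ℕ =>
    hcon (1 / ((n : ℝ) + 1)) (by positivity) (1 / ((n : ℝ) + 1)) (by positivity)
  have hone := tendsto_one_div_add_atTop_nhds_zero_nat (𝕜 := ℝ)
  obtain ⟨x₀, hx₀, φ, hφ, hlim⟩ := (h.isCompact_sublevel_le hc).tendsto_subseq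
    (x := x) fun n => ⟨hx n, hxc n⟩
  have hx₀S : x₀ ∈ sublevel Ω ω w δ := ⟨hx₀.1, hx₀.2.trans_lt hc⟩
  have hone' := hone.comp hφ.tendsto_atTop
  have hV0 : P.value x₀ = 0 := le_antisymm
    (le_of_tendsto_of_tendsto ((h.cont.tendsto x₀).comp hlim) hone'
      (Eventually.of_forall fun n => hV (φ n))) (value_nonneg P _)
  have hlam0 : Tendsto (lam ∘ φ) atTop (𝓝 0) :=
    squeeze_zero (fun n => (hl (φ n)).pos.le) (fun n => (hlam (φ n)).le) hone'
  have hε0 : Tendsto (ε ∘ φ) atTop (𝓝 0) :=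
    squeeze_zero (fun n => (hε (φ n)).le) (fun n => (hεl (φ n)).le) hone'
  have hth : ∀ᶠ n in atTop, y (φ n) ∈ Metric.thickening (2 * r) (sublevel Ω ω w δ) := by
    filter_upwards [hε0.eventually_lt_const hr] with n hn
    refine ball_subset_thickening (x := x (φ n)) ⟨hx _, (hxc _).trans_lt hc⟩ _ ?_
    rw [Metric.mem_ball]
    have h1 := Metric.mem_ball.1 (hy (φ n))
    simp only [Function.comp] at hn
    linarith
  set G : ℕ → E d := fun n => gradient (moreau Ω P.value (lam (φ n))) (y (φ n)) with hG
  have hp : Tendsto (fun n => y (φ n) - lam (φ n) • G n) atTop (𝓝 x₀) := by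
    rw [tendsto_iff_dist_tendsto_zero] at hlim ⊢
    refine squeeze_zero' (g := fun n => lam (φ n) * L + (ε (φ n) + dist (x (φ n)) x₀))
      (Eventually.of_forall fun _ => dist_nonneg) ?_ ?_
    · filter_upwards [hth] with n hn
      refine (dist_triangle _ (y (φ n)) _).trans (add_le_add ?_
        ((dist_triangle _ (x (φ n)) _).trans (add_le_add (Metric.mem_ball.1 (hy (φ n))).le le_rfl)))
      rw [dist_eq_norm, sub_sub_cancel_left, norm_neg]
      exact h.norm_smul_gradient_le (hl (φ n)) hn
    · simpa using (hlam0.mul_const L).add (hε0.add hlim)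
  obtain ⟨ζ, hζ, ψ, -, hψlim⟩ := h.exists_subseq_isSubgrad
    (Metric.self_subset_thickening (by positivity) _ hx₀S) hp
    (hth.mono fun n hn => h.isSubgrad (hl (φ n)) hn)
  have hζ0 := h0 x₀ hx₀S hV0 ζ hζ
  have h1 := ge_of_tendsto hψlim.norm (Eventually.of_forall fun n => (hlt (φ (ψ n))).le)
  rw [hζ0, norm_zero] at h1
  linarith

theorem ofReal_abs_le_sigma1 {x y : E d} (hx : x ∈ sublevel Ω ω w δ) (hy : y ∈ Metric.ball x ε) :
    ENNReal.ofReal |P.gLam Ω ω δ w P.value 0 lam y - inner ℝ (gradient w y) (P.f y)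
      + inner ℝ (gradient w x) (P.f x)| ≤ P.sigma1 Ω ω δ w P.value 0 ε lam :=
  le_iSup₂_of_le x hx (le_iSup₂_of_le y hy le_rfl)

/-- On the diagonal `y = x` of `σ¹` the two terms in `∇wᵀf` cancel and `g_λ(x)` remains. -/
theorem gLam_le_rate (h : P.Frame Ω ω δ w C r Vb L) (hl : SmallLam C r Vb lam) (hε : 0 < ε)
    (hrate : P.rate Ω ω δ w ε lam ≠ ⊤) {x : E d} (hx : x ∈ sublevel Ω ω w δ) :
    P.gLam Ω ω δ w P.value 0 lam x ≤ (P.rate Ω ω δ w ε lam).toReal := by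
  have h1 := ofReal_abs_le_sigma1 (P := P) (lam := lam) hx (Metric.mem_ball_self hε)
  rw [sub_add_cancel, abs_of_nonneg (h.gLam_nonneg hl (h.sublevel_subset_thickening hx))] at h1
  exact (ENNReal.ofReal_le_iff_le_toReal hrate).1 (h1.trans le_self_add)

/-- `σ¹` bounds the oscillation of `∇wᵀf` only together with `g_λ`; since `g_λ` lies between `0` and
the rate, the oscillation costs a second copy of the rate. -/
theorem abs_inner_sub_le_rate (h : P.Frame Ω ω δ w C r Vb L) (hl : SmallLam C r Vb lam)
    (hrate : P.rate Ω ω δ w ε lam ≠ ⊤) {x y : E d}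
    (hx : x ∈ sublevel Ω ω w δ) (hyx : y ∈ Metric.ball x ε) (hy : y ∈ sublevel Ω ω w δ) :
    |inner ℝ (gradient w x) (P.f x) - inner ℝ (gradient w y) (P.f y)|
      ≤ 2 * (P.rate Ω ω δ w ε lam).toReal := by
  have hε : 0 < ε := dist_nonneg.trans_lt (Metric.mem_ball.1 hyx)
  have h1 := h.gLam_le_rate hl hε hrate hy
  have h2 := h.gLam_nonneg hl (h.sublevel_subset_thickening hy)
  have h3 := (ENNReal.ofReal_le_iff_le_toReal hrate).1
    ((ofReal_abs_le_sigma1 (P := P) (lam := lam) hx hyx).trans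
      (le_self_add (b := P.sigma2 Ω ω δ w ε * supNorm (fun x =>
        ContinuousLinearMap.adjoint (P.B x) (gradient (moreau Ω P.value lam) x))
        (sublevel Ω ω w δ) / ENNReal.ofReal P.β)))
  rw [abs_le] at h3 ⊢
  constructor <;> linarith

theorem norm_mul_norm_le_rate (h : P.Frame Ω ω δ w C r Vb L)
    (hrate : P.rate Ω ω δ w ε lam ≠ ⊤) {x y z : E d}
    (hx : x ∈ sublevel Ω ω w δ) (hyx : y ∈ Metric.ball x ε) (hz : z ∈ sublevel Ω ω w δ) :
    ‖ContinuousLinearMap.adjoint (P.B x) (gradient w x)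
      - ContinuousLinearMap.adjoint (P.B y) (gradient w y)‖ *
      ‖ContinuousLinearMap.adjoint (P.B z) (gradient (moreau Ω P.value lam) z)‖ / P.β
      ≤ (P.rate Ω ω δ w ε lam).toReal := by
  have hβ := h.standing.β_pos
  refine (ENNReal.ofReal_le_iff_le_toReal hrate).1 (le_trans ?_ le_add_self)
  rw [ENNReal.ofReal_div_of_pos hβ, ENNReal.ofReal_mul (norm_nonneg _)]
  refine ENNReal.div_le_div_right (mul_le_mul' ?_ ?_) _
  · exact le_iSup₂_of_le x hx (le_iSup₂_of_le y hyx le_rfl)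
  · exact ofReal_norm_le_supNorm (F := fun x => ContinuousLinearMap.adjoint (P.B x)
        (gradient (moreau Ω P.value lam) x)) hz

/-- For small parameters, `p + λξ` stays in `ω_δ`. -/
theorem exists_add_smul_mem (h : P.Frame Ω ω δ w C r Vb L) {p : E d}
    (hp : p ∈ sublevel Ω ω w δ) (ξ : E d) {U : Set (E d)} (hU : U ∈ 𝓝 p) :
    ∃ l : ℝ, 0 < l ∧ ∀ lam : ℝ, 0 < lam → lam < l → p + lam • ξ ∈ sublevel Ω ω w δ ∩ U := by
  have hc : Continuous fun lam : ℝ => p + lam • ξ := by fun_prop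
  have h1 : Tendsto (fun lam : ℝ => p + lam • ξ) (𝓝 0) (𝓝 p) := by simpa using hc.tendsto 0
  obtain ⟨l, hl, hsub⟩ := Metric.eventually_nhds_iff_ball.1
    (h1.eventually_mem (inter_mem (h.isOpen_sublevel.mem_nhds hp) hU))
  exact ⟨l, hl, fun lam h0 h1 => hsub lam (by
    rw [Metric.mem_ball, Real.dist_eq, sub_zero, abs_of_pos h0]; exact h1)⟩

end Frame
end ControlProblem

/-! ### The rise of the Lyapunov function -/

namespace ControlProblem
variable {d m : ℕ} {P : ControlProblem d m}

namespace Frame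
variable {Ω ω : Set (E d)} {δ : ℝ} {w : E d → ℝ} {C r Vb L lam ε : ℝ} {ρ : E d → ℝ}

theorem continuous_feedback (h : P.Frame Ω ω δ w C r Vb L) (hl : SmallLam C r Vb lam)
    (hρ : IsSmoothMollifier ρ) (hε : 0 < ε) (hne : Ω.Nonempty) :
    Continuous (P.feedback (P.smoothValue Ω ρ ε lam)) := by
  have hs : ContDiff ℝ (⊤ : ℕ∞) (P.smoothValue Ω ρ ε lam) :=
    hρ.contDiff_mollify hε (h.continuous_moreau hl hne)
  have hg : Continuous (gradient (P.smoothValue Ω ρ ε lam)) :=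
    (InnerProductSpace.toDual ℝ (E d)).symm.continuous.comp (hs.continuous_fderiv (by simp))
  have hBg : Continuous fun x => ContinuousLinearMap.adjoint (P.B x)
      (gradient (P.smoothValue Ω ρ ε lam) x) := h.standing.continuous_adjoint.clm_apply hg
  exact (hBg.const_smul P.β⁻¹).neg

/-- The total running cost along closed loop trajectories in `ω_δ`. -/
theorem integral_runCost_le (h : P.Frame Ω ω δ w C r Vb L) (hl : SmallLam C r Vb lam)
    (hg : P.GoodEps Ω ω δ w ρ ε lam)
    (hu : Continuous (P.feedback (P.smoothValue Ω ρ ε lam))) {T : ℝ} (hT : 0 ≤ T) {y₀ : E d}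
    {y : ℝ → E d}
    (hy : P.IsClosedLoop (sublevel Ω ω w δ) (P.feedback (P.smoothValue Ω ρ ε lam)) T y₀ y) :
    (∫ t in (0 : ℝ)..T, P.runCost (fun t => P.feedback (P.smoothValue Ω ρ ε lam) (y t)) y t)
      ≤ Vb + P.energyConst Ω L * lam * T := by
  have h1 := h.closedLoop_energy_le hl hg hu hT hy
  have h0 := (hy.mem 0 (left_mem_Icc.2 hT)).1
  have h2 := (moreau_le_self hl.pos (nonneg P Ω) h0).trans (h.value_le _ h0)
  have h3 := moreau_nonneg hl.pos (nonneg P Ω) (y T)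
  linarith

/-- Drift bound `(1 + κ) rate` when `V` has a non-trivial subgradient at one of its zeros. -/
theorem exists_drift_le_of_ne_zero (h : P.Frame Ω ω δ w C r Vb L) (hρ : IsSmoothMollifier ρ)
    {c : ℝ} (hc : c < sSup (w '' ω) + δ) {x₀ ξ : E d} (hx₀ : x₀ ∈ sublevel Ω ω w δ)
    (hV : P.value x₀ = 0) (hξ : IsSubgrad C Ω P.value x₀ ξ) (hξ0 : ξ ≠ 0) {κ : ℝ} (hκ : 0 < κ) :
    ∃ l > 0, ∀ lam ε, SmallLam C r Vb lam → lam < l → 0 < ε → ε < l →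
      P.GoodEps Ω ω δ w ρ ε lam → ∀ x ∈ Ω, w x ≤ c →
        P.lyapDrift w x (gradient (P.smoothValue Ω ρ ε lam) x)
          ≤ (1 + κ) * (P.rate Ω ω δ w ε lam).toReal := by
  have hL := h.L_pos
  have hξn : 0 < ‖ξ‖ := norm_pos_iff.2 hξ0
  obtain ⟨l₁, hl₁, hdrift⟩ := h.exists_drift_le hρ hc
  -- The constant makes the excess at most `κ` times the last term of `g_λ` at `x₀ + λξ`, where the
  -- gradient of the envelope is exactly `ξ`; that term is below the rate.
  obtain ⟨l₂, hl₂, heps⟩ := h.exists_eps_lt hρ hx₀ hV hξ hξ0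
    (c := 2 * κ * ‖ξ‖ ^ 2 / L) (by positivity)
  obtain ⟨l₃, hl₃, hmem⟩ := h.exists_add_smul_mem hx₀ ξ univ_mem
  refine ⟨min l₁ (min l₂ l₃), by positivity, fun lam ε hl hlam hε hεl hg x hx hxc => ?_⟩
  simp only [lt_min_iff] at hlam hεl
  obtain ⟨hrt, hd⟩ := hdrift lam ε hl hlam.1 hε hεl.1
  obtain ⟨hm, hQ⟩ := hd x hx hxc
  have h1 := hQ L fun y hy => h.norm_gradient_le hl (h.sublevel_subset_thickening (hm y hy).1)
  have h2 := heps lam ε hl hlam.2.1 hε hεl.2.1 hg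
  have h3 := (hmem lam hl.pos hlam.2.2).1
  have h4 := h.gLam_le_rate hl hε hrt h3
  have h5 := h.le_gLam hl (h.sublevel_subset_thickening h3)
  rw [h.gradient_add_smul hl hx₀.1 hξ (h.sublevel_subset_thickening h3)] at h5
  have h6 : P.excessConst Ω w * ε * L ≤ κ * (P.rate Ω ω δ w ε lam).toReal := by
    have h7 : ε * L ≤ 2 * κ * ‖ξ‖ ^ 2 * lam := by
      rw [div_mul_eq_mul_div, lt_div_iff₀ hL] at h2
      exact h2.le
    calc P.excessConst Ω w * ε * L = P.excessConst Ω w * (ε * L) := by ring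
      _ ≤ P.excessConst Ω w * (2 * κ * ‖ξ‖ ^ 2 * lam) :=
        mul_le_mul_of_nonneg_left h7 h.excessConst_nonneg
      _ = κ * (2 * P.β⁻¹ * (lam * ‖ξ‖ ^ 2) * (lipNorm P.B Ω).toReal ^ 2
          * (supNorm (gradient w) Ω).toReal) := by rw [excessConst]; ring
      _ ≤ κ * (P.rate Ω ω δ w ε lam).toReal := by gcongr; exact h5.trans h4
  linarith

/-- Either the drift vanishes to leading order for trivial reasons, or `rate` is at least of the
order of `ε`. -/
theorem exists_drift_le_or_le_rate (h : P.Frame Ω ω δ w C r Vb L) (hρ : IsSmoothMollifier ρ)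
    {c : ℝ} (hc : c < sSup (w '' ω) + δ)
    (h0 : ∀ x ∈ sublevel Ω ω w δ, P.value x = 0 → ∀ ξ, IsSubgrad C Ω P.value x ξ → ξ = 0) :
    (∃ l > 0, ∀ lam ε, SmallLam C r Vb lam → lam < l → 0 < ε → ε < l →
      ∀ x ∈ Ω, w x ≤ c → P.lyapDrift w x (gradient (P.smoothValue Ω ρ ε lam) x)
          ≤ (P.rate Ω ω δ w ε lam).toReal) ∨
    ∃ k > 0, ∃ l > 0, ∀ lam ε, SmallLam C r Vb lam → lam < l → 0 < ε → ε < l →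
      k * ε ≤ (P.rate Ω ω δ w ε lam).toReal := by
  have hβ := h.standing.β_pos
  obtain ⟨l₀, hl₀, hdrift⟩ := h.exists_drift_le hρ hc
  -- Both `∇wᵀf` and `Bᵀ∇w` vanish at critical points of `w`, so the dichotomy applies to each.
  -- Linear oscillation of `∇wᵀf` makes `σ¹`, hence the rate, at least of order `ε`.
  rcases h.eq_zero_or_exists_norm_sub_ge (G := fun x => inner ℝ (gradient w x) (P.f x))
    (fun x _ hx => by simp [hx]) with hF | ⟨k, hk, ε₀, hε₀, hF⟩
  swap
  · refine Or.inr ⟨k / 2, by positivity, min l₀ ε₀, by positivity, fun lam ε hl hlam hε hεl => ?_⟩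
    simp only [lt_min_iff] at hlam hεl
    obtain ⟨x, hx, y, hyx, hy, hxy⟩ := hF ε hε hεl.2
    have := h.abs_inner_sub_le_rate hl (hdrift lam ε hl hlam.1 hε hεl.1).1 hx hyx hy
    rw [Real.norm_eq_abs] at hxy
    linarith
  rcases h.eq_zero_or_exists_norm_sub_ge
    (G := fun x => ContinuousLinearMap.adjoint (P.B x) (gradient w x))
    (fun x _ hx => by simp [hx]) with ha | ⟨k, hk, ε₀, hε₀, ha⟩
  · refine Or.inl ⟨1, one_pos, fun lam ε hl hlam hε hεl x hx hxc => ?_⟩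
    have hxS : x ∈ sublevel Ω ω w δ := ⟨hx, hxc.trans_lt hc⟩
    rw [lyapDrift, hF x hxS, ha x hxS, inner_zero_left, mul_zero, sub_zero]
    exact ENNReal.toReal_nonneg
  -- Here `∇wᵀf = 0` and `Bᵀ∇w` oscillates linearly, so `σ²` is of order `ε`. Whether the rate is
  -- too depends on its factor `‖Bᵀ∇M_λV‖`: it stays positive if `Bᵀξ ≠ 0` for some subgradient.
  -- Otherwise `V = 0` on `ω_δ`, all subgradients there vanish, and so does the excess.
  by_cases hB : ∀ p ∈ sublevel Ω ω w δ, ∀ ξ, IsSubgrad C Ω P.value p ξ →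
      ContinuousLinearMap.adjoint (P.B p) ξ = 0
  · refine Or.inl ⟨l₀, hl₀, fun lam ε hl hlam hε hεl x hx hxc => ?_⟩
    obtain ⟨hm, hQ⟩ := (hdrift lam ε hl hlam hε hεl).2 x hx hxc
    have := hQ 0 fun y hy => by
      have h1 := (hm y hy).2
      rw [h0 _ h1 (h.value_eq_zero hF hB h1) _
        (h.isSubgrad hl (h.sublevel_subset_thickening (hm y hy).1)), norm_zero]
    rwa [mul_zero, add_zero] at this
  · push Not at hB
    obtain ⟨p, hp, ξ, hξ, hBξ⟩ := hB
    have hn : 0 < ‖ContinuousLinearMap.adjoint (P.B p) ξ‖ := norm_pos_iff.2 hBξ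
    have hcont : Continuous fun x => ‖ContinuousLinearMap.adjoint (P.B x) ξ‖ :=
      (h.standing.continuous_adjoint.clm_apply continuous_const).norm
    obtain ⟨l₁, hl₁, hmem⟩ := h.exists_add_smul_mem hp ξ
      (hcont.continuousAt.eventually_const_lt (half_lt_self hn))
    refine Or.inr ⟨k * (‖ContinuousLinearMap.adjoint (P.B p) ξ‖ / 2) / P.β, by positivity,
      min l₀ (min l₁ ε₀), by positivity, fun lam ε hl hlam hε hεl => ?_⟩
    simp only [lt_min_iff] at hlam hεl
    obtain ⟨x, hx, y, hyx, -, hxy⟩ := ha ε hε hεl.2.2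
    obtain ⟨hz, hz'⟩ := hmem lam hl.pos hlam.2.1
    have h1 := h.norm_mul_norm_le_rate (hdrift lam ε hl hlam.1 hε hεl.1).1 hx hyx hz
    rw [h.gradient_add_smul hl hp.1 hξ (h.sublevel_subset_thickening hz)] at h1
    refine le_trans ?_ h1
    have h2 : ‖ContinuousLinearMap.adjoint (P.B p) ξ‖ / 2
      ≤ ‖ContinuousLinearMap.adjoint (P.B (p + lam • ξ)) ξ‖ := le_of_lt hz'
    calc k * (‖ContinuousLinearMap.adjoint (P.B p) ξ‖ / 2) / P.β * ε
        = k * ε * (‖ContinuousLinearMap.adjoint (P.B p) ξ‖ / 2) / P.β := by ring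
      _ ≤ _ := by gcongr

/-- The rise of `w` along closed loop trajectories, if `V` has only the trivial subgradient at its
zeros and `rate` is at least of the order of `ε`. -/
theorem exists_rise_le (h : P.Frame Ω ω δ w C r Vb L) (hρ : IsSmoothMollifier ρ)
    {c : ℝ} (hc : c < sSup (w '' ω) + δ)
    (h0 : ∀ x ∈ sublevel Ω ω w δ, P.value x = 0 → ∀ ξ, IsSubgrad C Ω P.value x ξ → ξ = 0)
    {C₁ η : ℝ} (hC₁ : 0 < C₁) (hη : 0 < η) :
    ∃ l > 0, ∀ lam ε, SmallLam C r Vb lam → lam < l → 0 < ε → ε < l →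
      P.GoodEps Ω ω δ w ρ ε lam → ∀ T, 0 ≤ T → ε * T ≤ C₁ → ∀ y₀ y,
      P.IsClosedLoop {x ∈ Ω | w x ≤ c} (P.feedback (P.smoothValue Ω ρ ε lam)) T y₀ y →
      w (y T) - w (y 0) ≤ (P.rate Ω ω δ w ε lam).toReal * T + η := by
  have hβ := h.standing.β_pos
  have hL := h.L_pos
  have hVb := h.Vb_pos
  have hP := h.standing
  set c₀ := P.excessConst Ω w with hc₀
  have hc0 : 0 ≤ c₀ := h.excessConst_nonneg
  have he0 := h.energyConst_nonneg
  set e := P.energyConst Ω L with he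
  obtain ⟨l₀, hl₀, hdrift⟩ := h.exists_drift_le hρ hc
  set κ := η / (4 * ((c₀ + 1) * C₁)) with hκdef
  have hκ : 0 < κ := by positivity
  obtain ⟨μ, hμ, l₁, hl₁, hsmall⟩ := h.exists_norm_gradient_le hc h0 hκ
  obtain ⟨S, hS, η', hη', hwin⟩ := h.exists_window hμ
  -- This collects the coefficients of the excess on times of large value and on the last window; it
  -- multiplies only `ε` and `λ`. The summand `1` keeps it positive when `c₀ = 0`.
  set A := (c₀ + 1) * (L / η' * S * (Vb + e * C₁) + L * S) with hA
  have hA0 : 0 < A := by positivity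
  refine ⟨min l₀ (min l₁ (η / (4 * A))), by positivity,
    fun lam ε hl hlam hε hεl hg T hT hεT y₀ y hy => ?_⟩
  simp only [lt_min_iff] at hlam hεl
  have hεA : ε * A < η / 4 := by
    have := hεl.2.2
    rw [lt_div_iff₀ (by positivity)] at this
    linarith
  have hlamA : lam * A < η / 4 := by
    have := hlam.2.2
    rw [lt_div_iff₀ (by positivity)] at this
    linarith
  set D := (P.rate Ω ω δ w ε lam).toReal with hD
  have hD0 : 0 ≤ D := ENNReal.toReal_nonneg
  obtain ⟨-, hd⟩ := hdrift lam ε hl hlam.1 hε hεl.1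
  set u := P.feedback (P.smoothValue Ω ρ ε lam) with hu
  have hmem0 := hy.mem 0 (left_mem_Icc.2 hT)
  have huc : Continuous u := h.continuous_feedback hl hρ hε ⟨_, hmem0.1⟩
  have hyΩ : P.IsClosedLoop Ω u T y₀ y := hy.mono le_rfl fun t ht => (hy.mem t ht).1
  have hyS : P.IsClosedLoop (sublevel Ω ω w δ) u T y₀ y := hy.mono le_rfl fun t ht =>
    ⟨(hy.mem t ht).1, (hy.mem t ht).2.trans_lt hc⟩
  have hyc := hyS.isControlled huc
  have hcrude : ∀ t ∈ Icc 0 T, P.lyapDrift w (y t)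
      (gradient (P.smoothValue Ω ρ ε lam) (y t)) ≤ D + c₀ * ε * L := fun t ht => by
    obtain ⟨hm, hQ⟩ := hd (y t) (hy.mem t ht).1 (hy.mem t ht).2
    exact hQ L fun z hz => h.norm_gradient_le hl (h.sublevel_subset_thickening (hm z hz).1)
  -- the last window
  have hlast : ∀ a, 0 ≤ a → a ≤ T → T - a ≤ S →
      w (y T) - w (y a) ≤ D * (T - a) + c₀ * ε * L * S := fun a ha haT haS => by
    have h1 := h.w_sub_le_integral hyΩ ha haT le_rfl (φ := fun _ => D + c₀ * ε * L)
      continuousOn_const fun t ht => hcrude t ⟨ha.trans ht.1, ht.2⟩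
    rw [intervalIntegral.integral_const, smul_eq_mul] at h1
    have h2 : c₀ * ε * L * (T - a) ≤ c₀ * ε * L * S := by gcongr
    linarith
  have hbound1 : c₀ * ε * L * S ≤ ε * A := by
    have h1 : L * S ≤ L / η' * S * (Vb + e * C₁) + L * S := by
      have : 0 ≤ L / η' * S * (Vb + e * C₁) := by positivity
      linarith
    calc c₀ * ε * L * S = ε * (c₀ * (L * S)) := by ring
      _ ≤ ε * ((c₀ + 1) * (L / η' * S * (Vb + e * C₁) + L * S)) := by gcongr; linarith
  rcases le_total T S with hTS | hST
  · have h1 := hlast 0 le_rfl hT (by linarith)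
    rw [sub_zero] at h1
    linarith
  have hTS0 : 0 ≤ T - S := by linarith
  set R : ℝ → ℝ := fun s => ∫ t in (0 : ℝ)..s, P.runCost (fun t => u (y t)) y t with hR
  have hRc : ContinuousOn R (Icc 0 T) := by
    have := intervalIntegral.continuousOn_primitive_interval
      (f := P.runCost (fun t => u (y t)) y) (a := 0) (b := T) (μ := volume) (by
        rw [uIcc_of_le hT]; exact (hyc.continuousOn_runCost hP).integrableOn_Icc)
    rwa [uIcc_of_le hT] at this
  have hRT : R T ≤ Vb + e * lam * T := h.integral_runCost_le hl hg huc hT hyS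
  have hWc : ContinuousOn (fun s => R (s + S) - R s) (Icc 0 (T - S)) :=
    (hRc.comp (by fun_prop) fun s hs => ⟨by linarith [hs.1], by linarith [hs.2]⟩).sub
      (hRc.mono (Icc_subset_Icc_right (by linarith)))
  -- Both cases enter one bound for the gradient. If the window starting at `s` costs at most `η'`,
  -- then `V(y(s)) ≤ μ` and the gradient is at most `κ`; otherwise `L` is at most `L/η'` times the
  -- cost of the window.
  have hwindow : ∀ s ∈ Icc 0 (T - S), P.lyapDrift w (y s)
      (gradient (P.smoothValue Ω ρ ε lam) (y s))
        ≤ D + c₀ * ε * (κ + L / η' * (R (s + S) - R s)) := fun s hs => by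
    have hsT : s ∈ Icc 0 T := ⟨hs.1, by linarith [hs.2]⟩
    have hsS : s + S ≤ T := by linarith [hs.2]
    have h1 := hyc.integral_runCost_shift hP hs.1 hS.le hsS
    have h2 : 0 ≤ R (s + S) - R s := by
      rw [hR]
      simp only
      rw [← h1]
      exact intervalIntegral.integral_nonneg hS.le fun t _ => hP.runCost_nonneg _ _ t
    obtain ⟨hm, hQ⟩ := hd (y s) (hy.mem s hsT).1 (hy.mem s hsT).2
    refine hQ _ fun z hz => ?_
    by_cases hle : R (s + S) - R s ≤ η'
    · have h3 := hwin _ _ (hyc.shift hs.1 hsS) (h1.le.trans hle)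
      simp only [add_zero] at h3
      have h4 := hsmall lam ε hl hlam.2.1 hε hεl.2.1 (y s) (hy.mem s hsT).1 (hy.mem s hsT).2 h3 z hz
      have h5 : 0 ≤ L / η' * (R (s + S) - R s) := by positivity
      linarith
    · push Not at hle
      have h3 := h.norm_gradient_le hl (h.sublevel_subset_thickening (hm z hz).1)
      have h4 : L ≤ L / η' * (R (s + S) - R s) := by
        calc L = L / η' * η' := by field_simp
          _ ≤ _ := by gcongr
      linarith
  have h1 := h.w_sub_le_integral hyΩ le_rfl hTS0 (by linarith : T - S ≤ T)
    (φ := fun s => D + c₀ * ε * (κ + L / η' * (R (s + S) - R s)))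
    (continuousOn_const.add (continuousOn_const.mul (continuousOn_const.add
      (continuousOn_const.mul hWc)))) hwindow
  have hWi : IntervalIntegrable (fun s => R (s + S) - R s) volume 0 (T - S) := by
    refine ContinuousOn.intervalIntegrable ?_
    rwa [uIcc_of_le hTS0]
  have h2 : ∫ s in (0 : ℝ)..(T - S), (D + c₀ * ε * (κ + L / η' * (R (s + S) - R s)))
      = D * (T - S) + c₀ * ε * (κ * (T - S)
        + L / η' * ∫ s in (0 : ℝ)..(T - S), (R (s + S) - R s)) := by
    rw [intervalIntegral.integral_add intervalIntegrable_const
      ((intervalIntegrable_const.add (hWi.const_mul _)).const_mul _),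
      intervalIntegral.integral_const_mul, intervalIntegral.integral_add intervalIntegrable_const
      (hWi.const_mul _), intervalIntegral.integral_const_mul, intervalIntegral.integral_const,
      intervalIntegral.integral_const]
    simp only [sub_zero, smul_eq_mul]
    ring
  rw [h2] at h1
  have h3 : ∫ s in (0 : ℝ)..(T - S), (R (s + S) - R s) ≤ S * R T :=
    hyc.integral_window_le hP hS.le hST
  have h4 := hlast (T - S) hTS0 (by linarith) (by linarith)
  rw [sub_sub_cancel] at h4
  -- The bound `εT ≤ C₁` is what makes the small-gradient part harmless on a long horizon.
  have h5 : c₀ * ε * (κ * (T - S)) ≤ η / 4 := by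
    calc c₀ * ε * (κ * (T - S)) ≤ (c₀ + 1) * ε * (κ * T) := by gcongr <;> linarith
      _ = (c₀ + 1) * κ * (ε * T) := by ring
      _ ≤ (c₀ + 1) * κ * C₁ := by gcongr
      _ = η / 4 := by rw [hκdef]; field_simp
  have h6 : c₀ * ε * (L / η' * ∫ s in (0 : ℝ)..(T - S), (R (s + S) - R s))
      ≤ ε * A + lam * A := by
    calc c₀ * ε * (L / η' * ∫ s in (0 : ℝ)..(T - S), (R (s + S) - R s))
        ≤ c₀ * ε * (L / η' * (S * (Vb + e * lam * T))) := by gcongr; exact h3.trans (by gcongr)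
      _ = ε * (c₀ * (L / η' * S * Vb)) + lam * (c₀ * (L / η' * S * (e * (ε * T)))) := by ring
      _ ≤ ε * A + lam * A := by
        have hX : 0 ≤ L / η' * S := by positivity
        refine add_le_add (mul_le_mul_of_nonneg_left ?_ hε.le)
          (mul_le_mul_of_nonneg_left ?_ hl.pos.le)
        · refine mul_le_mul (by linarith) ?_ (by positivity) (by positivity)
          have h7 : 0 ≤ L / η' * S * (e * C₁) := by positivity
          have h8 : 0 ≤ L * S := by positivity
          linarith
        · refine mul_le_mul (by linarith) ?_ (by positivity) (by positivity)
          have h7 : L / η' * S * (e * (ε * T)) ≤ L / η' * S * (e * C₁) := by gcongr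
          have h8 : 0 ≤ L * S := by positivity
          have h9 : 0 ≤ L / η' * S * Vb := by positivity
          linarith
  linarith

end Frame
end ControlProblem

/-! ### Existence of closed loop trajectories, and the horizon -/

theorem LocallyLipschitz.clm_apply {X Y Z : Type*} [PseudoEMetricSpace X] [NormedAddCommGroup Y]
    [NormedSpace ℝ Y] [NormedAddCommGroup Z] [NormedSpace ℝ Z] {A : X → Y →L[ℝ] Z} {v : X → Y}
    (hA : LocallyLipschitz A) (hv : LocallyLipschitz v) : LocallyLipschitz fun x => A x (v x) :=
  (ContDiff.locallyLipschitz (f := fun p : (Y →L[ℝ] Z) × Y => p.1 p.2)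
    (contDiff_fst.clm_apply contDiff_snd)).comp (hA.prodMk hv)

/-- A curve that cannot be in `s` up to time `t` without being in the open subset `U` of `s` at time
`t` never leaves `s`. -/
theorem forall_mem_of_forall_mem_imp {X : Type*} [TopologicalSpace X] {z : ℝ → X} {s U : Set X}
    {T : ℝ} (hz : Continuous z) (hs : IsClosed s) (hU : IsOpen U) (hUs : U ⊆ s) (h0 : z 0 ∈ s)
    (h : ∀ t ∈ Icc 0 T, (∀ t' ∈ Icc 0 t, z t' ∈ s) → z t ∈ U) : ∀ t ∈ Icc 0 T, z t ∈ s := by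
  -- Times whose whole history `σt`, `σ ∈ [0,1]`, lies in `s`. Including the history keeps the set
  -- closed and makes the hypothesis applicable at each step of the continuous induction.
  set A : Set ℝ := ⋂ σ ∈ Icc (0 : ℝ) 1, {t | z (σ * t) ∈ s} with hA
  have hAc : IsClosed A := isClosed_biInter fun σ _ =>
    hs.preimage (hz.comp (continuous_const.mul continuous_id))
  have hmem : ∀ t, t ∈ A ↔ ∀ σ ∈ Icc (0 : ℝ) 1, z (σ * t) ∈ s := fun t => by simp [hA]
  have hsub : Icc 0 T ⊆ A := by
    refine IsClosed.Icc_subset_of_forall_exists_gt (hAc.inter isClosed_Icc)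
      ((hmem 0).2 fun σ _ => by simpa using h0) fun x hx b hb => ?_
    have hhist : ∀ t ∈ Icc 0 x, z t ∈ s := fun t ht => by
      rcases hx.2.1.eq_or_lt with h1 | h1
      · have : t = 0 := le_antisymm (ht.2.trans h1.symm.le) ht.1
        rwa [this]
      · have := (hmem x).1 hx.1 (t / x) ⟨div_nonneg ht.1 h1.le, (div_le_one h1).2 ht.2⟩
        rwa [div_mul_cancel₀ _ h1.ne'] at this
    obtain ⟨q, hq, hball⟩ := Metric.isOpen_iff.1 (hU.preimage hz) x
      (h x (Ico_subset_Icc_self hx.2) hhist)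
    have hbx : x < b := hb
    set x' := min b (x + q / 2) with hx'
    have h1 : x < x' := lt_min hbx (by linarith)
    have h2 : x' ≤ x + q / 2 := min_le_right _ _
    refine ⟨x', (hmem x').2 fun σ hσ => ?_, h1, min_le_left _ _⟩
    have h3 : 0 ≤ x' := hx.2.1.trans h1.le
    by_cases hle : σ * x' ≤ x
    · exact hhist _ ⟨mul_nonneg hσ.1 h3, hle⟩
    · push Not at hle
      refine hUs (hball ?_)
      rw [Metric.mem_ball, Real.dist_eq, abs_of_pos (by linarith)]
      have := mul_le_mul_of_nonneg_right hσ.2 h3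
      linarith
  intro t ht
  simpa using (hmem t).1 (hsub ht) 1 (by simp)

namespace ControlProblem
variable {d m : ℕ} {P : ControlProblem d m}

theorem IsClosedLoop.eqOn {D : Set (E d)} (hD : Bornology.IsBounded D) {u : E d → E m} {T : ℝ}
    {y₀ : E d} {y z : ℝ → E d} (hX : LocallyLipschitz fun x => P.f x + P.B x (u x))
    (hy : P.IsClosedLoop D u T y₀ y) (hz : P.IsClosedLoop D u T y₀ z) : EqOn y z (Icc 0 T) := by
  obtain ⟨X, K, L, hXK, -, hXe⟩ := hX.exists_lipschitzWith_eqOn hD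
  have hd : ∀ {y : ℝ → E d}, P.IsClosedLoop D u T y₀ y → ∀ t ∈ Ico 0 T,
      HasDerivWithinAt y (X (y t)) (Ici t) t := fun hy t ht => by
    rw [hXe (hy.mem t (Ico_subset_Icc_self ht))]
    exact (hy.deriv t (Ico_subset_Icc_self ht)).mono_of_mem_nhdsWithin (Icc_mem_nhdsGE_of_mem ht)
  exact ODE_solution_unique (v := fun _ => X) (fun _ => hXK) hy.continuousOn (hd hy)
    hz.continuousOn (hd hz) (hy.init.trans hz.init.symm)

/-- `trajectory` is an arbitrary choice among solutions in `Ω`; uniqueness identifies it with the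
solution that stays in `D`. -/
theorem trajectory_isClosedLoop {D Ω : Set (E d)} (hD : D ⊆ Ω) (hΩ : Bornology.IsBounded Ω)
    {u : E d → E m} {T : ℝ} {y₀ : E d} (hX : LocallyLipschitz fun x => P.f x + P.B x (u x))
    (h : y₀ ∈ P.stayingSet D u T) : P.IsClosedLoop D u T y₀ (P.trajectory Ω u T y₀) := by
  obtain ⟨y, hy⟩ := h
  have hyΩ : P.IsClosedLoop Ω u T y₀ y := hy.mono le_rfl fun t ht => hD (hy.mem t ht)
  have hex : ∃ y, P.IsClosedLoop Ω u T y₀ y := ⟨y, hyΩ⟩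
  rw [trajectory, dif_pos hex]
  exact hex.choose_spec.mono le_rfl fun t ht => by
    rw [hex.choose_spec.eqOn hΩ hX hyΩ ht]; exact hy.mem t ht

section Horizon

variable {Ω ω : Set (E d)} {δ θ ε lam k : ℝ} {w : E d → ℝ}

theorem horizon_eq : P.horizon Ω ω δ w θ ε lam k
    = (min (ENNReal.ofReal (θ * δ) / P.rate Ω ω δ w ε lam) (ENNReal.ofReal k)).toReal := rfl

theorem horizon_le (hk : 0 ≤ k) : P.horizon Ω ω δ w θ ε lam k ≤ k := by
  rw [horizon_eq]
  exact (ENNReal.toReal_mono ENNReal.ofReal_ne_top (min_le_right _ _)).trans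
    (ENNReal.toReal_ofReal hk).le

theorem horizon_pos (hθ : 0 < θ * δ) (hk : 0 < k) (hrate : P.rate Ω ω δ w ε lam ≠ ⊤) :
    0 < P.horizon Ω ω δ w θ ε lam k := by
  rw [horizon_eq]
  refine ENNReal.toReal_pos (lt_min ?_ (by simpa using hk)).ne'
    (ne_top_of_le_ne_top ENNReal.ofReal_ne_top (min_le_right _ _))
  exact ENNReal.div_pos (by simpa using hθ) hrate

theorem horizon_mul_rate_le (hθ : 0 ≤ θ * δ) :
    P.horizon Ω ω δ w θ ε lam k * (P.rate Ω ω δ w ε lam).toReal ≤ θ * δ := by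
  rw [horizon_eq, ← ENNReal.toReal_mul]
  refine ENNReal.toReal_le_of_le_ofReal hθ ?_
  exact ENNReal.mul_le_of_le_div (min_le_left _ _)

theorem le_horizon (hθ : 0 < θ * δ) {a : ℝ} (ha : 0 < a) (hk : a ≤ k)
    (hrate : P.rate Ω ω δ w ε lam ≤ ENNReal.ofReal (θ * δ / a)) :
    a ≤ P.horizon Ω ω δ w θ ε lam k := by
  rw [horizon_eq]
  refine (ENNReal.ofReal_le_iff_le_toReal
    (ne_top_of_le_ne_top ENNReal.ofReal_ne_top (min_le_right _ _))).1
    (le_min ?_ (ENNReal.ofReal_le_ofReal hk))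
  rw [ENNReal.ofReal_div_of_pos ha] at hrate
  rw [ENNReal.le_div_iff_mul_le (Or.inr (by simpa using hθ)) (Or.inr ENNReal.ofReal_ne_top),
    mul_comm]
  exact ENNReal.mul_le_of_le_div hrate

end Horizon

/-! ### Confinement to `ω_δ` and the cost estimate -/

namespace Frame
variable {Ω ω : Set (E d)} {δ θ : ℝ} {w : E d → ℝ} {C r Vb L lam ε : ℝ} {ρ : E d → ℝ}

/-- The barrier `(1 + θ)δ/2` is midway between `θδ`, the rise allowed by the rate, and `δ`. In each
of the three situations the excess adds at most `(1 - θ)δ/4`, half of the gap, so the barrier is not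
reached. -/
theorem exists_w_lt (h : P.Frame Ω ω δ w C r Vb L) (hρ : IsSmoothMollifier ρ)
    (hθ : θ ∈ Ioo (0 : ℝ) 1) :
    ∃ l > 0, ∀ lam ε, SmallLam C r Vb lam → lam < l → 0 < ε → ε < l →
      P.GoodEps Ω ω δ w ρ ε lam →
      ∀ T, 0 ≤ T → T * (P.rate Ω ω δ w ε lam).toReal ≤ θ * δ → ∀ y₀ y,
      P.IsClosedLoop {x ∈ Ω | w x ≤ sSup (w '' ω) + (1 + θ) / 2 * δ}
        (P.feedback (P.smoothValue Ω ρ ε lam)) T y₀ y →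
      w (y 0) ≤ sSup (w '' ω) → w (y T) < sSup (w '' ω) + (1 + θ) / 2 * δ := by
  obtain ⟨hθ0, hθ1⟩ := hθ
  have hδ := h.lyap.δ_pos
  have hgap : 0 < (1 - θ) * δ := mul_pos (by linarith) hδ
  have hc : sSup (w '' ω) + (1 + θ) / 2 * δ < sSup (w '' ω) + δ := by nlinarith
  -- integrate a bound on the drift by a multiple of `rate`
  have hint : ∀ {lam ε κ : ℝ} {T : ℝ} {y₀ : E d} {y : ℝ → E d}, 0 ≤ T →
      (∀ x ∈ Ω, w x ≤ sSup (w '' ω) + (1 + θ) / 2 * δ →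
        P.lyapDrift w x (gradient (P.smoothValue Ω ρ ε lam) x)
          ≤ κ * (P.rate Ω ω δ w ε lam).toReal) →
      P.IsClosedLoop {x ∈ Ω | w x ≤ sSup (w '' ω) + (1 + θ) / 2 * δ}
        (P.feedback (P.smoothValue Ω ρ ε lam)) T y₀ y →
      w (y T) - w (y 0) ≤ κ * (T * (P.rate Ω ω δ w ε lam).toReal) :=
    fun {lam ε κ T y₀ y} hT hd hy => by
      have h1 := h.w_sub_le_integral (hy.mono le_rfl fun t ht => (hy.mem t ht).1) le_rfl hT le_rfl
        (φ := fun _ => κ * (P.rate Ω ω δ w ε lam).toReal) continuousOn_const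
        fun t ht => hd _ (hy.mem t ht).1 (hy.mem t ht).2
      rw [intervalIntegral.integral_const, smul_eq_mul, sub_zero] at h1
      linarith
  by_cases h0 : ∀ x ∈ sublevel Ω ω w δ, P.value x = 0 → ∀ ξ, IsSubgrad C Ω P.value x ξ → ξ = 0
  · rcases h.exists_drift_le_or_le_rate hρ hc h0 with ⟨l, hl0, hd⟩ | ⟨k, hk, l, hl0, hrate⟩
    · refine ⟨l, hl0, fun lam ε hl hlam hε hεl _ T hT hTr y₀ y hy hy0 => ?_⟩
      have h1 := hint (κ := 1) hT (by simpa using hd lam ε hl hlam hε hεl) hy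
      nlinarith
    -- From `kε ≤ rate` and `T · rate ≤ θδ` follows `εT ≤ θδ/k`.
    · obtain ⟨l', hl', hrise⟩ := h.exists_rise_le hρ hc h0 (C₁ := θ * δ / k)
        (η := (1 - θ) * δ / 4) (by positivity) (by positivity)
      refine ⟨min l l', by positivity, fun lam ε hl hlam hε hεl hg T hT hTr y₀ y hy hy0 => ?_⟩
      simp only [lt_min_iff] at hlam hεl
      have h2 := mul_le_mul_of_nonneg_left (hrate lam ε hl hlam.1 hε hεl.1) hT
      have h1 := hrise lam ε hl hlam.2 hε hεl.2 hg T hT (by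
        rw [le_div_iff₀ hk]; linarith) y₀ y hy
      nlinarith
  · push Not at h0
    obtain ⟨x₀, hx₀, hV, ξ, hξ, hξ0⟩ := h0
    obtain ⟨l, hl0, hd⟩ := h.exists_drift_le_of_ne_zero hρ hc hx₀ hV hξ hξ0
      (κ := (1 - θ) / (4 * θ)) (div_pos (by linarith) (by linarith))
    refine ⟨l, hl0, fun lam ε hl hlam hε hεl hg T hT hTr y₀ y hy hy0 => ?_⟩
    have h1 := hint hT (hd lam ε hl hlam hε hεl hg) hy
    have hκ : 0 ≤ (1 - θ) / (4 * θ) := div_nonneg (by linarith) (by linarith)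
    have h2 := mul_le_mul_of_nonneg_left hTr (show 0 ≤ 1 + (1 - θ) / (4 * θ) by linarith)
    have h3 : (1 + (1 - θ) / (4 * θ)) * (θ * δ) = θ * δ + (1 - θ) * δ / 4 := by
      field_simp
    nlinarith

theorem locallyLipschitz_feedback (h : P.Frame Ω ω δ w C r Vb L) (hl : SmallLam C r Vb lam)
    (hρ : IsSmoothMollifier ρ) (hε : 0 < ε) (hne : Ω.Nonempty) :
    LocallyLipschitz (P.feedback (P.smoothValue Ω ρ ε lam)) := by
  have hs : ContDiff ℝ (⊤ : ℕ∞) (P.smoothValue Ω ρ ε lam) :=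
    hρ.contDiff_mollify hε (h.continuous_moreau hl hne)
  have hf : LocallyLipschitz (fderiv ℝ (P.smoothValue Ω ρ ε lam)) :=
    (hs.fderiv_right (m := 1) (by norm_cast)).locallyLipschitz
  have hg : LocallyLipschitz (gradient (P.smoothValue Ω ρ ε lam)) :=
    (InnerProductSpace.toDual ℝ (E d)).symm.lipschitz.locallyLipschitz.comp hf
  have ha : LocallyLipschitz fun x => ContinuousLinearMap.adjoint (P.B x) :=
    (ContinuousLinearMap.adjoint (𝕜 := ℝ) (E := E m)
      (F := E d)).lipschitz.locallyLipschitz.comp h.standing.B_lip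
  have hsm : LocallyLipschitz fun v : E m => -(P.β⁻¹ • v) :=
    ContDiff.locallyLipschitz (𝕂 := ℝ) (f := fun v : E m => -(P.β⁻¹ • v)) (by fun_prop)
  exact hsm.comp (ha.clm_apply hg)

theorem locallyLipschitz_field (h : P.Frame Ω ω δ w C r Vb L) {u : E d → E m}
    (hu : LocallyLipschitz u) : LocallyLipschitz fun x => P.f x + P.B x (u x) :=
  h.standing.f_lip.add (h.standing.B_lip.clm_apply hu)

/-- The field is replaced by a globally Lipschitz one, whose flow always exists. As long as that
flow respects the barrier it is a genuine closed loop, and then `hstay` makes the inequality strict;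
hence the barrier is never crossed. -/
theorem exists_isClosedLoop (h : P.Frame Ω ω δ w C r Vb L) (hθ : θ < 1) {u : E d → E m}
    (hu : LocallyLipschitz u) {T : ℝ} {y₀ : E d} (hy₀ : y₀ ∈ Ω) (hw : w y₀ ≤ sSup (w '' ω))
    (hθ0 : 0 < θ)
    (hstay : ∀ t ∈ Icc 0 T, ∀ y,
      P.IsClosedLoop {x ∈ Ω | w x ≤ sSup (w '' ω) + (1 + θ) / 2 * δ} u t y₀ y →
      w (y t) < sSup (w '' ω) + (1 + θ) / 2 * δ) :
    ∃ y, P.IsClosedLoop (sublevel Ω ω w δ) u T y₀ y := by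
  have hδ := h.lyap.δ_pos
  have hc : sSup (w '' ω) + (1 + θ) / 2 * δ < sSup (w '' ω) + δ := by nlinarith
  obtain ⟨X, K, L', hX, hL', hXe⟩ :=
    (h.locallyLipschitz_field hu).exists_lipschitzWith_eqOn h.bounded
  obtain ⟨z, hz0, hz⟩ := hX.exists_flow hL' y₀
  have hzc : Continuous z := continuous_iff_continuousAt.2 fun t => (hz t).continuousAt
  have hcl : ∀ {t : ℝ} {D : Set (E d)}, D ⊆ Ω → (∀ s ∈ Icc 0 t, z s ∈ D) →
      P.IsClosedLoop D u t y₀ z := fun {t D} hD hmem =>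
    ⟨hz0, fun s hs => by
      have h1 := (hz s).hasDerivWithinAt (s := Icc 0 t)
      rw [hXe (hD (hmem s hs))] at h1
      exact h1, hmem⟩
  have hmem := forall_mem_of_forall_mem_imp (T := T) hzc (h.isCompact_sublevel_le hc).isClosed
    (U := {x ∈ Ω | w x < sSup (w '' ω) + (1 + θ) / 2 * δ})
    (h.continuousOn_w.isOpen_inter_preimage h.isOpen isOpen_Iio)
    (fun x hx => ⟨hx.1, le_of_lt hx.2⟩)
    (by rw [hz0]; exact ⟨hy₀, by nlinarith⟩) fun t ht hist =>
      ⟨(hist t (right_mem_Icc.2 ht.1)).1, hstay t ht z (hcl (fun x hx => hx.1) hist)⟩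
  exact ⟨z, hcl sublevel_subset fun t ht => ⟨(hmem t ht).1, (hmem t ht).2.trans_lt hc⟩⟩

/-- The defect is non-negative because following the feedback and then almost optimal controls is a
competitor in the definition of `V`. The upper bound is the energy inequality for `M_λV`, with `M_λV
≤ V` at the start and `V ≤ M_λV + η` at the end. -/
theorem abs_feedbackCost_le (h : P.Frame Ω ω δ w C r Vb L) (hl : SmallLam C r Vb lam)
    (hρ : IsSmoothMollifier ρ) (hε : 0 < ε) (hg : P.GoodEps Ω ω δ w ρ ε lam) {T η : ℝ}
    (hT : 0 ≤ T) (hη : ∀ y ∈ sublevel Ω ω w δ, P.value y - moreau Ω P.value lam y ≤ η) {y₀ : E d}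
    (hy₀ : y₀ ∈ P.stayingSet (sublevel Ω ω w δ) (P.feedback (P.smoothValue Ω ρ ε lam)) T) :
    |P.feedbackCost Ω (P.feedback (P.smoothValue Ω ρ ε lam)) T y₀
      + P.value (P.trajectory Ω (P.feedback (P.smoothValue Ω ρ ε lam)) T y₀ T) - P.value y₀|
      ≤ P.energyConst Ω L * lam * T + η := by
  have hne : Ω.Nonempty := by
    obtain ⟨y, hy⟩ := hy₀
    exact ⟨_, (hy.mem 0 (left_mem_Icc.2 hT)).1⟩
  have hu := h.locallyLipschitz_feedback hl hρ hε hne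
  have hy := trajectory_isClosedLoop sublevel_subset h.bounded (h.locallyLipschitz_field hu) hy₀
  have h1 := h.closedLoop_energy_le hl hg hu.continuous hT hy
  have hyc := hy.isControlled hu.continuous
  have h2 := h.standing.value_le h.fin hT hyc.cont hyc.continuousOn
    fun t ht => hyc.eq_integral h.standing ht
  have h3 := hη _ (hy.mem T (right_mem_Icc.2 hT))
  have h4 := moreau_le_self hl.pos (nonneg P Ω) (hy.mem 0 (left_mem_Icc.2 hT)).1
  rw [hy.init] at h1 h2 h4
  have h5 : P.feedbackCost Ω (P.feedback (P.smoothValue Ω ρ ε lam)) T y₀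
      = ∫ t in (0 : ℝ)..T, P.runCost (fun t => P.feedback (P.smoothValue Ω ρ ε lam)
        (P.trajectory Ω (P.feedback (P.smoothValue Ω ρ ε lam)) T y₀ t))
        (P.trajectory Ω (P.feedback (P.smoothValue Ω ρ ε lam)) T y₀) t := rfl
  rw [h5, abs_of_nonneg (by linarith)]
  linarith

end Frame
end ControlProblem

/-! ### Assembly of the theorem -/

theorem mainTheorem3 {d m : ℕ} (P : ControlProblem d m) (hP : P.Standing)
    (hVfin : ∀ y₀, P.valueENN y₀ ≠ ⊤) (hVcont : Continuous P.value)
    (Ω ω : Set (E d)) (hΩo : IsOpen Ω) (hΩb : Bornology.IsBounded Ω) (hΩc : Convex ℝ Ω)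
    (hωo : IsOpen ω) (hωne : ω.Nonempty) (hωΩ : closure ω ⊆ Ω)
    (δ : ℝ) (w : E d → ℝ) (hw : ContDiffOn ℝ 1 w (closure Ω))
    (hL : P.Lyapunov Ω ω δ w P.value 0)
    (hδΩ : closure (sublevel Ω ω w δ) ⊆ Ω)
    (C : ℝ) (hC : 0 < C) (hV : SemiconvexOn C Ω P.value)
    (ρ : E d → ℝ) (hρ : IsSmoothMollifier ρ) :
    ∃ lam₀ : ℝ, 0 < lam₀ ∧
      -- the Moreau envelope is differentiable on `ω_δ`, and all small `ε` are good
      (∀ lam ∈ Ioo 0 lam₀,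
        (∀ x ∈ sublevel Ω ω w δ, DifferentiableAt ℝ (moreau Ω P.value lam) x) ∧
        ∃ ε₀ : ℝ, 0 < ε₀ ∧ ∀ ε ∈ Ioo 0 ε₀, P.GoodEps Ω ω δ w ρ ε lam) ∧
      -- for every good choice `ε(λ) → 0`
      ∀ ε : ℝ → ℝ, (∀ lam ∈ Ioo 0 lam₀, 0 < ε lam ∧ P.GoodEps Ω ω δ w ρ (ε lam) lam) →
        Tendsto ε (𝓝[>] 0) (𝓝 0) →
      ∀ θ ∈ Ioo (0 : ℝ) 1, ∃ lam₁ ∈ Ioc 0 lam₀,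
      ∀ κ : ℝ → ℝ, (∀ s, 0 < s → 0 < κ s) →
        Tendsto κ (𝓝[>] 0) atTop → Tendsto (fun s => κ s * s) (𝓝[>] 0) (𝓝 0) →
      ∀ (u : ℝ → E d → E m) (τ : ℝ → ℝ),
        (∀ lam, u lam = P.feedback (P.smoothValue Ω ρ (ε lam) lam)) →
        (∀ lam, τ lam = P.horizon Ω ω δ w θ (ε lam) lam (κ lam)) →
        (∀ lam ∈ Ioo 0 lam₁, P.Admissible Ω (u lam) ω (τ lam) ∧
          ω ⊆ P.stayingSet (sublevel Ω ω w δ) (u lam) (τ lam)) ∧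
        Tendsto τ (𝓝[>] 0) atTop ∧
        Tendsto (fun lam => supNorm
            (fun y₀ => P.feedbackCost Ω (u lam) (τ lam) y₀
              + P.value (P.trajectory Ω (u lam) (τ lam) y₀ (τ lam)) - P.value y₀)
            (P.stayingSet (sublevel Ω ω w δ) (u lam) (τ lam)))
          (𝓝[>] 0) (𝓝 0) := by
  obtain ⟨r, Vb, L, h⟩ := ControlProblem.exists_frame hP hVfin hVcont hΩo hΩb hw hL hδΩ hC hV
  have hr := h.r_pos
  have hVb := h.Vb_pos
  have hδ := hL.δ_pos
  have hωsub : ω ⊆ Ω := subset_closure.trans hωΩ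
  have hwle : ∀ y ∈ ω, w y ≤ sSup (w '' ω) := fun y hy =>
    le_csSup ((hΩb.isCompact_closure.bddAbove_image hw.continuousOn).mono
      (image_mono (hωsub.trans subset_closure))) (mem_image_of_mem w hy)
  have hΩne : Ω.Nonempty := hωne.mono hωsub
  -- The two bounds are `λC ≤ 1/2`, for regularity of the envelope, and `4λVb ≤ r²`, for `Ω_V^λ` and
  -- for the distance to proximal points.
  set lam₀ : ℝ := min (1 / (2 * C)) (r ^ 2 / (4 * Vb)) with hlam₀
  have hlam₀0 : 0 < lam₀ := by positivity
  have hVl : ∀ lam ∈ Ioo 0 lam₀, 4 * lam * Vb ≤ r ^ 2 := fun lam hlam => by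
    have h1 := hlam.2.le.trans (min_le_right _ _)
    rw [le_div_iff₀ (by positivity)] at h1
    linarith
  have hsmall : ∀ lam ∈ Ioo 0 lam₀, ControlProblem.SmallLam C r Vb lam := fun lam hlam => by
    refine ⟨hlam.1, ?_, ?_⟩
    · have h1 := hlam.2.le.trans (min_le_left _ _)
      rw [le_div_iff₀ (by positivity)] at h1
      linarith
    · have h1 := hVl lam hlam
      have h2 := mul_pos hlam.1 hVb
      linarith
  refine ⟨lam₀, hlam₀0, fun lam hlam => ⟨fun x hx => (h.hasGradientAt (hsmall lam hlam)
    (h.sublevel_subset_thickening hx)).differentiableAt,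
    h.exists_goodEps (hsmall lam hlam) (hVl lam hlam) hρ⟩, ?_⟩
  intro ε hε hε0 θ hθ
  have hθδ : 0 < θ * δ := mul_pos hθ.1 hδ
  have hid : Tendsto (fun lam : ℝ => lam) (𝓝[>] 0) (𝓝 0) := nhdsWithin_le_nhds
  have hIoo : ∀ l : ℝ, 0 < l → ∀ᶠ lam in 𝓝[>] (0 : ℝ), lam ∈ Ioo 0 l := fun l hl =>
    Ioo_mem_nhdsGT hl
  obtain ⟨l₁, hl₁, hstay⟩ := h.exists_w_lt hρ hθ
  obtain ⟨l₂, hl₂, hrate⟩ := h.exists_rate_le one_pos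
  obtain ⟨l₃, hl₃, hεsmall⟩ := mem_nhdsGT_iff_exists_Ioo_subset.1
    (hε0.eventually_lt_const (lt_min hl₁ hl₂))
  have hl₃' : 0 < l₃ := hl₃
  -- The threshold does not involve `κ`: confinement only uses that the horizon times the rate is at
  -- most `θδ`. The bound `l₃` turns the smallness required of `ε(λ)` into smallness of `λ`.
  refine ⟨min lam₀ (min l₁ (min l₂ l₃)), ⟨by positivity, min_le_left _ _⟩, ?_⟩
  intro κ hκ hκtop hκ0 u τ hu hτ
  refine ⟨fun lam hlam => ?_, ?_, ?_⟩
  · have hlam' := hlam.2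
    simp only [lt_min_iff] at hlam'
    obtain ⟨a0, a1, a2, a3⟩ := hlam'
    have hl := hsmall lam ⟨hlam.1, a0⟩
    obtain ⟨hε1, hg⟩ := hε lam ⟨hlam.1, a0⟩
    have hε2 : ε lam < min l₁ l₂ := hεsmall ⟨hlam.1, a3⟩
    rw [lt_min_iff] at hε2
    have hrt := ne_top_of_le_ne_top ENNReal.ofReal_ne_top (hrate lam _ hl a2 hε1 hε2.2)
    have hulip := h.locallyLipschitz_feedback hl hρ hε1 hΩne
    have hτ0 : 0 < τ lam := by
      rw [hτ]; exact ControlProblem.horizon_pos hθδ (hκ lam hlam.1) hrt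
    have hτr : τ lam * (P.rate Ω ω δ w (ε lam) lam).toReal ≤ θ * δ := by
      rw [hτ]; exact ControlProblem.horizon_mul_rate_le hθδ.le
    have hex : ω ⊆ P.stayingSet (sublevel Ω ω w δ) (u lam) (τ lam) := fun y₀ hy₀ => by
      rw [hu]
      refine h.exists_isClosedLoop hθ.2 hulip (hωsub hy₀) (hwle y₀ hy₀) hθ.1 fun t ht y hy => ?_
      refine hstay lam _ hl a1 hε1 hε2.1 hg t ht.1 ?_ y₀ y hy (by rw [hy.init]; exact hwle y₀ hy₀)
      exact (mul_le_mul_of_nonneg_right ht.2 ENNReal.toReal_nonneg).trans hτr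
    refine ⟨⟨by rw [hu]; exact hulip.locallyLipschitzOn, hτ0, fun y₀ hy₀ => ?_⟩, hex⟩
    obtain ⟨y, hy⟩ := hex hy₀
    exact ⟨y, hy.mono le_rfl fun t ht => (hy.mem t ht).1⟩
  · refine tendsto_atTop.2 fun a => ?_
    obtain ⟨b, hb0, hab⟩ : ∃ b > 0, a ≤ b := ⟨max a 1, by positivity, le_max_left _ _⟩
    obtain ⟨l, hl0, hrl⟩ := h.exists_rate_le (η := θ * δ / b) (by positivity)
    filter_upwards [hIoo _ hlam₀0, hIoo _ hl0, hε0.eventually_lt_const hl0,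
      hκtop.eventually_ge_atTop b] with lam h1 h2 h3 h4
    rw [hτ]
    exact hab.trans (ControlProblem.le_horizon hθδ hb0 h4
      (hrl lam _ (hsmall lam h1) h2.2 (hε lam h1).1 h3))
  · refine ENNReal.tendsto_nhds_zero.2 fun η hη => ?_
    obtain ⟨a, ha0, haη⟩ : ∃ a : ℝ, 0 < a ∧ ENNReal.ofReal a ≤ η := by
      obtain ⟨a, -, h1, h2⟩ := ENNReal.lt_iff_exists_real_btwn.1 hη
      exact ⟨a, by simpa using h1, h2.le⟩
    obtain ⟨l, hl0, hVM⟩ := h.exists_value_sub_moreau_le (half_pos ha0)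
    have hlim : Tendsto (fun lam => P.energyConst Ω L * (κ lam * lam)) (𝓝[>] 0) (𝓝 0) := by
      simpa using hκ0.const_mul (P.energyConst Ω L)
    filter_upwards [hIoo _ hlam₀0, hIoo _ hl0, hlim.eventually_lt_const (half_pos ha0)]
      with lam h1 h2 h3
    have hl := hsmall lam h1
    have hτκ : τ lam ≤ κ lam := by
      rw [hτ]; exact ControlProblem.horizon_le (hκ lam h1.1).le
    have hτ0 : 0 ≤ τ lam := by rw [hτ]; exact ENNReal.toReal_nonneg
    refine (supNorm_le_ofReal fun y₀ hy₀ => ?_).trans haη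
    rw [hu] at hy₀ ⊢
    rw [Real.norm_eq_abs]
    refine (h.abs_feedbackCost_le hl hρ (hε lam h1).1 (hε lam h1).2 hτ0
      (hVM lam hl h2.2) hy₀).trans ?_
    -- The horizon enters the error only through `λτ_λ ≤ κ(λ)λ`, which tends to `0`.
    have h4 := mul_le_mul_of_nonneg_left hτκ (mul_nonneg h.energyConst_nonneg h1.1.le)
    linarith
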